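/- Let $p$ be a fixed prime, let $p_1<p_2<\cdots$ be the sequence of all primes, and let $\Phi_m$ be the $m$-th cyclotomic polynomial. For a positive integer $N$ let $r$ be the smallest positive integer with $N<\Phi_1(p)\Phi_{p_1}(p)\cdots\Phi_{p_r}(p)$ (it exists), and put $$s=\Phi_1(p)\Phi_{p_1}(p)\cdots\Phi_{p_r}(p),\qquad d=p_1p_2\cdots p_r .$$ Then $[\mathbb{Q}_p(\zeta_s):\mathbb{Q}_p]=d$, where $\zeta_s$ is a primitive $s$-th root of unity. Consider the following randomized algorithm, with input $N\ge 1$, a precision parameter $n\ge 0$ and $f\in\mathbb{Q}_p[X]$ with $\deg f<s$. Its cost is the number of arithmetic operations in $\mathbb{F}_p$ and $\mathbb{Q}_p$; extensions are handled as $K[X]/(F)$ with schoolbook multiplication. (1) Starting from $\mathbb{F}_p$, adjoin roots of unity for the prime factors $\ell$ of $s$, taken in increasing order with multiplicity: given $\mathbb{F}_p(\zeta_a)$ with $\ell^v$ exactly dividing $a$, find by the Cantor–Zassenhaus algorithm an irreducible factor of $\Phi_\ell$ (if $v=0$) or of $X^\ell-\zeta_{\ell^v}$ (if $v>0$), and compute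 the minimal polynomial over $\mathbb{F}_p$ of a primitive $a\ell$-th root of unity by expanding the product over its conjugates. (In a round of Cantor–Zassenhaus a uniformly random polynomial $g$ of degree less than that of the polynomial to be factored is used, with exponent $(q^e-1)/2$ for odd $p$ and $(q^e-1)/3$ for $p=2$, where $q$ is the size of the current field and $e$ the degree of the irreducible factors.) (2) Lift the resulting irreducible factor of $\Phi_s\in\mathbb{F}_p[X]$ to the monic $F\in\mathbb{Z}[X]$ with non-leading coefficients in $\{0,\dots,p-1\}$ and, in $\mathbb{Z}_p[X]/(F)$, perform $n$ Newton steps $\alpha\mapsto\alpha-\frac1s(\alpha^s-1)\alpha(2-\alpha^s)\bmod p^{2^i}$, $i=1,\dots,n$, starting from $\alpha=X$. (3) Run the mixed-radix Cooley–Tukey FFT of length $s$, with the prime factors of $s$ as radices, in $\mathbb{Q}_p[X]/(F)$ on the coefficients of $f$, with $\alpha$ as root of unity. Then: (a) Whenever the algorithm returns, $F$ is irreducible over $\mathbb{Q}_p$ of degree $d$, and $\mathbb{Q}_p[X]/(F)$ contains a primitive $s$-th root of unity $\zeta_s$ whose coordinates in the basis $1,X,\dots,X^{d-1}$ agree with those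 of $\alpha$ up to $p^{-2^n}$ in absolute value. The FFT of step (3) run at $\zeta_s$ itself gives exactly $(f(1),f(\zeta_s),\dots,f(\zeta_s^{s-1}))$, and the computed values agree with these, coordinatewise, up to $p^{-2^n}B$, where $B$ is any bound for the absolute values of the coefficients of $f$. If every call of Cantor–Zassenhaus is cut off after $k$ rounds, the probability that the algorithm is cut off tends to $0$ as $k\to\infty$. (b) For every $\varepsilon>0$ there is a constant $C$, depending only on $p$ and $\varepsilon$, such that for all $N$, $n$, $f$ the FFT of length $s$ over a degree-$d$ extension $\mathbb{Q}_p[X]/(F)$ costs at most $C N^{1+\varepsilon}$ operations, and the whole algorithm, including the computation of the root of unity, has expected cost at most $C\,(N^{1+\varepsilon}+nN^{\varepsilon})$ (also when it is cut off after any number of rounds). In particular, for fixed precision the cost is $O(N^{1+o(1)})$, where $O(N^{1+o(1)})=\bigcap_{\varepsilon>0}O(N^{1+\varepsilon})$. -/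

import Mathlib

namespace PadicFFT

open Polynomial

/-! ### Counting arithmetic operations -/

/-- The result of a deterministic computation together with the number of arithmetic operations
(in the base field or base ring) that it has performed. -/
structure Counted (α : Type) where
  val : α
  ops : ℕ

instance : Monad Counted where
  pure a := ⟨a, 0⟩
  bind x f := ⟨(f x.val).val, x.ops + (f x.val).ops⟩

/-- `f` applied to all entries of a list; the operations are added up. -/
def mapList {α β : Type} (f : α → Counted β) : List α → Counted (List β)
  | [] => pure []
  | a :: l => do
    let b ← f a
    let m ← mapList f l
    pure (b :: m)

/-- `f` applied entrywise to two lists; the operations are added up. -/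
def zipLists {α β γ : Type} (f : α → β → Counted γ) : List α → List β → Counted (List γ)
  | a :: l, b :: m => do
    let c ← f a b
    let n ← zipLists f l m
    pure (c :: n)
  | _, _ => pure []

/-- Left fold over a list; the operations are added up. -/
def foldList {α β : Type} (f : β → α → Counted β) : β → List α → Counted β
  | b, [] => pure b
  | b, a :: l => do
    let b' ← f b a
    foldList f b' l

/-- Ring operations on a set of representatives, each with its cost. -/
structure Arith (R : Type) where
  zero : R
  one : R
  add : R → R → Counted R
  sub : R → R → Counted R
  mul : R → R → Counted R

/-- The base ring itself: every addition, subtraction and multiplication costs one operation. -/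
def Arith.base (K : Type) [CommRing K] : Arith K where
  zero := 0
  one := 1
  add a b := ⟨a + b, 1⟩
  sub a b := ⟨a - b, 1⟩
  mul a b := ⟨a * b, 1⟩

/-! ### Polynomials and residue class rings

A list of coefficients, *highest degree first*, stands for a polynomial. A monic polynomial
`X ^ d + c₁ X ^ (d - 1) + ⋯ + c_d` is stored without its leading coefficient, as `[c₁, …, c_d]`,
so that its degree is the length of the list; this is called its tail. An element of `R[X]/(f)`
with `f` monic of degree `d` is a list of length `d`. -/

namespace Arith

variable {R : Type} (A : Arith R)

/-- Repeated squaring; the exponent is given by its binary digits, lowest digit first. -/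
def powBits (a : R) : List Bool → Counted R
  | [] => pure A.one
  | b :: bs => do
    let t ← powBits a bs
    let u ← A.mul t t
    if b then A.mul u a else pure u

/-- `a ^ n` by repeated squaring. -/
def pow (a : R) (n : ℕ) : Counted R := A.powBits a n.bits

/-- `x - h • y`, entrywise. -/
def subScaled (h : R) (x y : List R) : Counted (List R) :=
  zipLists (fun u v => do
    let w ← A.mul h v
    A.sub u w) x y

/-- `x + h • y`, entrywise. -/
def addScaled (h : R) (x y : List R) : Counted (List R) :=
  zipLists (fun u v => do
    let w ← A.mul h v
    A.add u w) x y

/-- The constant `c` in `R[X]/(f)`, `deg f = d`. -/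
def const (d : ℕ) (c : R) : List R := List.replicate (d - 1) A.zero ++ [c]

/-- Multiplication by `X` in `R[X]/(f)`, where `f` is the tail of the monic modulus. -/
def mulX (f : List R) : List R → Counted (List R)
  | [] => pure []
  | h :: t => A.subScaled h (t ++ [A.zero]) f

/-- The ring `R[X]/(f)`, where `f` is the tail of the monic modulus. Multiplication is the
schoolbook method: for the coefficients `c` of `a` from the highest to the lowest, the accumulator
is replaced by `X * acc + c * b`. -/
def quot (f : List R) : Arith (List R) where
  zero := List.replicate f.length A.zero
  one := A.const f.length A.one
  add := zipLists A.add
  sub := zipLists A.sub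
  mul a b := foldList (fun acc c => do
    let acc' ← A.mulX f acc
    A.addScaled c acc' b) (List.replicate f.length A.zero) a

/-- The class of `X` in `R[X]/(f)`. -/
def gen (f : List R) : Counted (List R) := A.mulX f (A.quot f).one

/-- Schoolbook division by the monic polynomial with tail `u`: `k` steps of the division,
returning quotient and remainder. -/
def divSteps (u : List R) : ℕ → List R → Counted (List R × List R)
  | 0, a => pure ([], a)
  | _ + 1, [] => pure ([], [])
  | k + 1, h :: t => do
    let t' ← A.subScaled h (t.take u.length) u
    let qr ← divSteps u k (t' ++ t.drop u.length)
    pure (h :: qr.1, qr.2)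

/-- Quotient and remainder of `a` by the monic polynomial with tail `u`. -/
def divMod (a u : List R) : Counted (List R × List R) := A.divSteps u (a.length - u.length) a

/-- Euclid's algorithm over a field with `q` elements, for the monic polynomial with tail `u` and
an arbitrary polynomial `a`; the result is the tail of the monic gcd. Leading coefficients are
inverted as `c⁻¹ = c ^ (q - 2)`. The first argument bounds the number of divisions. -/
def gcdSteps [DecidableEq R] (q : ℕ) : ℕ → List R → List R → Counted (List R)
  | 0, u, _ => pure u
  | k + 1, u, a => do
    let qr ← A.divMod a u
    match qr.2.dropWhile (fun c => decide (c = A.zero)) with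
    | [] => pure u
    | c :: t => do
      let i ← A.pow c (q - 2)
      let t' ← mapList (A.mul i) t
      gcdSteps q k t' (A.one :: u)

/-- Tail of the monic gcd of the monic polynomial with tail `u` and the polynomial `a`. -/
def gcd [DecidableEq R] (q : ℕ) (u a : List R) : Counted (List R) :=
  A.gcdSteps q (u.length + 1) u a

/-- Tail of the monic polynomial `∏ (T - z)`, `z` running over the list. -/
def expand (zs : List R) : Counted (List R) :=
  foldList (fun c z => A.subScaled z (c ++ [A.zero]) (A.one :: c)) [] zs

/-- The list `[z, g z, g (g z), …]` with `k` entries. -/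
def iterates (g : R → Counted R) : ℕ → R → Counted (List R)
  | 0, _ => pure []
  | 1, z => pure [z]
  | k + 2, z => do
    let z' ← g z
    let l ← iterates g (k + 1) z'
    pure (z :: l)

/-! ### The Cooley–Tukey transform -/

/-- Value at `x` of the polynomial with the given coefficients, *lowest degree first*. -/
def horner (x : R) : List R → Counted R
  | [] => pure A.zero
  | c :: l => do
    let v ← horner x l
    let w ← A.mul v x
    A.add w c

/-- The mixed radix Cooley–Tukey FFT of length `n = m₁ m₂ ⋯` for the list `[m₁, m₂, …]` of radices,
a root of unity `ω` with `ω ^ n = 1` and the coefficients `a₀, …, a_{n-1}` (lowest degree first).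
For `n = m n'` the sequences `(a_{m k + j})_k`, `j < m`, are transformed recursively with `ω ^ m`,
and entry `i` of the result is `∑ j < m, (ω ^ i) ^ j * (transform j)_{i mod n'}`. -/
def fft : List ℕ → R → List R → Counted (List R)
  | [], _, a => pure [a.headD A.zero]
  | m :: ms, ω, a => do
    let ωm ← A.pow ω m
    let parts ← mapList (fun j =>
      fft ms ωm ((List.range ms.prod).map fun k => a.getD (m * k + j) A.zero)) (List.range m)
    let points ← iterates (fun z => A.mul z ω) (m * ms.prod) A.one
    mapList (fun xi : R × ℕ =>
      A.horner xi.1 (parts.map fun b => b.getD (xi.2 % ms.prod) A.zero)) points.zipIdx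

end Arith

/-! ### Randomized computations -/

/-- A randomized computation: the joint law of its result (`none` if it was cut off) and of the
number of arithmetic operations performed. -/
def Rand (α : Type) : Type := PMF (Option α × ℕ)

namespace Rand

/-- The law of result and number of operations. -/
def law {α : Type} (x : Rand α) : PMF (Option α × ℕ) := x

noncomputable instance : Monad Rand where
  pure a := PMF.pure (some a, 0)
  bind x f := PMF.bind x.law fun r =>
    match r.1 with
    | none => PMF.pure (none, r.2)
    | some a => PMF.map (fun y => (y.1, r.2 + y.2)) (f a).law

/-- A deterministic computation. -/
noncomputable def lift {α : Type} (c : Counted α) : Rand α := PMF.pure (some c.val, c.ops)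

/-- Cut off. -/
noncomputable def cutOff {α : Type} : Rand α := PMF.pure (none, 0)

/-- A random sample; sampling performs no arithmetic operation. -/
noncomputable def sample {α : Type} (μ : PMF α) : Rand α := PMF.map (fun a => (some a, 0)) μ

/-- `a` is a possible result. -/
def CanReturn {α : Type} (x : Rand α) (a : α) : Prop := ∃ c, (some a, c) ∈ x.law.support

/-- The probability that the computation is cut off. -/
noncomputable def cutOffProb {α : Type} (x : Rand α) : ENNReal := ∑' c, x.law (none, c)

/-- The expected number of arithmetic operations. -/
noncomputable def expectedOps {α : Type} (x : Rand α) : ENNReal :=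
  ∑' r, x.law r * (r.2 : ENNReal)

end Rand

section FiniteField

variable (p : ℕ) [Fact p.Prime]

/-! ### An irreducible factor of the `s`-th cyclotomic polynomial over `𝔽_p` -/

/-- The field `𝔽_p[Y]/(fY)`. -/
def ext (fY : List (ZMod p)) : Arith (List (ZMod p)) := (Arith.base (ZMod p)).quot fY

/-- A uniformly distributed polynomial of degree `< m` over `𝔽_p[Y]/(fY)`, `deg fY = D`. -/
noncomputable def randomPoly (D m : ℕ) : PMF (List (List (ZMod p))) :=
  PMF.map (fun g : Fin m → Fin D → ZMod p => List.ofFn fun i => List.ofFn (g i))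
    (PMF.uniformOfFintype (Fin m → Fin D → ZMod p))

/-- If the divisor `u` of the monic polynomial `f` is nontrivial, the one of smaller degree among
`u` and `f / u`; otherwise `none`. -/
def splitOff (fY : List (ZMod p)) (f u : List (List (ZMod p))) :
    Counted (Option (List (List (ZMod p)))) :=
  if 0 < u.length ∧ u.length < f.length then do
    let qr ← (ext p fY).divMod ((ext p fY).one :: f) u
    pure (some (if u.length ≤ qr.1.tail.length then u else qr.1.tail))
  else pure none

/-- One round of the Cantor–Zassenhaus algorithm with the random polynomial `g`, over the field
`F = 𝔽_p[Y]/(fY)` with `q` elements: split `f` by `gcd (g, f)` or else by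
`gcd (g ^ ((q ^ e - 1) / 2) - 1, f)`. In characteristic two, where it is run only if `3 ∣ q ^ e - 1`,
the exponent is `(q ^ e - 1) / 3`. -/
def czRound (fY : List (ZMod p)) (e : ℕ) (f g : List (List (ZMod p))) :
    Counted (List (List (ZMod p))) := do
  let F := ext p fY
  let q := p ^ fY.length
  let u ← F.gcd q f g
  match ← splitOff p fY f u with
  | some f' => pure f'
  | none => do
    let h ← (F.quot f).pow g ((q ^ e - 1) / (if p = 2 then 3 else 2))
    let h1 ← (F.quot f).sub h (F.quot f).one
    let w ← F.gcd q f h1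
    match ← splitOff p fY f w with
    | some f' => pure f'
    | none => pure f

/-- The Cantor–Zassenhaus algorithm: an irreducible factor (as a tail) of the monic polynomial `f`
over `𝔽_p[Y]/(fY)`, a product of distinct irreducible polynomials of degree `e`.
It is cut off after the given number of rounds. -/
noncomputable def cantorZassenhaus (fY : List (ZMod p)) (e : ℕ) :
    ℕ → List (List (ZMod p)) → Rand (List (List (ZMod p)))
  | 0, f => if f.length = e then pure f else Rand.cutOff
  | k + 1, f =>
    if f.length = e then pure f else do
      let g ← Rand.sample (randomPoly p fY.length f.length)
      let f' ← Rand.lift (czRound p fY e f g)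
      cantorZassenhaus fY e k f'

/-- Given `ζ_a = Y` in `F = 𝔽_p[Y]/(fY)` and a prime `ℓ` with `ℓ ^ v ∥ a`, the polynomial whose
roots are the next root of unity of `ℓ`-power order: `Φ_ℓ` if `v = 0`, and `X ^ ℓ - ζ_{ℓ ^ v}`
otherwise, where `ζ_{ℓ ^ v} = ζ_a ^ (a / ℓ ^ v)`. -/
def kummerPoly (fY : List (ZMod p)) (a ℓ : ℕ) : Counted (List (List (ZMod p))) := do
  let F := ext p fY
  if ℓ ∣ a then do
    let y ← (Arith.base (ZMod p)).gen fY
    let c ← F.pow y (a / ℓ ^ a.factorization ℓ)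
    let c' ← F.sub F.zero c
    pure (F.const ℓ c')
  else pure (List.replicate (ℓ - 1) F.one)

/-- Given `ζ_a = Y` in `F = 𝔽_p[Y]/(fY)` and `F(ξ) = F[X]/(g)`, `ξ = X`, the minimal polynomial of
`ζ = ζ_a ξ` over `𝔽_p`, expanded as the product of `T - ζ ^ (p ^ j)`, `j < [F(ξ) : 𝔽_p]`. -/
def flatten (fY : List (ZMod p)) (g : List (List (ZMod p))) : Counted (List (ZMod p)) := do
  let F := ext p fY
  let E := F.quot g
  let y ← (Arith.base (ZMod p)).gen fY
  let x ← F.gen g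
  let z ← mapList (F.mul y) x
  let conjugates ← Arith.iterates (fun t => E.pow t p) (fY.length * g.length) z
  let m ← E.expand conjugates
  pure (m.map fun c => (c.getLastD []).getLastD 0)

/-- From (the tail of) a minimal polynomial `fY` of `ζ_a` to one of `ζ_{a ℓ}`, over `𝔽_p`. -/
noncomputable def adjoinStep (rounds : ℕ) (fY : List (ZMod p)) (a ℓ : ℕ) :
    Rand (List (ZMod p)) := do
  let f ← Rand.lift (kummerPoly p fY a ℓ)
  let e := orderOf (p : ZMod (a * ℓ)) / fY.length
  let g ← cantorZassenhaus p fY e rounds f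
  Rand.lift (flatten p fY g)

/-- Adjoin roots of unity for the primes in the list, one after the other. -/
noncomputable def adjoinAll (rounds : ℕ) : List ℕ → ℕ → List (ZMod p) → Rand (List (ZMod p))
  | [], _, fY => pure fY
  | ℓ :: ls, a, fY => do
    let fY' ← adjoinStep p rounds fY a ℓ
    adjoinAll rounds ls (a * ℓ) fY'

/-- Tail of an irreducible factor of `Φ_s` over `𝔽_p`; starting from `Y - 1`, the minimal polynomial
of `ζ_1`, the prime factors of `s` are treated in increasing order, with multiplicity. -/
noncomputable def cyclotomicFactor (rounds s : ℕ) : Rand (List (ZMod p)) :=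
  adjoinAll p rounds s.primeFactorsList 1 [-1]

/-! ### Lifting the root of unity -/

/-- One Newton step for `X ^ s - 1` in `ℤ_p[X]/(F)`:
`α ↦ α - (1/s) (α ^ s - 1) α (2 - α ^ s)` modulo `p ^ k`. -/
noncomputable def newtonStep (F : List ℤ_[p]) (s : ℕ) (sInv : ℤ_[p]) (k : ℕ) (α : List ℤ_[p]) :
    Counted (List ℤ_[p]) := do
  let A := (Arith.base ℤ_[p]).quot F
  let t ← A.pow α s
  let u ← A.sub t A.one
  let v ← A.sub ((Arith.base ℤ_[p]).const F.length 2) t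
  let w ← A.mul u α
  let x ← A.mul w v
  let y ← mapList ((Arith.base ℤ_[p]).mul sInv) x
  let z ← A.sub α y
  mapList (fun c : ℤ_[p] => ⟨(c.appr k : ℤ_[p]), 1⟩) z

/-- The Newton steps number `i, i + 1, …, i + n - 1`, where step `i` is to precision `p ^ (2 ^ i)`. -/
noncomputable def newtonSteps (F : List ℤ_[p]) (s : ℕ) (sInv : ℤ_[p]) :
    ℕ → ℕ → List ℤ_[p] → Counted (List ℤ_[p])
  | _, 0, α => pure α
  | i, n + 1, α => do
    let α' ← newtonStep p F s sInv (2 ^ i) α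
    newtonSteps F s sInv (i + 1) n α'

/-- The lift `X` of `ζ_s ∈ 𝔽_p[X]/(F mod p)` improved to an `s`-th root of unity in `ℤ_p[X]/(F)`
modulo `p ^ (2 ^ n)`. -/
noncomputable def liftRoot (F : List ℤ_[p]) (s n : ℕ) : Counted (List ℤ_[p]) := do
  let sInv ← (⟨(s : ℤ_[p]).inv, 1⟩ : Counted ℤ_[p])
  let x ← (Arith.base ℤ_[p]).gen F
  newtonSteps p F s sInv 1 n x

/-! ### The FFT over `ℚ_p` -/

/-- `S r = Φ_1(p) Φ_{p_1}(p) ⋯ Φ_{p_r}(p)`, where `p_1 < p_2 < ⋯` are all the primes. -/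
noncomputable def lengthOf (r : ℕ) : ℕ :=
  ((cyclotomic 1 ℤ).eval (p : ℤ) *
    ∏ i ∈ Finset.range r, (cyclotomic (Nat.nth Nat.Prime i) ℤ).eval (p : ℤ)).natAbs

/-- The smallest positive `r` with `N < S r`. -/
noncomputable def chooseR (N : ℕ) : ℕ := sInf {r | 0 < r ∧ N < lengthOf p r}

/-- The length `s` of the transform. -/
noncomputable def chooseS (N : ℕ) : ℕ := lengthOf p (chooseR p N)

/-- `p_1 p_2 ⋯ p_r`. -/
noncomputable def chooseD (N : ℕ) : ℕ := ∏ i ∈ Finset.range (chooseR p N), Nat.nth Nat.Prime i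

/-- The Cooley–Tukey FFT of length `s` of `f ∈ ℚ_p[X]` in the ring `ℚ_p[X]/(F)`, with the element
`ω` in the role of the primitive `s`-th root of unity; the radices are the prime factors of `s`. -/
noncomputable def transform (F : List ℚ_[p]) (s : ℕ) (ω : List ℚ_[p]) (f : ℚ_[p][X]) :
    Counted (List (List ℚ_[p])) :=
  ((Arith.base ℚ_[p]).quot F).fft s.primeFactorsList ω
    ((List.range s).map fun j => (Arith.base ℚ_[p]).const F.length (f.coeff j))

/-- What the algorithm returns: the tail of the monic polynomial `F` with `ℚ_p(ζ_s) = ℚ_p[X]/(F)`,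
(an approximation of) `ζ_s`, and (approximations of) the values `f(1), f(ζ_s), …, f(ζ_s ^ (s - 1))`,
these as elements of `ℚ_p[X]/(F)`. -/
structure Output where
  modulus : List ℚ_[p]
  root : List ℚ_[p]
  values : List (List ℚ_[p])

/-- The whole algorithm on the input `(f, N)`, to precision `p ^ (2 ^ n)`: compute an irreducible
factor of `Φ_s` over `𝔽_p`, lift its coefficients to `{0, …, p - 1}`, lift the root of unity, and run
the FFT. Every call of the Cantor–Zassenhaus algorithm is cut off after `rounds` rounds. -/
noncomputable def padicFFT (rounds N n : ℕ) (f : ℚ_[p][X]) : Rand (Output p) := do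
  let s := chooseS p N
  let fY ← cyclotomicFactor p rounds s
  let F : List ℤ_[p] := fY.map fun c => (c.val : ℤ_[p])
  let α ← Rand.lift (liftRoot p F s n)
  let F' : List ℚ_[p] := F.map fun c => (c : ℚ_[p])
  let α' : List ℚ_[p] := α.map fun c => (c : ℚ_[p])
  let v ← Rand.lift (transform p F' s α' f)
  pure ⟨F', α', v⟩

/-! ### Correctness of the output -/

/-- The polynomial with the given coefficients, highest degree first. -/
noncomputable def polyOf (l : List ℚ_[p]) : ℚ_[p][X] := l.foldl (fun g c => g * X + C c) 0

/-- The monic polynomial with the given tail. -/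
noncomputable def monicOf (F : List ℚ_[p]) : ℚ_[p][X] := polyOf p (1 :: F)

/-- The element of `ℚ_p[X]/(F)` with the given coordinates. -/
noncomputable def element (F l : List ℚ_[p]) : AdjoinRoot (monicOf p F) :=
  AdjoinRoot.mk (monicOf p F) (polyOf p l)

/-- Two coordinate vectors of the same length that agree up to `δ`. -/
def Close (δ : ℝ) (x y : List ℚ_[p]) : Prop := List.Forall₂ (fun a b => ‖a - b‖ ≤ δ) x y

/-- The output is right to precision `p ^ (2 ^ n)`: the modulus is irreducible of degree `d`, the
ring `ℚ_p[X]/(F)` contains a primitive `s`-th root of unity `ζ` to which the computed root is an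
approximation, the FFT at `ζ` itself gives exactly `f(1), f(ζ), …, f(ζ ^ (s - 1))`, and the
computed values are approximations of these, relative to the size of the coefficients of `f`. -/
def Correct (s d n : ℕ) (f : ℚ_[p][X]) (out : Output p) : Prop :=
  out.modulus.length = d ∧ Irreducible (monicOf p out.modulus) ∧
  ∃ z : List ℚ_[p], z.length = d ∧
    IsPrimitiveRoot (element p out.modulus z) s ∧
    Close p (((p : ℝ) ^ (2 ^ n))⁻¹) out.root z ∧
    ∃ y : List (List ℚ_[p]), (transform p out.modulus s z f).val = y ∧
      (∀ v ∈ y, v.length = d) ∧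
      y.map (element p out.modulus) =
        (List.range s).map (fun i => aeval (element p out.modulus z ^ i) f) ∧
      ∀ B : ℝ, (∀ k, ‖f.coeff k‖ ≤ B) →
        List.Forall₂ (Close p (B * ((p : ℝ) ^ (2 ^ n))⁻¹)) out.values y

end FiniteField

end PadicFFT

/-! All computations are read in honest rings. `Arith.Models A V φ c` says that on valid
representatives the operations of `A` become those of a ring under `φ`, each at cost at most `c`. If
`t` is a root of the monic polynomial `f`, then evaluation at `t` models `R[X]/(f)`, with cost `4 *
c * (deg f) ^ 2` (`Arith.Models.quot`). Towers over 𝔽_p are thus interpreted inside one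
algebraically closed field `Ω`, and irreducibility is expressed by the size of Frobenius orbits.

Degree. The order of `p` modulo Φ_ℓ(p) is ℓ, so its order modulo `s` is divisible by every p_i;
conversely `s` divides `p ^ d - 1`, because Φ_1, Φ_{p_1}, … are distinct factors of X^d - 1. Hence
the order is `d` (`orderOf_lengthOf`), which is the degree of every irreducible factor of Φ_s modulo
`p`. Lifts of such factors stay irreducible over ℤ_p, hence over ℚ_p.

Cantor–Zassenhaus. As long as `f` is reducible it has two non-conjugate roots, and by the Chinese
remainder theorem the values of a random `g` at them are independent and uniform in the field with Q
= q^e elements. With probability at least 1/8 the first value is an `M`-th root of unity and the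
second is not (`card_le_eight_mul_card_split`), and then the round lowers the degree
(`czRound_spec`). The degree is a potential function for the expected cost, and 2^degree is one for
the cut-off probability (`cantorZassenhaus_spec`).

Lifting and precision. The Newton step squares the error modulus (`newton_dvd`); the iterates
converge coordinatewise to an exact `s`-th root of unity, primitive because its reduction is
(`IsCyclotomicFactor.exists_root`). Since the absolute value is ultrametric and all powers of the
root are integral, errors do not accumulate in the FFT (`Near.mul`, `transform_close`).

Cost. One has s ≤ N * `width p N`, and the remaining parameters (`d`, the primes dividing `s`, the
binary lengths) are at most `width p N` = 2p(4p)^{p_r}. Minimality of `r` gives N ≥ 2^{r(r-1)/2},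
whereas p_r = o(r²) by Chebyshev's estimate; so every fixed power of the width is N^{o(1)}
(`nth_prime_le`, `exists_width_pow_le`). -/

set_option linter.unusedSectionVars false

namespace PadicFFT

open Polynomial
open scoped ENNReal

/-! ### Values and costs of the elementary combinators -/

section Counted

variable {α β γ : Type}

@[simp] theorem Counted.val_pure (a : α) : (pure a : Counted α).val = a := rfl

@[simp] theorem Counted.ops_pure (a : α) : (pure a : Counted α).ops = 0 := rfl

@[simp] theorem Counted.val_bind (x : Counted α) (f : α → Counted β) :
    (x >>= f).val = (f x.val).val := rfl

@[simp] theorem Counted.ops_bind (x : Counted α) (f : α → Counted β) :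
    (x >>= f).ops = x.ops + (f x.val).ops := rfl

@[simp] theorem mapList_val (f : α → Counted β) (l : List α) :
    (mapList f l).val = l.map fun a => (f a).val := by
  induction l with
  | nil => rfl
  | cons a l ih => simp [mapList, ih]

theorem mapList_ops_le {f : α → Counted β} {l : List α} {c : ℕ}
    (h : ∀ a ∈ l, (f a).ops ≤ c) : (mapList f l).ops ≤ l.length * c := by
  induction l with
  | nil => simp [mapList]
  | cons a l ih =>
    have h1 := h a (by simp)
    have h2 := ih fun b hb => h b (by simp [hb])
    simp only [mapList, Counted.ops_bind, Counted.ops_pure, List.length_cons, add_mul, one_mul]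
    omega

@[simp] theorem zipLists_val (f : α → β → Counted γ) (l : List α) (m : List β) :
    (zipLists f l m).val = List.zipWith (fun a b => (f a b).val) l m := by
  induction l generalizing m with
  | nil => simp [zipLists]
  | cons a l ih =>
    cases m with
    | nil => simp [zipLists]
    | cons b m => simp [zipLists, ih]

theorem zipLists_ops_le {f : α → β → Counted γ} {l : List α} {m : List β} {c : ℕ}
    (h : ∀ a ∈ l, ∀ b ∈ m, (f a b).ops ≤ c) : (zipLists f l m).ops ≤ m.length * c := by
  induction l generalizing m with
  | nil => simp [zipLists]
  | cons a l ih =>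
    cases m with
    | nil => simp [zipLists]
    | cons b m =>
      have h1 := h a (by simp) b (by simp)
      have h2 := ih (m := m) fun x hx y hy => h x (by simp [hx]) y (by simp [hy])
      simp only [zipLists, Counted.ops_bind, Counted.ops_pure, List.length_cons, add_mul, one_mul]
      omega

end Counted

theorem forall_mem_zipWith {α β γ : Type*} {f : α → β → γ} {V : γ → Prop} {l : List α}
    {m : List β} (h : ∀ a ∈ l, ∀ b ∈ m, V (f a b)) : ∀ x ∈ List.zipWith f l m, V x := by
  induction l generalizing m with
  | nil => simp
  | cons a l ih =>
    cases m with
    | nil => simp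
    | cons b m =>
      intro x hx
      rw [List.zipWith_cons_cons, List.mem_cons] at hx
      rcases hx with rfl | hx
      · exact h a (by simp) b (by simp)
      · exact ih (fun a ha b hb => h a (by simp [ha]) b (by simp [hb])) x hx

/-! ### Values of coefficient lists -/

section Horner

variable {R T : Type*} [CommRing T]

/-- Value at `t` of the polynomial with the given coefficients, highest degree first. -/
def hev (φ : R → T) (t : T) (l : List R) : T := l.foldl (fun g c => g * t + φ c) 0

variable (φ : R → T) (t : T)

@[simp] theorem hev_nil : hev φ t [] = 0 := rfl

theorem hev_concat (l : List R) (c : R) : hev φ t (l ++ [c]) = hev φ t l * t + φ c := by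
  simp [hev, List.foldl_append]

theorem hev_append (l m : List R) :
    hev φ t (l ++ m) = hev φ t l * t ^ m.length + hev φ t m := by
  induction m using List.reverseRecOn with
  | nil => simp
  | append_singleton m c ih =>
    rw [← List.append_assoc, hev_concat, hev_concat, ih, List.length_append]
    simp only [List.length_singleton, pow_succ]
    ring

theorem hev_cons (h : R) (l : List R) :
    hev φ t (h :: l) = φ h * t ^ l.length + hev φ t l := by
  rw [← List.singleton_append, hev_append]
  simp [hev]

theorem hev_map {R' : Type*} (g : R' → R) (l : List R') :
    hev φ t (l.map g) = hev (fun c => φ (g c)) t l := by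
  simp [hev, List.foldl_map]

theorem map_hev {T' : Type*} [CommRing T'] (σ : T →+* T') (l : List R) :
    σ (hev φ t l) = hev (fun c => σ (φ c)) (σ t) l := by
  induction l with
  | nil => simp
  | cons h l ih => simp [hev_cons, ih]

theorem hev_congr {φ ψ : R → T} {l : List R} (h : ∀ c ∈ l, φ c = ψ c) :
    hev φ t l = hev ψ t l := by
  induction l with
  | nil => rfl
  | cons a l ih =>
    rw [hev_cons, hev_cons, h a (by simp), ih fun c hc => h c (by simp [hc])]

theorem hev_eq_zero {l : List R} (h : ∀ c ∈ l, φ c = 0) : hev φ t l = 0 := by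
  induction l with
  | nil => rfl
  | cons a l ih => rw [hev_cons, h a (by simp), ih fun c hc => h c (by simp [hc])]; simp

/-- With `k` equal to 1, -1, `φ x` and `-φ x` this serves addition, subtraction, `addScaled` and
`subScaled`. -/
theorem hev_zipWith (k : T) {op : R → R → R} {l m : List R} (hlen : l.length = m.length)
    (h : ∀ a ∈ l, ∀ b ∈ m, φ (op a b) = φ a + k * φ b) :
    hev φ t (List.zipWith op l m) = hev φ t l + k * hev φ t m := by
  induction l generalizing m with
  | nil =>
    cases m with
    | nil => simp
    | cons b m => simp at hlen
  | cons a l ih =>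
    cases m with
    | nil => simp at hlen
    | cons b m =>
      simp only [List.length_cons, add_left_inj] at hlen
      rw [List.zipWith_cons_cons, hev_cons, hev_cons, hev_cons, h a (by simp) b (by simp),
        ih hlen fun x hx y hy => h x (by simp [hx]) y (by simp [hy]), List.length_zipWith, hlen,
        min_self]
      ring

/-- The polynomial with the given coefficients, highest degree first. -/
noncomputable def lp (l : List R) : T[X] := hev (fun c => C (φ c)) X l

/-- The monic polynomial with the given tail. -/
noncomputable def mp (l : List R) : T[X] := X ^ l.length + lp φ l

@[simp] theorem lp_nil : lp φ [] = 0 := rfl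

@[simp] theorem mp_nil : mp φ [] = 1 := by simp [mp]

theorem lp_cons (h : R) (l : List R) : lp φ (h :: l) = C (φ h) * X ^ l.length + lp φ l :=
  hev_cons _ _ _ _

@[simp] theorem eval_lp (l : List R) : (lp φ l).eval t = hev φ t l := by
  have := map_hev (fun c => C (φ c)) (X : T[X]) (evalRingHom t) l
  simpa [lp] using this

@[simp] theorem eval_mp (l : List R) : (mp φ l).eval t = t ^ l.length + hev φ t l := by
  simp [mp]

theorem degree_lp_lt (l : List R) : (lp φ l).degree < l.length := by
  induction l with
  | nil => simp
  | cons h l ih =>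
    rw [lp_cons]
    refine (degree_add_le _ _).trans_lt (max_lt ?_ ?_)
    · refine (degree_C_mul_X_pow_le _ _).trans_lt ?_
      exact_mod_cast Nat.lt_succ_self _
    · refine ih.trans ?_
      exact_mod_cast Nat.lt_succ_self _

theorem mp_monic (l : List R) : (mp φ l).Monic :=
  monic_X_pow_add (degree_lp_lt φ l)

theorem natDegree_mp [Nontrivial T] (l : List R) : (mp φ l).natDegree = l.length := by
  rw [mp, natDegree_add_eq_left_of_degree_lt, natDegree_X_pow]
  rw [degree_X_pow]
  exact degree_lp_lt φ l

/-- `φ` separates only valid representatives: for an extension these are the lists of full length,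
where zero padding is no longer ambiguous. -/
theorem lp_injOn {V : R → Prop} (hφ : ∀ a b, V a → V b → φ a = φ b → a = b) {l m : List R}
    (hl : ∀ a ∈ l, V a) (hm : ∀ a ∈ m, V a) (hlen : l.length = m.length)
    (h : lp φ l = lp φ m) : l = m := by
  induction l generalizing m with
  | nil =>
    cases m with
    | nil => rfl
    | cons b m => simp at hlen
  | cons a l ih =>
    cases m with
    | nil => simp at hlen
    | cons b m =>
      simp only [List.length_cons, add_left_inj] at hlen
      have key : φ a = φ b := by
        have h1 := congrArg (fun P : T[X] => P.coeff l.length) h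
        have e1 : (lp φ l).coeff l.length = 0 := coeff_eq_zero_of_degree_lt (degree_lp_lt φ l)
        have e2 : (lp φ m).coeff l.length = 0 := by
          rw [hlen]; exact coeff_eq_zero_of_degree_lt (degree_lp_lt φ m)
        simp only [lp_cons, coeff_add, e1, e2, coeff_C_mul, coeff_X_pow] at h1
        simpa [hlen] using h1
      have hab := hφ a b (hl a (by simp)) (hm b (by simp)) key
      subst hab
      rw [lp_cons, lp_cons, hlen] at h
      rw [ih (fun x hx => hl x (by simp [hx])) (fun x hx => hm x (by simp [hx])) hlen
        (add_left_cancel h)]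

theorem map_lp {T' : Type*} [CommRing T'] (σ : T →+* T') (l : List R) :
    (lp φ l).map σ = lp (fun c => σ (φ c)) l := by
  have := map_hev (fun c => C (φ c)) (X : T[X]) (mapRingHom σ) l
  simpa [lp] using this

theorem map_mp {T' : Type*} [CommRing T'] (σ : T →+* T') (l : List R) :
    (mp φ l).map σ = mp (fun c => σ (φ c)) l := by
  simp [mp, map_lp]

end Horner

/-! ### Arithmetic that models a ring -/

/-- On the representatives satisfying `V` the operations of `A` are mapped by `φ` to those of the
ring `T`, and each of them has cost at most `c`. -/
structure Arith.Models {R : Type} {T : Type*} [CommRing T] (A : Arith R) (V : R → Prop) (φ : R → T)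
    (c : ℕ) : Prop where
  zero_valid : V A.zero
  map_zero : φ A.zero = 0
  one_valid : V A.one
  map_one : φ A.one = 1
  add_valid : ∀ {a b}, V a → V b → V (A.add a b).val
  map_add : ∀ {a b}, V a → V b → φ (A.add a b).val = φ a + φ b
  add_ops : ∀ {a b}, V a → V b → (A.add a b).ops ≤ c
  sub_valid : ∀ {a b}, V a → V b → V (A.sub a b).val
  map_sub : ∀ {a b}, V a → V b → φ (A.sub a b).val = φ a - φ b
  sub_ops : ∀ {a b}, V a → V b → (A.sub a b).ops ≤ c
  mul_valid : ∀ {a b}, V a → V b → V (A.mul a b).val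
  map_mul : ∀ {a b}, V a → V b → φ (A.mul a b).val = φ a * φ b
  mul_ops : ∀ {a b}, V a → V b → (A.mul a b).ops ≤ c

theorem Arith.models_base {K : Type} {T : Type*} [CommRing K] [CommRing T] (φ : K →+* T) :
    (Arith.base K).Models (fun _ => True) φ 1 := by
  constructor <;> intros <;> simp [Arith.base]

namespace Arith.Models

variable {R : Type} {T : Type*} [CommRing T] {A : Arith R} {V : R → Prop} {φ : R → T} {c : ℕ}

/-- Mostly used with `σ = C`: a statement about values at `t` then becomes, at `t = X`, an identity
of polynomials over `T`. -/
theorem comp (h : A.Models V φ c) {T' : Type*} [CommRing T'] (σ : T →+* T') :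
    A.Models V (fun a => σ (φ a)) c where
  zero_valid := h.zero_valid
  map_zero := by rw [h.map_zero, _root_.map_zero]
  one_valid := h.one_valid
  map_one := by rw [h.map_one, _root_.map_one]
  add_valid := h.add_valid
  map_add ha hb := by rw [h.map_add ha hb, _root_.map_add]
  add_ops := h.add_ops
  sub_valid := h.sub_valid
  map_sub ha hb := by rw [h.map_sub ha hb, _root_.map_sub]
  sub_ops := h.sub_ops
  mul_valid := h.mul_valid
  map_mul ha hb := by rw [h.map_mul ha hb, _root_.map_mul]
  mul_ops := h.mul_ops

theorem powBits_spec (h : A.Models V φ c) {a : R} (ha : V a) (bs : List Bool) :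
    V (A.powBits a bs).val ∧ (A.powBits a bs).ops ≤ 2 * bs.length * c := by
  induction bs with
  | nil => simpa [powBits] using h.one_valid
  | cons b bs ih =>
    have h1 := h.mul_valid ih.1 ih.1
    have h2 := h.mul_ops ih.1 ih.1
    have h3 := h.mul_valid h1 ha
    have h4 := h.mul_ops h1 ha
    have h5 := ih.2
    have e : 2 * (bs.length + 1) * c = 2 * bs.length * c + c + c := by ring
    cases b
    · simp only [powBits, Counted.val_bind, Counted.ops_bind, List.length_cons, e,
        Bool.false_eq_true, if_false, Counted.val_pure, Counted.ops_pure]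
      exact ⟨h1, by omega⟩
    · simp only [powBits, Counted.val_bind, Counted.ops_bind, List.length_cons, e, if_true]
      exact ⟨h3, by omega⟩

theorem pow_valid (h : A.Models V φ c) {a : R} (ha : V a) (n : ℕ) : V (A.pow a n).val :=
  (h.powBits_spec ha n.bits).1

theorem pow_ops (h : A.Models V φ c) {a : R} (ha : V a) (n : ℕ) :
    (A.pow a n).ops ≤ 2 * n.size * c := by
  rw [← Nat.size_eq_bits_len]
  exact (h.powBits_spec ha n.bits).2

theorem map_pow (h : A.Models V φ c) {a : R} (ha : V a) (n : ℕ) :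
    φ (A.pow a n).val = φ a ^ n := by
  unfold Arith.pow
  -- The side condition of `Nat.binaryRec'` excludes a leading zero digit, so that the digits of
  -- `bit b n` are exactly `b :: n.bits`.
  induction n using Nat.binaryRec' with
  | zero => simpa [powBits] using h.map_one
  | bit b n hb ih =>
    have h0 := (h.powBits_spec ha n.bits).1
    have h1 := h.mul_valid h0 h0
    rw [Nat.bits_append_bit n b hb]
    cases b
    · simp only [powBits, Counted.val_bind, Bool.false_eq_true, if_false, Counted.val_pure,
        h.map_mul h0 h0, ih, Nat.bit_false]
      ring
    · simp only [powBits, Counted.val_bind, if_true, h.map_mul h1 ha,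
        h.map_mul h0 h0, ih, Nat.bit_true]
      ring

/-! ### Linear operations on coefficient lists -/

section Lists

variable (h : A.Models V φ c) {x : R} {l m : List R}
include h

theorem subScaled_valid (hx : V x) (hl : ∀ y ∈ l, V y) (hm : ∀ y ∈ m, V y) :
    ∀ y ∈ (A.subScaled x l m).val, V y := by
  simp only [Arith.subScaled, zipLists_val]
  exact forall_mem_zipWith fun a ha b hb => h.sub_valid (hl a ha) (h.mul_valid hx (hm b hb))

theorem addScaled_valid (hx : V x) (hl : ∀ y ∈ l, V y) (hm : ∀ y ∈ m, V y) :
    ∀ y ∈ (A.addScaled x l m).val, V y := by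
  simp only [Arith.addScaled, zipLists_val]
  exact forall_mem_zipWith fun a ha b hb => h.add_valid (hl a ha) (h.mul_valid hx (hm b hb))

theorem subScaled_ops (hx : V x) (hl : ∀ y ∈ l, V y) (hm : ∀ y ∈ m, V y) :
    (A.subScaled x l m).ops ≤ m.length * (2 * c) := by
  refine zipLists_ops_le fun a ha b hb => ?_
  have h1 := h.mul_ops hx (hm b hb)
  have h2 := h.sub_ops (hl a ha) (h.mul_valid hx (hm b hb))
  simp only [Counted.ops_bind]
  omega

theorem addScaled_ops (hx : V x) (hl : ∀ y ∈ l, V y) (hm : ∀ y ∈ m, V y) :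
    (A.addScaled x l m).ops ≤ m.length * (2 * c) := by
  refine zipLists_ops_le fun a ha b hb => ?_
  have h1 := h.mul_ops hx (hm b hb)
  have h2 := h.add_ops (hl a ha) (h.mul_valid hx (hm b hb))
  simp only [Counted.ops_bind]
  omega

theorem hev_subScaled (t : T) (hx : V x) (hl : ∀ y ∈ l, V y) (hm : ∀ y ∈ m, V y)
    (hlen : l.length = m.length) :
    hev φ t (A.subScaled x l m).val = hev φ t l - φ x * hev φ t m := by
  simp only [Arith.subScaled, zipLists_val]
  rw [hev_zipWith φ t (-φ x) hlen]
  · ring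
  · intro a ha b hb
    simp only [Counted.val_bind]
    rw [h.map_sub (hl a ha) (h.mul_valid hx (hm b hb)), h.map_mul hx (hm b hb)]
    ring

theorem hev_addScaled (t : T) (hx : V x) (hl : ∀ y ∈ l, V y) (hm : ∀ y ∈ m, V y)
    (hlen : l.length = m.length) :
    hev φ t (A.addScaled x l m).val = hev φ t l + φ x * hev φ t m := by
  simp only [Arith.addScaled, zipLists_val]
  rw [hev_zipWith φ t (φ x) hlen]
  intro a ha b hb
  simp only [Counted.val_bind]
  rw [h.map_add (hl a ha) (h.mul_valid hx (hm b hb)), h.map_mul hx (hm b hb)]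

omit h in
theorem subScaled_length (hlen : l.length = m.length) :
    (A.subScaled x l m).val.length = m.length := by
  simp [Arith.subScaled, hlen]

omit h in
theorem addScaled_length (hlen : l.length = m.length) :
    (A.addScaled x l m).val.length = m.length := by
  simp [Arith.addScaled, hlen]

theorem const_valid {d : ℕ} (hx : V x) : ∀ y ∈ A.const d x, V y := by
  intro y hy
  simp only [Arith.const, List.mem_append, List.mem_replicate, List.mem_singleton] at hy
  rcases hy with ⟨-, rfl⟩ | rfl
  · exact h.zero_valid
  · exact hx

omit h in
theorem const_length {d : ℕ} (hd : 0 < d) : (A.const d x).length = d := by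
  simp [Arith.const]
  omega

theorem hev_const (t : T) (d : ℕ) : hev φ t (A.const d x) = φ x := by
  rw [Arith.const, hev_concat, hev_eq_zero]
  · simp
  · intro c hc
    rw [List.eq_of_mem_replicate hc, h.map_zero]

end Lists

/-! ### Residue class rings -/

section Quot

variable (h : A.Models V φ c) {f : List R} (hf : ∀ y ∈ f, V y)
include h hf

/-- Shifting produces the term `a * t ^ d`, and `t ^ d` is minus the value of the tail because `t`
is a root of the modulus. Nothing else about the modulus is needed. -/
theorem mulX_spec {t : T} (ht : t ^ f.length + hev φ t f = 0) {l : List R}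
    (hlen : l.length = f.length) (hl : ∀ y ∈ l, V y) :
    ((A.mulX f l).val.length = f.length ∧ ∀ y ∈ (A.mulX f l).val, V y) ∧
      hev φ t (A.mulX f l).val = hev φ t l * t ∧
      (A.mulX f l).ops ≤ f.length * (2 * c) := by
  cases l with
  | nil =>
    simp only [mulX, Counted.val_pure, Counted.ops_pure]
    simp [hlen.symm]
  | cons a l =>
    have ha : V a := hl a (by simp)
    have hl' : ∀ y ∈ l ++ [A.zero], V y := by
      intro y hy
      rw [List.mem_append, List.mem_singleton] at hy
      rcases hy with hy | rfl
      · exact hl y (by simp [hy])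
      · exact h.zero_valid
    have hlen' : (l ++ [A.zero]).length = f.length := by simpa using hlen
    simp only [mulX]
    refine ⟨⟨subScaled_length hlen', h.subScaled_valid ha hl' hf⟩, ?_, h.subScaled_ops ha hl' hf⟩
    rw [h.hev_subScaled t ha hl' hf hlen', hev_concat, hev_cons, h.map_zero]
    have e : hev φ t f = - t ^ (l.length + 1) := by
      rw [List.length_cons] at hlen
      rw [hlen]
      linear_combination ht
    rw [e]
    ring

/-- The loop invariant of Horner's scheme in the coefficients of `a`. Each coefficient costs one
reduction and one scaled addition, both at most `f.length * (2 * c)`. -/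
theorem quot_mul_spec {t : T} (ht : t ^ f.length + hev φ t f = 0) {b : List R}
    (hblen : b.length = f.length) (hb : ∀ y ∈ b, V y) (a : List R) (ha : ∀ y ∈ a, V y)
    (acc : List R) (hlen : acc.length = f.length) (hacc : ∀ y ∈ acc, V y) :
    let r := foldList (fun acc c => do
      let acc' ← A.mulX f acc
      A.addScaled c acc' b) acc a
    (r.val.length = f.length ∧ ∀ y ∈ r.val, V y) ∧
      hev φ t r.val = hev φ t acc * t ^ a.length + hev φ t a * hev φ t b ∧
      r.ops ≤ a.length * (4 * c * f.length) := by
  induction a generalizing acc with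
  | nil => simpa [foldList] using ⟨hlen, hacc⟩
  | cons x a ih =>
    have hx : V x := ha x (by simp)
    obtain ⟨⟨h1, h2⟩, h3, h4⟩ := h.mulX_spec hf ht hlen hacc
    have h5 : (A.mulX f acc).val.length = b.length := by rw [h1, hblen]
    have h6 := h.addScaled_valid hx h2 hb
    have h7 := h.addScaled_ops hx h2 hb
    have h8 := h.hev_addScaled t hx h2 hb h5
    have h9 := addScaled_length (A := A) (x := x) h5
    obtain ⟨g1, g2, g3⟩ := ih (fun y hy => ha y (by simp [hy])) _ (h9.trans hblen) h6
    simp only [foldList, Counted.val_bind, Counted.ops_bind] at g1 g2 g3 ⊢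
    refine ⟨g1, ?_, ?_⟩
    · rw [g2, h8, h3, hev_cons, List.length_cons]
      ring
    · rw [hblen] at h7
      rw [List.length_cons, add_mul, one_mul]
      have e : 4 * c * f.length = f.length * (2 * c) + f.length * (2 * c) := by ring
      omega

/-- If `t` is a root of the monic polynomial with tail `f`, then `R[X]/(f)` with coefficients
modelled by `φ` is modelled by evaluation at `t`. -/
theorem quot (hd : 0 < f.length) {t : T} (ht : t ^ f.length + hev φ t f = 0) :
    (A.quot f).Models (fun l => l.length = f.length ∧ ∀ y ∈ l, V y) (hev φ t)
      (4 * c * f.length ^ 2) := by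
  -- The common bound is that of multiplication; additions and subtractions cost only `f.length *
  -- c`.
  have hle : f.length * c ≤ 4 * c * f.length ^ 2 := by
    have : f.length ≤ f.length ^ 2 := Nat.le_self_pow two_ne_zero _
    nlinarith [Nat.zero_le (c * f.length ^ 2), Nat.mul_le_mul_left c this]
  have hrep : ∀ y ∈ List.replicate f.length A.zero, V y := fun y hy => by
    rw [List.eq_of_mem_replicate hy]; exact h.zero_valid
  have hrep0 : hev φ t (List.replicate f.length A.zero) = 0 := hev_eq_zero _ _ fun y hy => by
    rw [List.eq_of_mem_replicate hy]; exact h.map_zero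
  refine
    { zero_valid := ⟨by simp [Arith.quot], hrep⟩
      map_zero := hrep0
      one_valid := ⟨const_length hd, h.const_valid h.one_valid⟩
      map_one := by
        change hev φ t (A.const f.length A.one) = 1
        rw [h.hev_const, h.map_one]
      add_valid := ?_
      map_add := ?_
      add_ops := ?_
      sub_valid := ?_
      map_sub := ?_
      sub_ops := ?_
      mul_valid := ?_
      map_mul := ?_
      mul_ops := ?_ }
  · rintro a b ⟨ha, ha'⟩ ⟨hb, hb'⟩
    refine ⟨by simp [Arith.quot, ha, hb], ?_⟩
    simp only [Arith.quot, zipLists_val]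
    exact forall_mem_zipWith fun x hx y hy => h.add_valid (ha' x hx) (hb' y hy)
  · rintro a b ⟨ha, ha'⟩ ⟨hb, hb'⟩
    simp only [Arith.quot, zipLists_val]
    rw [hev_zipWith φ t 1 (ha.trans hb.symm), one_mul]
    intro x hx y hy
    rw [h.map_add (ha' x hx) (hb' y hy), one_mul]
  · rintro a b ⟨ha, ha'⟩ ⟨hb, hb'⟩
    refine (zipLists_ops_le fun x hx y hy => h.add_ops (ha' x hx) (hb' y hy)).trans ?_
    rw [hb]; exact hle
  · rintro a b ⟨ha, ha'⟩ ⟨hb, hb'⟩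
    refine ⟨by simp [Arith.quot, ha, hb], ?_⟩
    simp only [Arith.quot, zipLists_val]
    exact forall_mem_zipWith fun x hx y hy => h.sub_valid (ha' x hx) (hb' y hy)
  · rintro a b ⟨ha, ha'⟩ ⟨hb, hb'⟩
    simp only [Arith.quot, zipLists_val]
    rw [hev_zipWith φ t (-1) (ha.trans hb.symm)]
    · ring
    intro x hx y hy
    rw [h.map_sub (ha' x hx) (hb' y hy)]
    ring
  · rintro a b ⟨ha, ha'⟩ ⟨hb, hb'⟩
    refine (zipLists_ops_le fun x hx y hy => h.sub_ops (ha' x hx) (hb' y hy)).trans ?_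
    rw [hb]; exact hle
  · rintro a b ⟨ha, ha'⟩ ⟨hb, hb'⟩
    exact (h.quot_mul_spec hf ht hb hb' a ha' _ (by simp) hrep).1
  · rintro a b ⟨ha, ha'⟩ ⟨hb, hb'⟩
    refine ((h.quot_mul_spec hf ht hb hb' a ha' _ (by simp) hrep).2.1).trans ?_
    rw [hrep0]
    ring
  · rintro a b ⟨ha, ha'⟩ ⟨hb, hb'⟩
    refine ((h.quot_mul_spec hf ht hb hb' a ha' _ (by simp) hrep).2.2).trans ?_
    rw [ha]
    exact le_of_eq (by ring)

theorem gen_spec (hd : 0 < f.length) {t : T} (ht : t ^ f.length + hev φ t f = 0) :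
    ((A.gen f).val.length = f.length ∧ ∀ y ∈ (A.gen f).val, V y) ∧
      hev φ t (A.gen f).val = t ∧ (A.gen f).ops ≤ f.length * (2 * c) := by
  have hq := h.quot hf hd ht
  obtain ⟨h1, h2, h3⟩ := h.mulX_spec hf ht hq.one_valid.1 hq.one_valid.2
  refine ⟨h1, ?_, h3⟩
  rw [Arith.gen, h2, hq.map_one, one_mul]

end Quot

end Arith.Models

/-! ### Division, greatest common divisors, products of linear factors -/

namespace Arith.Models

variable {R : Type} {T : Type*} [CommRing T] {A : Arith R} {V : R → Prop} {φ : R → T} {c : ℕ}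

/-- The clause on `head?` records that division by a monic polynomial keeps the leading coefficient:
the quotient of a monic polynomial is again monic, which `splitOff` relies on when it drops the
leading entry. -/
theorem divSteps_spec (h : A.Models V φ c) {u : List R} (hu : ∀ y ∈ u, V y) (t : T) (k : ℕ)
    {a : List R} (ha : ∀ y ∈ a, V y) (hlen : a.length = k + u.length) :
    ((∀ y ∈ (A.divSteps u k a).val.1, V y) ∧ (A.divSteps u k a).val.1.length = k) ∧
      ((∀ y ∈ (A.divSteps u k a).val.2, V y) ∧ (A.divSteps u k a).val.2.length = u.length) ∧
      hev φ t a = hev φ t (A.divSteps u k a).val.1 * (t ^ u.length + hev φ t u) +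
        hev φ t (A.divSteps u k a).val.2 ∧
      (A.divSteps u k a).ops ≤ k * (u.length * (2 * c)) ∧
      ((A.divSteps u k a).val.1.head? = if k = 0 then none else a.head?) := by
  induction k generalizing a with
  | zero => simpa [divSteps] using ⟨ha, by simpa using hlen⟩
  | succ k ih =>
    cases a with
    | nil => simp at hlen; omega
    | cons x l =>
      have hx : V x := ha x (by simp)
      have hl : ∀ y ∈ l, V y := fun y hy => ha y (by simp [hy])
      have hll : l.length = k + u.length := by simp at hlen; omega
      have htl : (l.take u.length).length = u.length := by simp [hll]
      have htake : ∀ y ∈ l.take u.length, V y := fun y hy => hl y (List.mem_of_mem_take hy)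
      have h1 := h.subScaled_valid hx htake hu
      have h2 := h.subScaled_ops hx htake hu
      have h3 := h.hev_subScaled t hx htake hu htl
      have h4 := subScaled_length (A := A) (x := x) htl
      have hv : ∀ y ∈ (A.subScaled x (l.take u.length) u).val ++ l.drop u.length, V y := by
        intro y hy
        rcases List.mem_append.1 hy with hy | hy
        · exact h1 y hy
        · exact hl y (List.mem_of_mem_drop hy)
      obtain ⟨⟨g1, g2⟩, g3, g4, g5, -⟩ := ih hv (by simp [h4, hll]; omega)
      simp only [divSteps, Counted.val_bind, Counted.ops_bind, Counted.val_pure, Counted.ops_pure]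
      refine ⟨⟨?_, by simp [g2]⟩, g3, ?_, ?_, by simp⟩
      · intro y hy
        rcases List.mem_cons.1 hy with rfl | hy
        · exact hx
        · exact g1 y hy
      · have e1 : hev φ t l = hev φ t (l.take u.length) * t ^ k + hev φ t (l.drop u.length) := by
          conv_lhs => rw [← List.take_append_drop u.length l, hev_append]
          simp [hll]
        have e2 := hev_append φ t (A.subScaled x (l.take u.length) u).val (l.drop u.length)
        have e3 : (l.drop u.length).length = k := by simp [hll]
        rw [h3, e3] at e2
        rw [hev_cons, hev_cons, g2, hll]
        rw [e2] at g4
        rw [e1, pow_add]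
        linear_combination g4
      · rw [add_mul, one_mul]
        omega

theorem divMod_spec (h : A.Models V φ c) {u a : List R} (hu : ∀ y ∈ u, V y) (t : T)
    (ha : ∀ y ∈ a, V y) :
    ((∀ y ∈ (A.divMod a u).val.1, V y) ∧ (A.divMod a u).val.1.length = a.length - u.length) ∧
      ((∀ y ∈ (A.divMod a u).val.2, V y) ∧ (A.divMod a u).val.2.length ≤ u.length) ∧
      hev φ t a = hev φ t (A.divMod a u).val.1 * (t ^ u.length + hev φ t u) +
        hev φ t (A.divMod a u).val.2 ∧
      (A.divMod a u).ops ≤ a.length * (u.length * (2 * c)) ∧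
      (u.length < a.length → (A.divMod a u).val.1.head? = a.head?) := by
  rcases le_total u.length a.length with hle | hle
  · obtain ⟨h1, h2, h3, h4, h5⟩ := h.divSteps_spec hu t (a.length - u.length) ha (by omega)
    refine ⟨h1, ⟨h2.1, h2.2.le⟩, h3, h4.trans (Nat.mul_le_mul_right _ (Nat.sub_le _ _)), ?_⟩
    intro hlt
    rw [divMod, h5, if_neg (by omega)]
  · have e : a.length - u.length = 0 := by omega
    simp only [divMod, e, divSteps, Counted.val_pure, Counted.ops_pure]
    simp only [List.not_mem_nil, false_imp_iff, implies_true, List.length_nil, true_and, hev_nil,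
      zero_mul, zero_add, Nat.zero_le]
    exact ⟨⟨ha, hle⟩, fun hlt => by omega⟩

theorem lp_divMod (h : A.Models V φ c) {u a : List R} (hu : ∀ y ∈ u, V y)
    (ha : ∀ y ∈ a, V y) :
    lp φ a = lp φ (A.divMod a u).val.1 * mp φ u + lp φ (A.divMod a u).val.2 :=
  ((h.comp C).divMod_spec hu X ha).2.2.1

theorem lp_dropWhile_zero [DecidableEq R] (h : A.Models V φ c) (l : List R) :
    lp φ (l.dropWhile fun x => decide (x = A.zero)) = lp φ l := by
  induction l with
  | nil => rfl
  | cons x l ih =>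
    by_cases hx : x = A.zero
    · rw [List.dropWhile_cons_of_pos (by simpa using hx), ih, lp_cons, hx, h.map_zero]
      simp
    · rw [List.dropWhile_cons_of_neg (by simpa using hx)]

theorem lp_mapMul (h : A.Models V φ c) {x : R} (hx : V x) {l : List R} (hl : ∀ y ∈ l, V y) :
    lp φ (l.map fun y => (A.mul x y).val) = C (φ x) * lp φ l := by
  induction l with
  | nil => simp
  | cons y l ih =>
    rw [List.map_cons, lp_cons, lp_cons, ih fun z hz => hl z (by simp [hz]),
      h.map_mul hx (hl y (by simp)), List.length_map, C_mul]
    ring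

theorem lp_one_cons (h : A.Models V φ c) (u : List R) : lp φ (A.one :: u) = mp φ u := by
  rw [lp_cons, h.map_one, mp]
  simp

/-! ### Euclid's algorithm -/

section Gcd

variable {K : Type*} [Field K] {ψ : R → K} [DecidableEq R] (h : A.Models V ψ c) {q : ℕ}
  (hq : 2 ≤ q) (hfix : ∀ a, V a → ψ a ^ q = ψ a) (hinj : ∀ a b, V a → V b → ψ a = ψ b → a = b)
include h hq hfix hinj

/-- The invariant is the set of common divisors, so the result is characterised by divisibility
alone. The parameter `m` bounds all lengths in the recursion: the new dividend `A.one :: u` is one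
longer than `u`, and the divisors get shorter. -/
theorem gcdSteps_spec {m : ℕ} (k : ℕ) {u a : List R} (hu : ∀ y ∈ u, V y) (ha : ∀ y ∈ a, V y)
    (hk : u.length < k) (hum : u.length ≤ m) (ham : a.length ≤ m + 1) :
    ((∀ y ∈ (A.gcdSteps q k u a).val, V y) ∧ (A.gcdSteps q k u a).val.length ≤ u.length) ∧
      (∀ P, P ∣ mp ψ (A.gcdSteps q k u a).val ↔ P ∣ mp ψ u ∧ P ∣ lp ψ a) ∧
      (A.gcdSteps q k u a).ops ≤ k * ((m + 1) * (m * (2 * c)) + 2 * (q - 2).size * c + m * c) := by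
  induction k generalizing u a with
  | zero => omega
  | succ k ih =>
    obtain ⟨-, ⟨hr, hrl⟩, -, hops, -⟩ := h.divMod_spec hu 0 ha
    have hdiv := h.lp_divMod hu ha
    have hops' : (A.divMod a u).ops ≤ (m + 1) * (m * (2 * c)) :=
      hops.trans (Nat.mul_le_mul ham (Nat.mul_le_mul_right _ hum))
    have hdvd : ∀ P, P ∣ mp ψ u ∧ P ∣ lp ψ (A.divMod a u).val.2 ↔ P ∣ mp ψ u ∧ P ∣ lp ψ a := by
      refine fun P => and_congr_right fun hP => ?_
      rw [hdiv]
      exact (dvd_add_right (hP.mul_left _)).symm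
    have hdw := h.lp_dropWhile_zero (A.divMod a u).val.2
    have hsuf := List.dropWhile_suffix (fun x => decide (x = A.zero)) (l := (A.divMod a u).val.2)
    rw [add_mul, one_mul]
    simp only [gcdSteps, Counted.val_bind, Counted.ops_bind]
    rcases hcase : (A.divMod a u).val.2.dropWhile (fun x => decide (x = A.zero)) with _ | ⟨x, l⟩
    · simp only [Counted.val_pure, Counted.ops_pure]
      refine ⟨⟨hu, le_rfl⟩, fun P => ?_, by omega⟩
      rw [← hdvd, ← hdw, hcase]
      simp
    · simp only [Counted.val_bind, Counted.ops_bind, mapList_val]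
      rw [hcase] at hsuf hdw
      have hxl : ∀ y ∈ x :: l, V y := fun y hy => hr y (hsuf.subset hy)
      have hx : V x := hxl x (by simp)
      have hl : ∀ y ∈ l, V y := fun y hy => hxl y (by simp [hy])
      have hlen : l.length < u.length := by
        have := hsuf.length_le
        simp at this
        omega
      -- `dropWhile` tests representatives; injectivity of `ψ` turns a nonzero representative into a
      -- nonzero field element.
      have hx0 : ψ x ≠ 0 := by
        intro h0
        have hxz : x = A.zero := hinj _ _ hx h.zero_valid (h0.trans h.map_zero.symm)
        have hne : (A.divMod a u).val.2.dropWhile (fun x => decide (x = A.zero)) ≠ [] := by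
          rw [hcase]; simp
        have := List.head_dropWhile_not (fun x => decide (x = A.zero)) hne
        simp [hcase, hxz] at this
      have hi := h.pow_valid hx (q - 2)
      -- From `x ^ q = x`: multiplying `x ^ (q - 2) * x` by `x` once more gives `x`, and `x`
      -- cancels.
      have hi' : ψ (A.pow x (q - 2)).val = (ψ x)⁻¹ := by
        rw [h.map_pow hx]
        refine eq_inv_of_mul_eq_one_left ?_
        refine mul_right_cancel₀ hx0 ?_
        rw [← pow_succ, ← pow_succ, one_mul, show q - 2 + 1 + 1 = q by omega, hfix x hx]
      have hl' : ∀ y ∈ l.map fun y => (A.mul (A.pow x (q - 2)).val y).val, V y := by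
        intro y hy
        obtain ⟨z, hz, rfl⟩ := List.mem_map.1 hy
        exact h.mul_valid hi (hl z hz)
      have hu' : ∀ y ∈ A.one :: u, V y := by
        intro y hy
        rcases List.mem_cons.1 hy with rfl | hy
        · exact h.one_valid
        · exact hu y hy
      have hmp : mp ψ (l.map fun y => (A.mul (A.pow x (q - 2)).val y).val) =
          C (ψ x)⁻¹ * lp ψ (x :: l) := by
        rw [mp, h.lp_mapMul hi hl, lp_cons, hi', List.length_map, mul_add, ← mul_assoc, ← C_mul,
          inv_mul_cancel₀ hx0, C_1, one_mul]
      obtain ⟨⟨g1, g2⟩, g3, g4⟩ := ih hl' hu' (by simp; omega) (by simp; omega) (by simp; omega)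
      refine ⟨⟨g1, g2.trans (by simp; omega)⟩, fun P => ?_, ?_⟩
      · rw [g3, h.lp_one_cons, ← hdvd, ← hdw, hmp, and_comm]
        refine and_congr_right fun _ => ?_
        have hunit : IsUnit (C (ψ x)⁻¹) := (Ne.isUnit (inv_ne_zero hx0)).map C
        exact hunit.dvd_mul_left
      · have e1 := h.pow_ops hx (q - 2)
        have e2 : (mapList (A.mul (A.pow x (q - 2)).val) l).ops ≤ m * c :=
          (mapList_ops_le fun y hy => h.mul_ops hi (hl y hy)).trans
            (Nat.mul_le_mul_right _ (by omega))
        omega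

theorem gcd_spec {u a : List R} (hu : ∀ y ∈ u, V y) (ha : ∀ y ∈ a, V y)
    (hau : a.length ≤ u.length + 1) :
    (∀ y ∈ (A.gcd q u a).val, V y) ∧
      (∀ P, P ∣ mp ψ (A.gcd q u a).val ↔ P ∣ mp ψ u ∧ P ∣ lp ψ a) ∧
      (A.gcd q u a).ops ≤ (u.length + 1) * ((u.length + 1) * (u.length * (2 * c)) +
        2 * (q - 2).size * c + u.length * c) := by
  obtain ⟨h1, h2, h3⟩ :=
    gcdSteps_spec h hq hfix hinj (m := u.length) (u.length + 1) hu ha (by omega) le_rfl hau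
  exact ⟨h1.1, h2, h3⟩

end Gcd

/-- Multiplying the monic polynomial with tail `l` by `X - z` gives the tail `X * l - z * (1 :: l)`,
since the leading terms shift by one degree. -/
theorem expandFold_spec (h : A.Models V φ c) (zs : List R) (hz : ∀ y ∈ zs, V y) (l : List R)
    (hl : ∀ y ∈ l, V y) :
    let r := foldList (fun c z => A.subScaled z (c ++ [A.zero]) (A.one :: c)) l zs
    ((∀ y ∈ r.val, V y) ∧ r.val.length = l.length + zs.length) ∧
      mp φ r.val = mp φ l * (zs.map fun z => X - C (φ z)).prod ∧
      r.ops ≤ zs.length * ((l.length + zs.length) * (2 * c)) := by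
  induction zs generalizing l with
  | nil => simpa [foldList] using hl
  | cons z zs ih =>
    have hz0 : V z := hz z (by simp)
    have h1 : ∀ y ∈ l ++ [A.zero], V y := by
      intro y hy
      rcases List.mem_append.1 hy with hy | hy
      · exact hl y hy
      · rw [List.mem_singleton.1 hy]; exact h.zero_valid
    have h2 : ∀ y ∈ A.one :: l, V y := by
      intro y hy
      rcases List.mem_cons.1 hy with rfl | hy
      · exact h.one_valid
      · exact hl y hy
    have hlen : (l ++ [A.zero]).length = (A.one :: l).length := by simp
    have h3 := h.subScaled_valid hz0 h1 h2
    have h4 := h.subScaled_ops hz0 h1 h2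
    have h5 : lp φ (A.subScaled z (l ++ [A.zero]) (A.one :: l)).val =
        lp φ (l ++ [A.zero]) - C (φ z) * lp φ (A.one :: l) :=
      (h.comp C).hev_subScaled X hz0 h1 h2 hlen
    have h6 := subScaled_length (A := A) (x := z) hlen
    have h7 : lp φ (l ++ [A.zero]) = lp φ l * X := by
      have := hev_concat (fun a => C (φ a)) X l A.zero
      simpa [lp, h.map_zero] using this
    obtain ⟨⟨g1, g2⟩, g3, g4⟩ := ih (fun y hy => hz y (by simp [hy])) _ h3
    simp only [foldList, Counted.val_bind, Counted.ops_bind] at g1 g2 g3 g4 ⊢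
    rw [h6, List.length_cons] at g2 g4
    refine ⟨⟨g1, by rw [g2, List.length_cons]; omega⟩, ?_, ?_⟩
    · rw [g3, List.map_cons, List.prod_cons, ← mul_assoc]
      congr 1
      rw [mp, h5, h6, h7, h.lp_one_cons, mp, List.length_cons]
      ring
    · rw [List.length_cons] at h4 ⊢
      have e : (l.length + 1) * (2 * c) ≤ (l.length + (zs.length + 1)) * (2 * c) :=
        Nat.mul_le_mul_right _ (by omega)
      rw [show l.length + 1 + zs.length = l.length + (zs.length + 1) by ring] at g4
      rw [add_mul zs.length, one_mul]
      omega

theorem expand_spec (h : A.Models V φ c) {zs : List R} (hz : ∀ y ∈ zs, V y) :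
    ((∀ y ∈ (A.expand zs).val, V y) ∧ (A.expand zs).val.length = zs.length) ∧
      mp φ (A.expand zs).val = (zs.map fun z => X - C (φ z)).prod ∧
      (A.expand zs).ops ≤ zs.length * (zs.length * (2 * c)) := by
  simpa [expand] using h.expandFold_spec zs hz [] (by simp)

end Arith.Models

theorem Arith.iterates_spec {R : Type} {T : Type*} {V : R → Prop} {φ : R → T} {c : ℕ}
    {g : R → Counted R} {σ : T → T} (hV : ∀ x, V x → V (g x).val)
    (hσ : ∀ x, V x → φ (g x).val = σ (φ x)) (hc : ∀ x, V x → (g x).ops ≤ c) (k : ℕ) {z : R}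
    (hz : V z) :
    (∀ y ∈ (iterates g k z).val, V y) ∧
      (iterates g k z).val.map φ = (List.range k).map (fun j => σ^[j] (φ z)) ∧
      (iterates g k z).ops ≤ k * c := by
  match k with
  | 0 => simp [iterates]
  | 1 => simpa [iterates] using hz
  | k + 2 =>
    obtain ⟨h1, h2, h3⟩ := iterates_spec hV hσ hc (k + 1) (hV z hz)
    have h4 := hc z hz
    simp only [iterates, Counted.val_bind, Counted.ops_bind, Counted.val_pure, Counted.ops_pure]
    refine ⟨?_, ?_, ?_⟩
    · intro y hy
      rcases List.mem_cons.1 hy with rfl | hy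
      · exact hz
      · exact h1 y hy
    · rw [List.map_cons, h2, hσ z hz, List.range_succ_eq_map (n := k + 1), List.map_cons,
        List.map_map]
      rfl
    · rw [show k + 2 = (k + 1) + 1 by rfl, add_mul (k + 1), one_mul]
      omega

theorem Arith.iterates_length {R : Type} (g : R → Counted R) (k : ℕ) (z : R) :
    (iterates g k z).val.length = k := by
  match k with
  | 0 => rfl
  | 1 => rfl
  | k + 2 => simp [iterates, iterates_length g (k + 1)]

/-! ### The Cooley–Tukey transform -/

namespace Arith

theorem forall₂_map {α α' β β' : Type*} {P : α → α' → Prop} {Q : β → β' → Prop} {f : α → β}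
    {g : α' → β'} {l : List α} {l' : List α'} (h : List.Forall₂ P l l')
    (hfg : ∀ a b, P a b → Q (f a) (g b)) : List.Forall₂ Q (l.map f) (l'.map g) := by
  induction h with
  | nil => simp
  | cons h _ ih => exact List.Forall₂.cons (hfg _ _ h) ih

theorem forall₂_range_map {β β' : Type*} {Q : β → β' → Prop} {f : ℕ → β} {g : ℕ → β'} (n : ℕ)
    (h : ∀ i < n, Q (f i) (g i)) : List.Forall₂ Q ((List.range n).map f) ((List.range n).map g) := by
  rw [List.forall₂_map_left_iff, List.forall₂_map_right_iff, List.forall₂_same]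
  simpa using h

theorem forall₂_getD {β β' : Type*} {Q : β → β' → Prop} {l : List β} {l' : List β'}
    (h : List.Forall₂ Q l l') {z : β} {z' : β'} (hz : Q z z') (i : ℕ) :
    Q (l.getD i z) (l'.getD i z') := by
  induction h generalizing i with
  | nil => simpa using hz
  | cons h _ ih =>
    cases i with
    | zero => simpa using h
    | succ i => simpa using ih i

theorem forall₂_zipIdx {β β' : Type*} {Q : β → β' → Prop} {l : List β} {l' : List β'}
    (h : List.Forall₂ Q l l') (n : ℕ) :
    List.Forall₂ (fun (x : β × ℕ) (y : β' × ℕ) => Q x.1 y.1 ∧ x.2 = y.2)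
      (l.zipIdx n) (l'.zipIdx n) := by
  induction h generalizing n with
  | nil => simp
  | cons h _ ih => simpa [List.zipIdx_cons] using ⟨h, ih (n + 1)⟩

/-! ### Comparison of two runs of the transform -/

variable {R R' : Type} {A : Arith R} {A' : Arith R'}

theorem powBits_rel {P : R → R' → Prop} (h1 : P A.one A'.one)
    (hmul : ∀ {a a' b b'}, P a a' → P b b' → P (A.mul a b).val (A'.mul a' b').val) {a : R} {a' : R'}
    (ha : P a a') (bs : List Bool) : P (A.powBits a bs).val (A'.powBits a' bs).val := by
  induction bs with
  | nil => exact h1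
  | cons b bs ih =>
    cases b
    · exact hmul ih ih
    · exact hmul (hmul ih ih) ha

theorem iterates_rel {P : R → R' → Prop} {g : R → Counted R} {g' : R' → Counted R'}
    (hg : ∀ {a a'}, P a a' → P (g a).val (g' a').val) (k : ℕ) {z : R} {z' : R'} (hz : P z z') :
    List.Forall₂ P (iterates g k z).val (iterates g' k z').val := by
  match k with
  | 0 => simp [iterates]
  | 1 => simpa [iterates] using hz
  | k + 2 => simpa [iterates] using ⟨hz, iterates_rel hg (k + 1) (hg hz)⟩

theorem horner_rel {P Q : R → R' → Prop} (h0 : Q A.zero A'.zero)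
    (hadd : ∀ {a a' b b'}, Q a a' → Q b b' → Q (A.add a b).val (A'.add a' b').val)
    (hmul : ∀ {a a' b b'}, Q a a' → P b b' → Q (A.mul a b).val (A'.mul a' b').val)
    {x : R} {x' : R'} (hx : P x x') {l : List R} {l' : List R'} (hl : List.Forall₂ Q l l') :
    Q (A.horner x l).val (A'.horner x' l').val := by
  induction hl with
  | nil => exact h0
  | cons h _ ih => exact hadd (hmul ih hx) h

/-- Two runs of the transform stay related, where `P` relates the powers of the root of unity and
`Q` the transformed values. -/
theorem fft_rel {P Q : R → R' → Prop} (h1 : P A.one A'.one)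
    (hP : ∀ {a a' b b'}, P a a' → P b b' → P (A.mul a b).val (A'.mul a' b').val)
    (h0 : Q A.zero A'.zero)
    (hadd : ∀ {a a' b b'}, Q a a' → Q b b' → Q (A.add a b).val (A'.add a' b').val)
    (hmul : ∀ {a a' b b'}, Q a a' → P b b' → Q (A.mul a b).val (A'.mul a' b').val)
    (ms : List ℕ) {ω : R} {ω' : R'} (hω : P ω ω') {a : List R} {a' : List R'}
    (ha : List.Forall₂ Q a a') :
    List.Forall₂ Q (A.fft ms ω a).val (A'.fft ms ω' a').val := by
  induction ms generalizing ω ω' a a' with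
  | nil =>
    cases ha with
    | nil => simpa [fft] using h0
    | cons h _ => simpa [fft] using h
  | cons m ms ih =>
    simp only [fft, Counted.val_bind, mapList_val]
    refine forall₂_map (forall₂_zipIdx (iterates_rel (fun h => hP h hω) _ h1) 0) ?_
    rintro ⟨x, i⟩ ⟨x', i'⟩ ⟨hx, hi⟩
    obtain rfl : i = i' := hi
    refine horner_rel h0 hadd hmul hx ?_
    rw [List.map_map, List.map_map]
    refine forall₂_range_map m fun j _ => ?_
    refine forall₂_getD (ih (powBits_rel h1 hP hω _) ?_) h0 _
    exact forall₂_range_map _ fun k _ => forall₂_getD ha h0 _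

/-- The comparison theorem `fft_rel`, applied with the graph of `φ` on valid elements as both
relations, transports the transform to the ring `T` itself. -/
theorem Models.fft_spec {T : Type} [CommRing T] {V : R → Prop} {φ : R → T} {c : ℕ}
    (h : A.Models V φ c) (ms : List ℕ) {ω : R} (hω : V ω) {a : List R} (ha : ∀ x ∈ a, V x) :
    (∀ x ∈ (A.fft ms ω a).val, V x) ∧
      (A.fft ms ω a).val.map φ = ((Arith.base T).fft ms (φ ω) (a.map φ)).val := by
  have key := fft_rel (A := A) (A' := Arith.base T) (P := fun x y => V x ∧ φ x = y)
    (Q := fun x y => V x ∧ φ x = y) ⟨h.one_valid, h.map_one⟩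
    (fun ha hb => ⟨h.mul_valid ha.1 hb.1, by rw [h.map_mul ha.1 hb.1, ha.2, hb.2]; rfl⟩)
    ⟨h.zero_valid, h.map_zero⟩
    (fun ha hb => ⟨h.add_valid ha.1 hb.1, by rw [h.map_add ha.1 hb.1, ha.2, hb.2]; rfl⟩)
    (fun ha hb => ⟨h.mul_valid ha.1 hb.1, by rw [h.map_mul ha.1 hb.1, ha.2, hb.2]; rfl⟩)
    ms (ω := ω) (ω' := φ ω) ⟨hω, rfl⟩ (a := a) (a' := a.map φ) (by
      rw [List.forall₂_map_right_iff, List.forall₂_same]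
      exact fun x hx => ⟨ha x hx, rfl⟩)
  generalize ((Arith.base T).fft ms (φ ω) (a.map φ)).val = l' at key
  generalize (A.fft ms ω a).val = l at key
  induction key with
  | nil => simp
  | cons h _ ih =>
    simp only [List.mem_cons, forall_eq_or_imp, List.map_cons, List.cons.injEq]
    exact ⟨⟨h.1, ih.1⟩, h.2, ih.2⟩

theorem Models.horner_ops {T : Type*} [CommRing T] {V : R → Prop} {φ : R → T} {c : ℕ}
    (h : A.Models V φ c) {x : R} (hx : V x) {l : List R} (hl : ∀ y ∈ l, V y) :
    V (A.horner x l).val ∧ (A.horner x l).ops ≤ l.length * (2 * c) := by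
  induction l with
  | nil => simpa [horner] using h.zero_valid
  | cons y l ih =>
    obtain ⟨h1, h2⟩ := ih fun z hz => hl z (by simp [hz])
    have h3 := h.mul_valid h1 hx
    have h4 := h.mul_ops h1 hx
    have hy := hl y (by simp)
    refine ⟨h.add_valid h3 hy, ?_⟩
    have h5 := h.add_ops h3 hy
    simp only [horner, Counted.ops_bind, List.length_cons, add_mul, one_mul]
    omega

/-- There are `ms.length` levels with `ms.prod` entries each. An entry is charged `5 * w * c` per
level: `2 * w * c` for Horner's scheme with `m ≤ w` values, at most `w * c` for its power of `ω`,
and `2 * w * c` to cover the computation of `ω ^ m`. -/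
theorem Models.fft_ops {T : Type} [CommRing T] {V : R → Prop} {φ : R → T} {c w : ℕ}
    (h : A.Models V φ c) (ms : List ℕ) (hms : ∀ m ∈ ms, 0 < m ∧ m ≤ w) {ω : R} (hω : V ω)
    {a : List R} (ha : ∀ x ∈ a, V x) :
    (A.fft ms ω a).ops ≤ ms.prod * (ms.length * (5 * w * c)) := by
  induction ms generalizing ω a with
  | nil => simp [fft]
  | cons m ms ih =>
    have hm := hms m (by simp)
    have hms' : ∀ m ∈ ms, 0 < m ∧ m ≤ w := fun k hk => hms k (by simp [hk])
    have hpos : 0 < ms.prod := List.prod_pos fun k hk => (hms' k hk).1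
    have hget : ∀ {l : List R}, (∀ x ∈ l, V x) → ∀ i, V (l.getD i A.zero) := by
      intro l hl i
      rcases lt_or_ge i l.length with hi | hi
      · rw [List.getD_eq_getElem _ _ hi]; exact hl _ (List.getElem_mem hi)
      · rw [List.getD_eq_default _ _ hi]; exact h.zero_valid
    have hωm := h.pow_valid hω m
    have hsub : ∀ j, ∀ x ∈ (List.range ms.prod).map fun k => a.getD (m * k + j) A.zero, V x := by
      intro j x hx
      obtain ⟨k, -, rfl⟩ := List.mem_map.1 hx
      exact hget ha _
    obtain ⟨i1, -, i3⟩ := iterates_spec (V := V) (φ := φ) (g := fun z => A.mul z ω)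
      (σ := fun z => z * φ ω) (c := c) (fun x hx => h.mul_valid hx hω)
      (fun x hx => h.map_mul hx hω) (fun x hx => h.mul_ops hx hω) (m * ms.prod) h.one_valid
    have b1 : (A.pow ω m).ops ≤ m * ms.prod * (2 * w * c) := by
      refine (h.pow_ops hω m).trans ?_
      have : m.size ≤ w := (Nat.size_le.2 Nat.lt_two_pow_self).trans hm.2
      calc 2 * m.size * c ≤ 1 * (2 * w * c) := by
            rw [one_mul]; exact Nat.mul_le_mul_right _ (Nat.mul_le_mul_left _ this)
        _ ≤ _ := Nat.mul_le_mul_right _ (Nat.mul_pos hm.1 hpos)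
    have b2 : (mapList (fun j => A.fft ms (A.pow ω m).val
        ((List.range ms.prod).map fun k => a.getD (m * k + j) A.zero)) (List.range m)).ops ≤
        m * (ms.prod * (ms.length * (5 * w * c))) := by
      refine (mapList_ops_le fun j _ => ih hms' hωm (hsub j)).trans ?_
      simp
    simp only [fft, Counted.ops_bind, mapList_val]
    set pts := (iterates (fun z => A.mul z ω) (m * ms.prod) A.one).val with hpts
    have b3 : (mapList (fun xi : R × ℕ => A.horner xi.1 (((List.range m).map fun j =>
        (A.fft ms (A.pow ω m).val
          ((List.range ms.prod).map fun k => a.getD (m * k + j) A.zero)).val).map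
          fun b => b.getD (xi.2 % ms.prod) A.zero)) pts.zipIdx).ops ≤
        m * ms.prod * (2 * w * c) := by
      refine (mapList_ops_le (c := 2 * w * c) ?_).trans (le_of_eq ?_)
      · rintro ⟨x, i⟩ hxi
        have hx : V x := i1 x (List.fst_mem_of_mem_zipIdx hxi)
        refine (h.horner_ops hx ?_).2.trans ?_
        · intro y hy
          simp only [List.map_map, List.mem_map, Function.comp] at hy
          obtain ⟨j, -, rfl⟩ := hy
          exact hget (h.fft_spec ms hωm (hsub j)).1 _
        · simp only [List.length_map, List.length_range]
          calc m * (2 * c) ≤ w * (2 * c) := Nat.mul_le_mul_right _ hm.2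
            _ = 2 * w * c := by ring
      · rw [List.length_zipIdx, hpts, iterates_length]
    have b4 : m * ms.prod * c ≤ m * ms.prod * (w * c) := by
      refine Nat.mul_le_mul_left _ (Nat.le_mul_of_pos_left c (hm.1.trans_le hm.2))
    rw [List.prod_cons, List.length_cons]
    calc _ ≤ m * ms.prod * (2 * w * c) + (m * (ms.prod * (ms.length * (5 * w * c))) +
          (m * ms.prod * (w * c) + m * ms.prod * (2 * w * c))) :=
        add_le_add b1 (add_le_add b2 (add_le_add (i3.trans b4) b3))
      _ = _ := by ring

/-! ### The value of the transform -/

theorem base_zero (T : Type) [CommRing T] : (Arith.base T).zero = 0 := rfl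

theorem base_one (T : Type) [CommRing T] : (Arith.base T).one = 1 := rfl

theorem base_horner {T : Type} [CommRing T] (x : T) (l : List T) :
    ((Arith.base T).horner x l).val = ∑ j ∈ Finset.range l.length, l.getD j 0 * x ^ j := by
  induction l with
  | nil => rfl
  | cons c l ih =>
    rw [List.length_cons, Finset.sum_range_succ']
    have : ((Arith.base T).horner x (c :: l)).val = ((Arith.base T).horner x l).val * x + c := rfl
    rw [this, ih, Finset.sum_mul]
    simp [pow_succ, mul_assoc]

theorem base_pow {T : Type} [CommRing T] (x : T) (n : ℕ) : ((Arith.base T).pow x n).val = x ^ n :=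
  (models_base (RingHom.id T)).map_pow trivial n

theorem base_powers {T : Type} [CommRing T] (ω : T) (n : ℕ) :
    (iterates (fun z => (Arith.base T).mul z ω) n 1).val = (List.range n).map fun j => ω ^ j := by
  have := (iterates_spec (V := fun _ : T => True) (φ := id) (σ := fun z => z * ω) (c := 1)
    (g := fun z => (Arith.base T).mul z ω) (fun _ _ => trivial) (fun _ _ => rfl)
    (fun _ _ => le_rfl) n (z := 1) trivial).2.1
  rw [List.map_id] at this
  rw [this]
  simp [mul_right_iterate]

theorem sum_range_mul_eq {M : Type*} [AddCommMonoid M] (f : ℕ → M) (m n : ℕ) :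
    ∑ x ∈ Finset.range (m * n), f x =
      ∑ k ∈ Finset.range n, ∑ j ∈ Finset.range m, f (m * k + j) := by
  induction n with
  | zero => simp
  | succ n ih => rw [Nat.mul_succ, Finset.sum_range_add, ih, Finset.sum_range_succ]

/-- Write the summation index as `m * k + j`: then `ω ^ (i * (m * k + j))` is `(ω ^ i) ^ j` times
the power `i * k` of `ω ^ m`. Only `ω ^ ms.prod = 1` enters, not primitivity. -/
theorem base_fft {T : Type} [CommRing T] (ms : List ℕ) {ω : T} (hω : ω ^ ms.prod = 1)
    (a : List T) :
    ((Arith.base T).fft ms ω a).val =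
      (List.range ms.prod).map fun i => ∑ k ∈ Finset.range ms.prod, a.getD k 0 * ω ^ (i * k) := by
  induction ms generalizing ω a with
  | nil => cases a <;> simp [fft, base]
  | cons m ms ih =>
    rw [List.prod_cons] at hω ⊢
    have hωm : (ω ^ m) ^ ms.prod = 1 := by rw [← pow_mul, hω]
    simp only [fft, Counted.val_bind, mapList_val, base_pow, base_one, base_zero, base_powers,
      ih hωm]
    refine List.ext_getElem (by simp) fun i hi1 hi2 => ?_
    have hi : i < m * ms.prod := by simpa using hi2
    have hn : 0 < ms.prod := Nat.pos_of_ne_zero fun h0 => by simp [h0] at hi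
    simp only [List.getElem_map, List.getElem_zipIdx, List.getElem_range, zero_add, base_horner,
      List.length_map, List.length_range]
    rw [sum_range_mul_eq, Finset.sum_comm]
    refine Finset.sum_congr rfl fun j hj => ?_
    rw [Finset.mem_range] at hj
    rw [List.getD_eq_getElem _ _ (by simpa using hj)]
    simp only [List.getElem_map, List.getElem_range]
    rw [List.getD_eq_getElem _ _ (by simpa using Nat.mod_lt _ hn)]
    simp only [List.getElem_map, List.getElem_range]
    rw [Finset.sum_mul]
    refine Finset.sum_congr rfl fun k hk => ?_
    rw [Finset.mem_range] at hk
    rw [List.getD_eq_getElem _ _ (by simpa using hk)]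
    simp only [List.getElem_map, List.getElem_range]
    -- The power of `ω ^ m` depends on `i` only modulo `ms.prod`, which is why the entry `i %
    -- ms.prod` of the partial transforms is the right one.
    have e : ω ^ (i * (m * k)) = ω ^ (m * (i % ms.prod * k)) := by
      conv_lhs => rw [← Nat.div_add_mod i ms.prod]
      rw [show (ms.prod * (i / ms.prod) + i % ms.prod) * (m * k) =
        m * ms.prod * (i / ms.prod * k) + m * (i % ms.prod * k) by ring, pow_add, pow_mul, hω,
        one_pow, one_mul]
    rw [mul_add, pow_add, e, ← pow_mul, ← pow_mul, mul_assoc]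

end Arith

/-! ### Laws of randomized computations -/

theorem tsum_bind_mul {α β : Type*} (μ : PMF α) (f : α → PMF β) (g : β → ℝ≥0∞) :
    ∑' b, μ.bind f b * g b = ∑' a, μ a * ∑' b, f a b * g b := by
  simp_rw [PMF.bind_apply, ← ENNReal.tsum_mul_right, ← ENNReal.tsum_mul_left]
  rw [ENNReal.tsum_comm]
  simp_rw [mul_assoc]

theorem tsum_pure_mul {α : Type*} (a : α) (g : α → ℝ≥0∞) : ∑' b, PMF.pure a b * g b = g a := by
  rw [tsum_eq_single a]
  · simp
  · intro b hb
    simp [PMF.pure_apply, hb]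

theorem tsum_map_mul {α β : Type*} (μ : PMF α) (f : α → β) (g : β → ℝ≥0∞) :
    ∑' b, μ.map f b * g b = ∑' a, μ a * g (f a) := by
  rw [PMF.map, tsum_bind_mul]
  simp_rw [Function.comp_apply, tsum_pure_mul]

namespace Rand

variable {α β : Type}

/-- The mean of `h` over result and number of operations. -/
noncomputable def mean (x : Rand α) (h : Option α × ℕ → ℝ≥0∞) : ℝ≥0∞ := ∑' r, x.law r * h r

theorem expectedOps_eq_mean (x : Rand α) : x.expectedOps = x.mean fun r => (r.2 : ℝ≥0∞) := rfl

theorem cutOffProb_eq_mean (x : Rand α) :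
    x.cutOffProb = x.mean fun r => if r.1.isNone then 1 else 0 := by
  rw [mean, ENNReal.tsum_prod', tsum_eq_single none]
  · simp [cutOffProb]
  · intro o ho
    cases o with
    | none => exact absurd rfl ho
    | some a => simp

theorem mean_pure (a : α) (h : Option α × ℕ → ℝ≥0∞) : (pure a : Rand α).mean h = h (some a, 0) :=
  tsum_pure_mul _ _

theorem mean_cutOff (h : Option α × ℕ → ℝ≥0∞) : (cutOff : Rand α).mean h = h (none, 0) :=
  tsum_pure_mul _ _

theorem mean_lift (c : Counted α) (h : Option α × ℕ → ℝ≥0∞) :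
    (lift c).mean h = h (some c.val, c.ops) :=
  tsum_pure_mul _ _

theorem mean_sample (μ : PMF α) (h : Option α × ℕ → ℝ≥0∞) :
    (sample μ).mean h = ∑' a, μ a * h (some a, 0) :=
  tsum_map_mul _ _ _

theorem mean_bind (x : Rand α) (f : α → Rand β) (h : Option β × ℕ → ℝ≥0∞) :
    (x >>= f).mean h = x.mean fun r => match r.1 with
      | none => h (none, r.2)
      | some a => (f a).mean fun y => h (y.1, r.2 + y.2) := by
  refine (tsum_bind_mul _ _ _).trans ?_
  refine tsum_congr fun r => ?_
  congr 1
  obtain ⟨_ | a, n⟩ := r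
  · exact tsum_pure_mul _ _
  · exact tsum_map_mul _ _ _

theorem mean_add (x : Rand α) (g h : Option α × ℕ → ℝ≥0∞) :
    (x.mean fun r => g r + h r) = x.mean g + x.mean h := by
  simp only [mean, mul_add]
  exact ENNReal.tsum_add

theorem mean_mono (x : Rand α) {g h : Option α × ℕ → ℝ≥0∞}
    (hgh : ∀ r ∈ x.law.support, g r ≤ h r) : x.mean g ≤ x.mean h := by
  refine ENNReal.tsum_le_tsum fun r => ?_
  by_cases hr : x.law r = 0
  · simp [hr]
  · exact mul_le_mul_right (hgh r ((PMF.mem_support_iff _ _).2 hr)) _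

theorem mean_const (x : Rand α) (B : ℝ≥0∞) : (x.mean fun _ => B) = B := by
  rw [mean, ENNReal.tsum_mul_right, x.law.tsum_coe, one_mul]

theorem expectedOps_pure (a : α) : (pure a : Rand α).expectedOps = 0 := by
  rw [expectedOps_eq_mean, mean_pure]; simp

theorem cutOffProb_pure (a : α) : (pure a : Rand α).cutOffProb = 0 := by
  rw [cutOffProb_eq_mean, mean_pure]; simp

theorem expectedOps_cutOff : (cutOff : Rand α).expectedOps = 0 := by
  rw [expectedOps_eq_mean, mean_cutOff]; simp

theorem cutOffProb_cutOff : (cutOff : Rand α).cutOffProb = 1 := by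
  rw [cutOffProb_eq_mean, mean_cutOff]; simp

theorem expectedOps_lift (c : Counted α) : (lift c).expectedOps = c.ops := by
  rw [expectedOps_eq_mean, mean_lift]

theorem cutOffProb_lift (c : Counted α) : (lift c).cutOffProb = 0 := by
  rw [cutOffProb_eq_mean, mean_lift]; simp

/-- A run cut off in `x` adds no further cost. The bound on the continuation is required only for
possible results, so that invariants of `x` may enter cost estimates. -/
theorem expectedOps_bind_le {x : Rand α} {f : α → Rand β} {B : ℝ≥0∞}
    (h : ∀ a, x.CanReturn a → (f a).expectedOps ≤ B) :
    (x >>= f).expectedOps ≤ x.expectedOps + B := by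
  rw [expectedOps_eq_mean, mean_bind, expectedOps_eq_mean, ← mean_const x B, ← mean_add]
  refine mean_mono x ?_
  rintro ⟨_ | a, n⟩ hr
  · simp
  · simp only [Nat.cast_add, mean_add, mean_const]
    exact add_le_add_right (h a ⟨n, hr⟩) _

theorem cutOffProb_bind_le {x : Rand α} {f : α → Rand β} {B : ℝ≥0∞}
    (h : ∀ a, x.CanReturn a → (f a).cutOffProb ≤ B) :
    (x >>= f).cutOffProb ≤ x.cutOffProb + B := by
  rw [cutOffProb_eq_mean, mean_bind, cutOffProb_eq_mean, ← mean_const x B, ← mean_add]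
  refine mean_mono x ?_
  rintro ⟨_ | a, n⟩ hr
  · simp
  · have := h a ⟨n, hr⟩
    rw [cutOffProb_eq_mean] at this
    simpa using this

theorem expectedOps_sample_bind (μ : PMF α) (f : α → Rand β) :
    (sample μ >>= f).expectedOps = ∑' a, μ a * (f a).expectedOps := by
  rw [expectedOps_eq_mean, mean_bind, mean_sample]
  simp [expectedOps_eq_mean]

theorem cutOffProb_sample_bind (μ : PMF α) (f : α → Rand β) :
    (sample μ >>= f).cutOffProb = ∑' a, μ a * (f a).cutOffProb := by
  rw [cutOffProb_eq_mean, mean_bind, mean_sample]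
  simp [cutOffProb_eq_mean]

theorem expectedOps_lift_bind (c : Counted α) (f : α → Rand β) :
    (lift c >>= f).expectedOps = c.ops + (f c.val).expectedOps := by
  rw [expectedOps_eq_mean, mean_bind, mean_lift]
  simp only [Nat.cast_add, mean_add, mean_const]
  rfl

theorem cutOffProb_lift_bind (c : Counted α) (f : α → Rand β) :
    (lift c >>= f).cutOffProb = (f c.val).cutOffProb := by
  rw [cutOffProb_eq_mean, mean_bind, mean_lift, cutOffProb_eq_mean]

theorem CanReturn.of_pure {a b : α} (h : (pure a : Rand α).CanReturn b) : b = a := by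
  obtain ⟨c, hc⟩ := h
  have := (PMF.mem_support_pure_iff _ _).1 hc
  simpa using congrArg Prod.fst this

theorem not_canReturn_cutOff {a : α} : ¬ (cutOff : Rand α).CanReturn a := by
  rintro ⟨c, hc⟩
  have := (PMF.mem_support_pure_iff _ _).1 hc
  simpa using congrArg Prod.fst this

theorem CanReturn.of_lift {c : Counted α} {b : α} (h : (lift c).CanReturn b) : b = c.val := by
  obtain ⟨n, hn⟩ := h
  have := (PMF.mem_support_pure_iff _ _).1 hn
  simpa using congrArg Prod.fst this

theorem CanReturn.of_sample {μ : PMF α} {b : α} (h : (sample μ).CanReturn b) : b ∈ μ.support := by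
  obtain ⟨n, hn⟩ := h
  obtain ⟨a, ha, he⟩ := (PMF.mem_support_map_iff _ _ _).1 hn
  have : a = b := by simpa using congrArg Prod.fst he
  exact this ▸ ha

theorem CanReturn.of_bind {x : Rand α} {f : α → Rand β} {b : β} (h : (x >>= f).CanReturn b) :
    ∃ a, x.CanReturn a ∧ (f a).CanReturn b := by
  obtain ⟨n, hn⟩ := h
  obtain ⟨⟨_ | a, k⟩, hr, he⟩ := (PMF.mem_support_bind_iff _ _ _).1 hn
  · have := (PMF.mem_support_pure_iff _ _).1 he
    simpa using congrArg Prod.fst this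
  · obtain ⟨⟨o, j⟩, hy, he'⟩ := (PMF.mem_support_map_iff _ _ _).1 he
    have : o = some b := by simpa using congrArg Prod.fst he'
    exact ⟨a, ⟨k, hr⟩, j, this ▸ hy⟩

end Rand

/-! ### Arithmetic that models a finite field -/

/-- The representatives satisfying `V` model a subfield with `q` elements of the field `Ω`. -/
structure Arith.ModelsField {R : Type} {Ω : Type*} [Field Ω] (A : Arith R) (V : R → Prop)
    (φ : R → Ω) (c q : ℕ) : Prop extends A.Models V φ c where
  inj : ∀ a b, V a → V b → φ a = φ b → a = b
  fix : ∀ a, V a → φ a ^ q = φ a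

section Frobenius

variable {Ω : Type*} [Field Ω] {p : ℕ} [Fact p.Prime] [CharP Ω p] {R : Type} {φ : R → Ω} {D : ℕ}

theorem hev_pow_card {l : List R} (hl : ∀ a ∈ l, φ a ^ p ^ D = φ a) (t : Ω) :
    hev φ t l ^ p ^ D = hev φ (t ^ p ^ D) l := by
  have := map_hev φ t (iterateFrobenius Ω p D) l
  simp only [iterateFrobenius_def] at this
  rw [this]
  exact hev_congr _ hl

theorem hev_iterate_eq_zero {l : List R} (hl : ∀ a ∈ l, φ a ^ p ^ D = φ a) {t : Ω}
    (ht : hev φ t l = 0) (j : ℕ) : hev φ ((fun x => x ^ p ^ D)^[j] t) l = 0 := by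
  induction j with
  | zero => exact ht
  | succ j ih =>
    rw [Function.iterate_succ_apply', ← hev_pow_card hl, ih]
    exact zero_pow (pow_ne_zero _ (Fact.out : p.Prime).ne_zero)

open Classical in
/-- The first `e` conjugates of `ξ` under the `q`-th power map. -/
noncomputable def orbit (q e : ℕ) (ξ : Ω) : Finset Ω :=
  (Finset.range e).image fun j => (fun x => x ^ q)^[j] ξ

theorem mem_orbit {q e : ℕ} {ξ x : Ω} :
    x ∈ orbit q e ξ ↔ ∃ j < e, (fun x => x ^ q)^[j] ξ = x := by
  simp [orbit]

theorem card_orbit {q e : ℕ} {ξ : Ω} (h : Function.minimalPeriod (fun x : Ω => x ^ q) ξ = e) :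
    (orbit q e ξ).card = e := by
  classical
  rw [orbit, Finset.card_image_of_injOn, Finset.card_range]
  subst h
  have := Function.iterate_injOn_Iio_minimalPeriod (f := fun x : Ω => x ^ q) (x := ξ)
  simpa using this

/-- The coefficients are fixed by the `p ^ D`-th power map, so a root brings along its `e` distinct
conjugates, too many for the degree. This plays the part of minimal polynomials. -/
theorem lp_eq_zero_of_root {e : ℕ} {ξ : Ω} {l : List R} (hl : ∀ a ∈ l, φ a ^ p ^ D = φ a)
    (hξ : Function.minimalPeriod (fun x : Ω => x ^ p ^ D) ξ = e) (hlen : l.length ≤ e)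
    (h0 : hev φ ξ l = 0) : lp φ l = 0 := by
  refine Polynomial.eq_zero_of_degree_lt_of_eval_finset_eq_zero (orbit (p ^ D) e ξ) ?_ ?_
  · rw [card_orbit hξ]
    exact (degree_lp_lt φ l).trans_le (by exact_mod_cast hlen)
  · intro x hx
    obtain ⟨j, -, rfl⟩ := mem_orbit.1 hx
    rw [eval_lp]
    exact hev_iterate_eq_zero hl h0 j

theorem pow_card_injective (D : ℕ) : Function.Injective fun x : Ω => x ^ p ^ D := by
  have := (iterateFrobenius Ω p D).injective
  intro a b hab
  exact this (by simpa [iterateFrobenius_def] using hab)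

theorem disjoint_orbit {e : ℕ} {ξ₁ ξ₂ : Ω}
    (h₁ : Function.minimalPeriod (fun x : Ω => x ^ p ^ D) ξ₁ = e)
    (h₂ : ξ₂ ∉ orbit (p ^ D) e ξ₁) (e' : ℕ) :
    Disjoint (orbit (p ^ D) e ξ₁) (orbit (p ^ D) e' ξ₂) := by
  rw [Finset.disjoint_left]
  intro x hx hx'
  apply h₂
  obtain ⟨i, hi, rfl⟩ := mem_orbit.1 hx
  obtain ⟨j, hj, hij⟩ := mem_orbit.1 hx'
  have he : 0 < e := (Nat.zero_le i).trans_lt hi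
  have hper : ∀ n, (fun x : Ω => x ^ p ^ D)^[n % e] ξ₁ = (fun x : Ω => x ^ p ^ D)^[n] ξ₁ := by
    intro n
    have := Function.iterate_mod_minimalPeriod_eq (f := fun x : Ω => x ^ p ^ D) (x := ξ₁) (n := n)
    rwa [h₁] at this
  -- To undo `j` iterations without subtraction, the multiple `j * e` of the period is added first;
  -- injectivity of the power map then cancels them.
  have key : (fun x : Ω => x ^ p ^ D)^[j] ξ₂ =
      (fun x : Ω => x ^ p ^ D)^[j] ((fun x : Ω => x ^ p ^ D)^[i + (j * e - j)] ξ₁) := by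
    have : j ≤ j * e := Nat.le_mul_of_pos_right j he
    rw [hij, ← Function.iterate_add_apply, show j + (i + (j * e - j)) = i + j * e by omega,
      ← hper (i + j * e), Nat.add_mul_mod_self_right, hper]
  have := (pow_card_injective (p := p) D).iterate j key
  rw [this, ← hper]
  exact mem_orbit.2 ⟨_, Nat.mod_lt _ he, rfl⟩

/-- Two disjoint orbits give `e + e` roots: this is the injectivity in the Chinese remainder theorem
for two distinct irreducible factors of degree `e`. -/
theorem lp_eq_zero_of_two_roots {e : ℕ} {ξ₁ ξ₂ : Ω} {l : List R}
    (hl : ∀ a ∈ l, φ a ^ p ^ D = φ a)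
    (h₁ : Function.minimalPeriod (fun x : Ω => x ^ p ^ D) ξ₁ = e)
    (h₂ : Function.minimalPeriod (fun x : Ω => x ^ p ^ D) ξ₂ = e)
    (h₁₂ : ξ₂ ∉ orbit (p ^ D) e ξ₁) (hlen : l.length ≤ e + e)
    (hl₁ : hev φ ξ₁ l = 0) (hl₂ : hev φ ξ₂ l = 0) : lp φ l = 0 := by
  classical
  refine Polynomial.eq_zero_of_degree_lt_of_eval_finset_eq_zero
    (orbit (p ^ D) e ξ₁ ∪ orbit (p ^ D) e ξ₂) ?_ ?_
  · rw [Finset.card_union_of_disjoint (disjoint_orbit h₁ h₁₂ e), card_orbit h₁, card_orbit h₂]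
    exact (degree_lp_lt φ l).trans_le (by exact_mod_cast hlen)
  · intro x hx
    rw [eval_lp]
    rcases Finset.mem_union.1 hx with hx | hx
    · obtain ⟨j, -, rfl⟩ := mem_orbit.1 hx
      exact hev_iterate_eq_zero hl hl₁ j
    · obtain ⟨j, -, rfl⟩ := mem_orbit.1 hx
      exact hev_iterate_eq_zero hl hl₂ j

theorem iterate_pow_eq {M : Type*} [Monoid M] (q j : ℕ) (x : M) :
    (fun x : M => x ^ q)^[j] x = x ^ q ^ j := by
  induction j with
  | zero => simp
  | succ j ih => rw [Function.iterate_succ_apply', ih, ← pow_mul, pow_succ]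

theorem Arith.modelsField_base [Algebra (ZMod p) Ω] :
    (Arith.base (ZMod p)).ModelsField (fun _ => True) (algebraMap (ZMod p) Ω) 1 p :=
  { Arith.models_base (algebraMap (ZMod p) Ω) with
    inj := fun _ _ _ _ h => (algebraMap (ZMod p) Ω).injective h
    fix := fun a _ => by rw [← map_pow, ZMod.pow_card] }

/-- The condition on the minimal period says that `t` has degree `f.length` over the subfield, i.e.
that `f` is its minimal polynomial. It makes evaluation at `t` injective on representatives, by
`lp_eq_zero_of_root` applied to differences. -/
theorem Arith.ModelsField.quot {A : Arith R} {V : R → Prop} {c : ℕ}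
    (h : A.ModelsField V φ c (p ^ D)) {f : List R} (hf : ∀ y ∈ f, V y) (hd : 0 < f.length) {t : Ω}
    (ht : t ^ f.length + hev φ t f = 0)
    (hper : Function.minimalPeriod (fun x : Ω => x ^ p ^ D) t = f.length) :
    (A.quot f).ModelsField (fun l => l.length = f.length ∧ ∀ y ∈ l, V y) (hev φ t)
      (4 * c * f.length ^ 2) (p ^ (D * f.length)) :=
  { h.toModels.quot hf hd ht with
    inj := by
      rintro a b ⟨ha, ha'⟩ ⟨hb, hb'⟩ hab
      have hq := h.toModels.quot hf hd ht
      have hv := hq.sub_valid (a := a) (b := b) ⟨ha, ha'⟩ ⟨hb, hb'⟩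
      have h0 : hev φ t ((A.quot f).sub a b).val = 0 := by
        rw [hq.map_sub ⟨ha, ha'⟩ ⟨hb, hb'⟩, hab, sub_self]
      have h1 := lp_eq_zero_of_root (fun x hx => h.fix x (hv.2 x hx)) hper hv.1.le h0
      refine lp_injOn φ h.inj ha' hb' (ha.trans hb.symm) ?_
      have e : lp φ ((A.quot f).sub a b).val = lp φ a - lp φ b := by
        simp only [Arith.quot, zipLists_val, lp]
        rw [hev_zipWith _ _ (-1) (ha.trans hb.symm)]
        · ring
        intro x hx y hy
        rw [h.map_sub (ha' x hx) (hb' y hy), C_sub]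
        ring
      rw [h1] at e
      exact (sub_eq_zero.1 e.symm)
    fix := by
      rintro a ⟨-, ha⟩
      have hfix : ∀ x ∈ a, φ x ^ p ^ (D * f.length) = φ x := by
        intro x hx
        rw [pow_mul, ← iterate_pow_eq]
        exact (Function.IsFixedPt.iterate (h.fix x (ha x hx)) _)
      rw [hev_pow_card hfix, pow_mul, ← iterate_pow_eq, ← hper]
      congr 1
      exact Function.isPeriodicPt_minimalPeriod (fun x : Ω => x ^ p ^ D) t }

end Frobenius

/-! ### One round of the Cantor–Zassenhaus algorithm -/

theorem length_le_of_mp_dvd {R Ω : Type*} [Field Ω] {φ : R → Ω} {u f : List R}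
    (h : mp φ u ∣ mp φ f) : u.length ≤ f.length := by
  have := natDegree_le_of_dvd h (mp_monic φ f).ne_zero
  rwa [natDegree_mp, natDegree_mp] at this

theorem mp_eq_of_dvd_of_length_le {R Ω : Type*} [Field Ω] {φ : R → Ω} {u f : List R}
    (h : mp φ u ∣ mp φ f) (hlen : f.length ≤ u.length) : mp φ u = mp φ f := by
  refine eq_of_monic_of_associated (mp_monic φ u) (mp_monic φ f) ?_
  refine associated_of_dvd_of_natDegree_le h (mp_monic φ f).ne_zero ?_
  rwa [natDegree_mp, natDegree_mp]

section Round

variable {p : ℕ} [Fact p.Prime] {Ω : Type*} [Field Ω] {fY : List (ZMod p)}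
  {V : List (ZMod p) → Prop} {φ : List (ZMod p) → Ω} {c : ℕ}

theorem splitOff_eq_none {f u : List (List (ZMod p))} (h : ¬ (0 < u.length ∧ u.length < f.length)) :
    splitOff p fY f u = pure none := by
  rw [splitOff, if_neg h]

/-- The remainder vanishes since `mp φ u` divides it and has larger degree. The quotient begins with
the leading 1 of `f`, so its remaining entries are the tail of the complementary divisor. -/
theorem splitOff_spec (h : (ext p fY).Models V φ c) {f u : List (List (ZMod p))}
    (hf : ∀ y ∈ f, V y) (hu : ∀ y ∈ u, V y) (hdvd : mp φ u ∣ mp φ f)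
    (hlen : 0 < u.length ∧ u.length < f.length) :
    ∃ f', (splitOff p fY f u).val = some f' ∧ (∀ y ∈ f', V y) ∧
      (0 < f'.length ∧ f'.length < f.length) ∧ mp φ f' ∣ mp φ f := by
  have hf1 : ∀ y ∈ (ext p fY).one :: f, V y := by
    intro y hy
    rcases List.mem_cons.1 hy with rfl | hy
    · exact h.one_valid
    · exact hf y hy
  obtain ⟨⟨hq, hql⟩, ⟨hr, hrl⟩, -, -, hhead⟩ := h.divMod_spec hu 0 hf1
  have hdiv := h.lp_divMod hu hf1
  rw [h.lp_one_cons] at hdiv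
  have hr0 : lp φ ((ext p fY).divMod ((ext p fY).one :: f) u).val.2 = 0 := by
    have h1 : mp φ u ∣ lp φ ((ext p fY).divMod ((ext p fY).one :: f) u).val.2 := by
      rw [hdiv] at hdvd
      exact (dvd_add_right (dvd_mul_left _ _)).1 hdvd
    refine eq_zero_of_dvd_of_degree_lt h1 ((degree_lp_lt φ _).trans_le ?_)
    rw [degree_eq_natDegree (mp_monic φ u).ne_zero, natDegree_mp]
    exact_mod_cast hrl
  rw [hr0, add_zero] at hdiv
  have hhead' := hhead (by rw [List.length_cons]; omega)
  rcases hcase : ((ext p fY).divMod ((ext p fY).one :: f) u).val.1 with _ | ⟨x, l⟩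
  · rw [hcase] at hhead'
    simp at hhead'
  · rw [hcase] at hhead' hq hql hdiv
    simp only [List.head?_cons, Option.some.injEq] at hhead'
    subst hhead'
    simp only [List.length_cons] at hql
    rw [h.lp_one_cons] at hdiv
    rw [splitOff, if_pos hlen]
    simp only [Counted.val_bind, Counted.val_pure, hcase, List.tail_cons, Option.some.injEq,
      exists_eq_left']
    split_ifs
    · exact ⟨hu, hlen, hdvd⟩
    · exact ⟨fun y hy => hq y (by simp [hy]), by omega, Dvd.intro _ hdiv.symm⟩

theorem splitOff_ops (h : (ext p fY).Models V φ c) {f u : List (List (ZMod p))}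
    (hf : ∀ y ∈ f, V y) (hu : ∀ y ∈ u, V y) :
    (splitOff p fY f u).ops ≤ (f.length + 1) * (f.length * (2 * c)) := by
  by_cases hlen : 0 < u.length ∧ u.length < f.length
  · have hf1 : ∀ y ∈ (ext p fY).one :: f, V y := by
      intro y hy
      rcases List.mem_cons.1 hy with rfl | hy
      · exact h.one_valid
      · exact hf y hy
    obtain ⟨-, -, -, hops, -⟩ := h.divMod_spec hu 0 hf1
    rw [splitOff, if_pos hlen]
    simp only [Counted.ops_bind, Counted.ops_pure, add_zero]
    exact hops.trans (Nat.mul_le_mul (by simp) (Nat.mul_le_mul_right _ hlen.2.le))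
  · rw [splitOff_eq_none hlen]
    exact Nat.zero_le _

/-- For the last clause: if the first gcd has not split `f`, then `X - C ξ₁` divides the gcd of `f`
with `g ^ M - 1` while `X - C ξ₂` does not. That gcd is therefore neither 1 nor `f`. -/
theorem czRound_spec [IsAlgClosed Ω] (h : (ext p fY).ModelsField V φ c (p ^ fY.length))
    (hD : 0 < fY.length) {e w : ℕ} {f g : List (List (ZMod p))} (hf : ∀ y ∈ f, V y)
    (hg : ∀ y ∈ g, V y) (hgf : g.length = f.length) (hpos : 0 < f.length) (hw : f.length + 1 ≤ w)
    (hwq : (p ^ fY.length - 2).size ≤ w)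
    (hwM : (((p ^ fY.length) ^ e - 1) / (if p = 2 then 3 else 2)).size ≤ w) :
    ((∀ y ∈ (czRound p fY e f g).val, V y) ∧ mp φ (czRound p fY e f g).val ∣ mp φ f ∧
      0 < (czRound p fY e f g).val.length) ∧
    (czRound p fY e f g).ops ≤ 26 * (c * w ^ 3) ∧
    ∀ ξ₁ ξ₂, (mp φ f).eval ξ₁ = 0 → (mp φ f).eval ξ₂ = 0 →
      hev φ ξ₁ g ^ (((p ^ fY.length) ^ e - 1) / (if p = 2 then 3 else 2)) = 1 →
      hev φ ξ₂ g ^ (((p ^ fY.length) ^ e - 1) / (if p = 2 then 3 else 2)) ≠ 1 →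
      (czRound p fY e f g).val.length < f.length := by
  set M := ((p ^ fY.length) ^ e - 1) / (if p = 2 then 3 else 2) with hM
  have hq2 : 2 ≤ p ^ fY.length :=
    (Fact.out : p.Prime).two_le.trans (Nat.le_self_pow hD.ne' p)
  obtain ⟨u1, u2, u3⟩ := h.toModels.gcd_spec hq2 h.fix h.inj hf hg (by omega)
  have udvd : mp φ ((ext p fY).gcd (p ^ fY.length) f g).val ∣ mp φ f := ((u2 _).1 dvd_rfl).1
  -- Although `f` may be reducible, evaluation at each of its roots is a model of the residue class
  -- ring; together they show which roots `g ^ M - 1` has in common with `f`.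
  have hquot : ∀ ξ, (mp φ f).eval ξ = 0 → ((ext p fY).quot f).Models
      (fun l => l.length = f.length ∧ ∀ y ∈ l, V y) (hev φ ξ) (4 * c * f.length ^ 2) := by
    intro ξ hξ
    rw [eval_mp] at hξ
    exact h.toModels.quot hf hpos hξ
  -- Validity and cost of the computed power do not depend on the root, so an arbitrary one is used
  -- for them.
  obtain ⟨ξ, hξ⟩ := IsAlgClosed.exists_root (mp φ f) (by
    rw [degree_eq_natDegree (mp_monic φ f).ne_zero, natDegree_mp]
    exact_mod_cast hpos.ne')
  have hgv : g.length = f.length ∧ ∀ y ∈ g, V y := ⟨hgf, hg⟩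
  have hp := (hquot ξ hξ).pow_valid hgv M
  have hpo := (hquot ξ hξ).pow_ops hgv M
  have hs := (hquot ξ hξ).sub_valid hp (hquot ξ hξ).one_valid
  have hso := (hquot ξ hξ).sub_ops hp (hquot ξ hξ).one_valid
  set h1 := (((ext p fY).quot f).sub (((ext p fY).quot f).pow g M).val
    ((ext p fY).quot f).one) with hh1
  obtain ⟨w1, w2, w3⟩ := h.toModels.gcd_spec hq2 h.fix h.inj hf hs.2 (by omega)
  have wdvd : mp φ ((ext p fY).gcd (p ^ fY.length) f h1.val).val ∣ mp φ f := ((w2 _).1 dvd_rfl).1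
  have su := splitOff_ops h.toModels hf u1
  have sw := splitOff_ops h.toModels hf w1
  have hT : (((f.length + 1) * ((f.length + 1) * (f.length * (2 * c)) +
        2 * (p ^ fY.length - 2).size * c + f.length * c)) +
      ((f.length + 1) * (f.length * (2 * c)))) +
      (2 * M.size * (4 * c * f.length ^ 2) + (4 * c * f.length ^ 2 +
      (((f.length + 1) * ((f.length + 1) * (f.length * (2 * c)) +
        2 * (p ^ fY.length - 2).size * c + f.length * c)) +
      ((f.length + 1) * (f.length * (2 * c)))))) ≤ 26 * (c * w ^ 3) := by
    have hf' : f.length ≤ w := by omega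
    have hw1 : 1 ≤ w := by omega
    calc _ ≤ ((w * (w * (w * (2 * c)) + 2 * w * c + w * c)) + (w * (w * (2 * c)))) +
          (2 * w * (4 * c * w ^ 2) + (4 * c * w ^ 2 +
            ((w * (w * (w * (2 * c)) + 2 * w * c + w * c)) + (w * (w * (2 * c)))))) := by
          gcongr
      _ = 12 * (c * w ^ 3) + 14 * (c * (w ^ 2 * 1)) := by ring
      _ ≤ 12 * (c * w ^ 3) + 14 * (c * (w ^ 2 * w)) := by gcongr
      _ = _ := by ring
  by_cases hu : 0 < ((ext p fY).gcd (p ^ fY.length) f g).val.length ∧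
      ((ext p fY).gcd (p ^ fY.length) f g).val.length < f.length
  · obtain ⟨f', e1, e2, e3, e4⟩ := splitOff_spec h.toModels hf u1 udvd hu
    have hval : (czRound p fY e f g).val = f' := by
      simp only [czRound, Counted.val_bind, e1, Counted.val_pure]
    have hops : (czRound p fY e f g).ops = ((ext p fY).gcd (p ^ fY.length) f g).ops +
        (splitOff p fY f ((ext p fY).gcd (p ^ fY.length) f g).val).ops := by
      simp only [czRound, Counted.ops_bind, e1, Counted.ops_pure, add_zero]
    rw [hval, hops]
    exact ⟨⟨e2, e4, e3.1⟩, by omega, fun _ _ _ _ _ _ => e3.2⟩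
  · have hnone := splitOff_eq_none (fY := fY) hu
    by_cases hw' : 0 < ((ext p fY).gcd (p ^ fY.length) f h1.val).val.length ∧
        ((ext p fY).gcd (p ^ fY.length) f h1.val).val.length < f.length
    · obtain ⟨f', e1, e2, e3, e4⟩ := splitOff_spec h.toModels hf w1 wdvd hw'
      have hval : (czRound p fY e f g).val = f' := by
        simp only [czRound, Counted.val_bind, hnone, Counted.val_pure]
        simp only [← hM, ← hh1, e1, Counted.val_pure]
      have hops : (czRound p fY e f g).ops = ((ext p fY).gcd (p ^ fY.length) f g).ops +
          ((((ext p fY).quot f).pow g M).ops + (h1.ops +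
          (((ext p fY).gcd (p ^ fY.length) f h1.val).ops +
          (splitOff p fY f ((ext p fY).gcd (p ^ fY.length) f h1.val).val).ops))) := by
        simp only [czRound, Counted.ops_bind, hnone, Counted.val_pure, Counted.ops_pure, zero_add]
        simp only [← hM, ← hh1, e1, Counted.ops_pure, add_zero]
      rw [hval, hops]
      exact ⟨⟨e2, e4, e3.1⟩, by omega, fun _ _ _ _ _ _ => e3.2⟩
    · have hnone' := splitOff_eq_none (fY := fY) hw'
      have hval : (czRound p fY e f g).val = f := by
        simp only [czRound, Counted.val_bind, hnone, Counted.val_pure]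
        simp only [← hM, ← hh1, hnone', Counted.val_pure]
      have hops : (czRound p fY e f g).ops = ((ext p fY).gcd (p ^ fY.length) f g).ops +
          ((((ext p fY).quot f).pow g M).ops + (h1.ops +
          ((ext p fY).gcd (p ^ fY.length) f h1.val).ops)) := by
        simp only [czRound, Counted.ops_bind, hnone, Counted.val_pure, Counted.ops_pure, zero_add]
        simp only [← hM, ← hh1, hnone', Counted.val_pure, Counted.ops_pure, add_zero]
      rw [hval, hops]
      refine ⟨⟨hf, dvd_rfl, hpos⟩, by omega, fun ξ₁ ξ₂ r₁ r₂ g₁ g₂ => absurd ⟨?_, ?_⟩ hw'⟩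
      · have hd : X - C ξ₁ ∣ mp φ ((ext p fY).gcd (p ^ fY.length) f h1.val).val := by
          rw [w2, dvd_iff_isRoot, dvd_iff_isRoot]
          refine ⟨r₁, ?_⟩
          rw [IsRoot, eval_lp, hh1, (hquot ξ₁ r₁).map_sub hp (hquot ξ₁ r₁).one_valid,
            (hquot ξ₁ r₁).map_pow hgv, (hquot ξ₁ r₁).map_one, g₁, sub_self]
        refine Nat.pos_of_ne_zero fun h0 => ?_
        rw [List.length_eq_zero_iff.1 h0, mp_nil] at hd
        exact not_isUnit_X_sub_C ξ₁ (isUnit_of_dvd_one hd)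
      · by_contra hle
        have heq := mp_eq_of_dvd_of_length_le wdvd (not_lt.1 hle)
        have hd : X - C ξ₂ ∣ mp φ ((ext p fY).gcd (p ^ fY.length) f h1.val).val := by
          rw [heq, dvd_iff_isRoot]; exact r₂
        rw [w2, dvd_iff_isRoot, dvd_iff_isRoot, IsRoot.def, IsRoot.def, eval_lp, hh1,
          (hquot ξ₂ r₂).map_sub hp (hquot ξ₂ r₂).one_valid,
          (hquot ξ₂ r₂).map_pow hgv, (hquot ξ₂ r₂).map_one] at hd
        exact g₂ (sub_eq_zero.1 hd.2)

end Round

/-! ### The probability that a random polynomial splits -/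

theorem hev_ofFn_add {R T : Type*} [Add R] [CommRing T] {φ : R → T}
    (hφ : ∀ a b, φ (a + b) = φ a + φ b) (t : T) {m : ℕ} (g g' : Fin m → R) :
    hev φ t (List.ofFn (g + g')) = hev φ t (List.ofFn g) + hev φ t (List.ofFn g') := by
  induction m with
  | zero => simp
  | succ m ih =>
    have := ih (fun i => g i.succ) fun i => g' i.succ
    simp only [List.ofFn_succ, hev_cons, Pi.add_apply, hφ, List.length_ofFn] at this ⊢
    rw [show (fun i : Fin m => g i.succ + g' i.succ) =
      (fun i : Fin m => g i.succ) + fun i => g' i.succ from rfl, this]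
    ring

section Count

variable {p : ℕ} [Fact p.Prime] {Ω : Type*} [Field Ω] [Algebra (ZMod p) Ω]

/-- The list of coefficient lists of a polynomial over an extension of degree `D`. -/
def coeffLists {D m : ℕ} (g : Fin m → Fin D → ZMod p) : List (List (ZMod p)) :=
  List.ofFn fun i => List.ofFn (g i)

theorem coeffLists_eq_map {D m : ℕ} (g : Fin m → Fin D → ZMod p) :
    coeffLists g = (List.ofFn g).map List.ofFn := by
  rw [List.map_ofFn]
  rfl

theorem length_coeffLists {D m : ℕ} (g : Fin m → Fin D → ZMod p) : (coeffLists g).length = m := by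
  simp [coeffLists]

theorem length_of_mem_coeffLists {D m : ℕ} (g : Fin m → Fin D → ZMod p) :
    ∀ l ∈ coeffLists g, l.length = D := by
  intro l hl
  simp only [coeffLists, List.mem_ofFn'] at hl
  obtain ⟨i, rfl⟩ := hl
  simp

theorem coeffLists_injective {D m : ℕ} :
    Function.Injective (coeffLists : (Fin m → Fin D → ZMod p) → List (List (ZMod p))) := by
  intro g g' h
  have h1 := List.ofFn_injective h
  funext i
  exact List.ofFn_injective (congrFun h1 i)

/-- The values at `ξ₁` and `ξ₂` of a polynomial over the extension generated by `y`. -/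
noncomputable def evalPair (y ξ₁ ξ₂ : Ω) (D m : ℕ) : (Fin m → Fin D → ZMod p) →+ Ω × Ω :=
  AddMonoidHom.mk' (fun g => (hev (hev (algebraMap (ZMod p) Ω) y) ξ₁ (coeffLists g),
    hev (hev (algebraMap (ZMod p) Ω) y) ξ₂ (coeffLists g))) (by
    intro g g'
    have key : ∀ (ξ : Ω) (g : Fin m → Fin D → ZMod p),
        hev (hev (algebraMap (ZMod p) Ω) y) ξ (coeffLists g) =
        hev (fun v : Fin D → ZMod p => hev (algebraMap (ZMod p) Ω) y (List.ofFn v)) ξ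
          (List.ofFn g) := by
      intro ξ g
      rw [coeffLists_eq_map, hev_map]
    simp only [key]
    rw [hev_ofFn_add (fun a b => hev_ofFn_add (map_add _) y a b),
      hev_ofFn_add (fun a b => hev_ofFn_add (map_add _) y a b), Prod.mk_add_mk])

/-- All fibres of a homomorphism over its image have the same size, so a uniform element of `G` has
a uniform image. -/
theorem mul_card_preimage_eq {G H : Type*} [AddGroup G] [Fintype G] [AddGroup H] [DecidableEq H]
    (f : G →+ H) (B S : Finset H) (hB : B ⊆ S) (hS : ∀ x, x ∈ S ↔ x ∈ Set.range f) :
    S.card * (Finset.univ.filter fun g => f g ∈ B).card = B.card * Fintype.card G := by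
  have hfib : ∀ x ∈ S, (Finset.univ.filter fun g => f g = x).card =
      (Finset.univ.filter fun g => f g = 0).card := by
    intro x hx
    exact AddMonoidHom.card_fiber_eq_of_mem_range f ((hS x).1 hx) ⟨0, map_zero f⟩
  have hall : Fintype.card G = S.card * (Finset.univ.filter fun g => f g = 0).card := by
    rw [← Finset.card_univ, Finset.card_eq_sum_card_fiberwise (f := f) (t := S)
      (fun g _ => (hS _).2 ⟨g, rfl⟩), Finset.sum_congr rfl hfib, Finset.sum_const, smul_eq_mul]
  have hpart : (Finset.univ.filter fun g => f g ∈ B).card =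
      B.card * (Finset.univ.filter fun g => f g = 0).card := by
    rw [Finset.card_eq_sum_card_fiberwise (f := f) (t := B)
      (fun g hg => by simpa using hg)]
    rw [← smul_eq_mul, ← Finset.sum_const]
    refine Finset.sum_congr rfl fun x hx => ?_
    rw [← hfib x (hB hx), Finset.filter_filter]
    congr 1
    ext g
    simp only [Finset.mem_filter, Finset.mem_univ, true_and]
    exact ⟨fun h => h.2, fun h => ⟨h ▸ hx, h⟩⟩
  rw [hall, hpart]
  ring

variable [CharP Ω p] [IsAlgClosed Ω]

open Classical in
-- The pair of values at `ξ₁` and `ξ₂` is uniform on `K ×ˢ K`, where `K` has `Q = (p ^ D) ^ e`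
-- elements. The desired event is `U ×ˢ (K \ U)` with `U` the `M`-th roots of unity, so its
-- probability is `M * (Q - M) / Q ^ 2`, at least 1/4 times 1/2.
theorem card_le_eight_mul_card_split {y ξ₁ ξ₂ : Ω} {D e m M : ℕ}
    (hinj : ∀ a b : List (ZMod p), a.length = D → b.length = D →
      hev (algebraMap (ZMod p) Ω) y a = hev (algebraMap (ZMod p) Ω) y b → a = b)
    (hfix : ∀ a : List (ZMod p), a.length = D →
      hev (algebraMap (ZMod p) Ω) y a ^ p ^ D = hev (algebraMap (ZMod p) Ω) y a)
    (h₁ : Function.minimalPeriod (fun x : Ω => x ^ p ^ D) ξ₁ = e)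
    (h₂ : Function.minimalPeriod (fun x : Ω => x ^ p ^ D) ξ₂ = e)
    (h₁₂ : ξ₂ ∉ orbit (p ^ D) e ξ₁) (hm : e + e ≤ m) (hD : 0 < D) (he : 0 < e)
    (hMdvd : M ∣ (p ^ D) ^ e - 1) (hM4 : (p ^ D) ^ e ≤ 4 * M) (hM2 : 2 * M ≤ (p ^ D) ^ e) :
    Fintype.card (Fin m → Fin D → ZMod p) ≤
      8 * (Finset.univ.filter fun g : Fin m → Fin D → ZMod p =>
        hev (hev (algebraMap (ZMod p) Ω) y) ξ₁ (coeffLists g) ^ M = 1 ∧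
        hev (hev (algebraMap (ZMod p) Ω) y) ξ₂ (coeffLists g) ^ M ≠ 1).card := by
  obtain ⟨k, rfl⟩ := Nat.exists_eq_add_of_le hm
  rw [add_comm (e + e) k]
  have hp : p.Prime := Fact.out
  set Q := (p ^ D) ^ e with hQ
  have hQp : Q = p ^ (D * e) := by rw [hQ, ← pow_mul]
  have hDe : D * e ≠ 0 := (Nat.mul_pos hD he).ne'
  have hQ2 : 1 < Q := by rw [hQp]; exact Nat.one_lt_pow hDe hp.one_lt
  have hMpos : 0 < M := by omega
  -- the subfield with `Q` elements
  set K : Finset Ω := (X ^ Q - X : Polynomial Ω).roots.toFinset with hK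
  have hKmem : ∀ x, x ∈ K ↔ x ^ Q = x := by
    intro x
    rw [hK, Multiset.mem_toFinset, mem_roots (FiniteField.X_pow_card_sub_X_ne_zero Ω hQ2)]
    simp [sub_eq_zero]
  have hKcard : K.card ≤ Q := by
    refine (Multiset.toFinset_card_le _).trans ((card_roots' _).trans ?_)
    rw [FiniteField.X_pow_card_sub_X_natDegree_eq Ω hQ2]
  set φ := hev (algebraMap (ZMod p) Ω) y with hφ
  have hval : ∀ {ξ : Ω} {m : ℕ} (g : Fin m → Fin D → ZMod p),
      Function.minimalPeriod (fun x : Ω => x ^ p ^ D) ξ = e → hev φ ξ (coeffLists g) ∈ K := by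
    intro ξ m g hξ
    rw [hKmem, hQp, hev_pow_card (p := p) (D := D * e), pow_mul, ← iterate_pow_eq]
    · have := Function.isPeriodicPt_minimalPeriod (fun x : Ω => x ^ p ^ D) ξ
      rw [hξ] at this
      rw [this]
    · intro a ha
      rw [pow_mul, ← iterate_pow_eq]
      exact Function.IsFixedPt.iterate (hfix a (length_of_mem_coeffLists g a ha)) _
  set f := evalPair (p := p) y ξ₁ ξ₂ D (k + (e + e)) with hf
  set f' := evalPair (p := p) y ξ₁ ξ₂ D (e + e) with hf'
  have hfapp : ∀ g, f g = (hev φ ξ₁ (coeffLists g), hev φ ξ₂ (coeffLists g)) := fun g => rfl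
  have hfapp' : ∀ g, f' g = (hev φ ξ₁ (coeffLists g), hev φ ξ₂ (coeffLists g)) := fun g => rfl
  -- `f'` is the evaluation restricted to polynomials of degree below `e + e`, where two roots with
  -- disjoint orbits already determine the polynomial.
  have hinj' : Function.Injective f' := by
    rw [injective_iff_map_eq_zero]
    intro g hg
    rw [hfapp', Prod.mk_eq_zero] at hg
    have h0 := lp_eq_zero_of_two_roots (p := p) (D := D) (l := coeffLists g) (φ := φ)
      (fun a ha => hfix a (length_of_mem_coeffLists g a ha)) h₁ h₂ h₁₂
      (length_coeffLists g).le hg.1 hg.2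
    apply coeffLists_injective
    refine lp_injOn φ hinj (length_of_mem_coeffLists g) (length_of_mem_coeffLists 0)
      (by simp [length_coeffLists]) ?_
    rw [h0]
    refine (hev_eq_zero _ _ fun a ha => ?_).symm
    rw [C_eq_zero]
    refine hev_eq_zero _ _ fun b hb => ?_
    simp only [coeffLists, List.mem_ofFn'] at ha
    obtain ⟨i, rfl⟩ := ha
    simp only [List.mem_ofFn'] at hb
    obtain ⟨j, rfl⟩ := hb
    simp
  have hsub : Finset.univ.image f' ⊆ K ×ˢ K := by
    intro x hx
    obtain ⟨g, -, rfl⟩ := Finset.mem_image.1 hx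
    rw [hfapp', Finset.mem_product]
    exact ⟨hval g h₁, hval g h₂⟩
  have hcard : (Finset.univ.image f').card = Q * Q := by
    rw [Finset.card_image_of_injective _ hinj', Finset.card_univ]
    simp only [Fintype.card_fun, Fintype.card_fin, ZMod.card]
    rw [pow_add, hQ]
  have hKK : (K ×ˢ K).card ≤ Q * Q := by
    rw [Finset.card_product]; exact Nat.mul_le_mul hKcard hKcard
  -- The image has `Q * Q` elements and `K` has at most `Q`, so counting gives surjectivity and, at
  -- the same time, `K.card = Q`.
  have himage : Finset.univ.image f' = K ×ˢ K :=
    Finset.eq_of_subset_of_card_le hsub (hKK.trans hcard.ge)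
  have hKQ : K.card = Q := by
    rw [himage, Finset.card_product] at hcard
    exact Nat.mul_self_inj.1 hcard
  have hrange : ∀ x, x ∈ K ×ˢ K ↔ x ∈ Set.range f := by
    intro x
    constructor
    · intro hx
      rw [← himage] at hx
      obtain ⟨g, -, rfl⟩ := Finset.mem_image.1 hx
      -- Coefficients are listed from the highest degree down, so the zeros come first and the
      -- polynomial keeps its values.
      refine ⟨Fin.append 0 g, ?_⟩
      have hc : coeffLists (Fin.append (0 : Fin k → Fin D → ZMod p) g) =
          coeffLists (0 : Fin k → Fin D → ZMod p) ++ coeffLists g := by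
        rw [coeffLists_eq_map, coeffLists_eq_map, coeffLists_eq_map, List.ofFn_fin_append, List.map_append]
      have hz : ∀ ξ : Ω, hev φ ξ (coeffLists (0 : Fin k → Fin D → ZMod p)) = 0 := by
        intro ξ
        refine hev_eq_zero _ _ fun a ha => hev_eq_zero _ _ fun b hb => ?_
        simp only [coeffLists, List.mem_ofFn'] at ha
        obtain ⟨i, rfl⟩ := ha
        simp only [List.mem_ofFn'] at hb
        obtain ⟨j, rfl⟩ := hb
        simp
      rw [hfapp, hfapp', hc, hev_append, hev_append, hz, hz]
      simp
    · rintro ⟨g, rfl⟩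
      rw [hfapp, Finset.mem_product]
      exact ⟨hval g h₁, hval g h₂⟩
  -- the `M`-th roots of unity
  have hMΩ : (M : Ω) ≠ 0 := by
    intro h0
    have hpM : p ∣ M := (CharP.cast_eq_zero_iff Ω p M).1 h0
    have h1 : p ∣ Q - 1 := hpM.trans hMdvd
    have h2 : p ∣ Q := by rw [hQp]; exact dvd_pow_self p hDe
    have h3 : p ∣ 1 := by
      have := Nat.dvd_sub h2 h1
      rwa [Nat.sub_sub_self hQ2.le] at this
    exact hp.one_lt.ne' (Nat.dvd_one.1 h3)
  have : NeZero (M : Ω) := ⟨hMΩ⟩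
  have : NeZero M := ⟨hMpos.ne'⟩
  obtain ⟨ζ, hζ⟩ := HasEnoughRootsOfUnity.exists_primitiveRoot Ω M
  set U : Finset Ω := nthRootsFinset M (1 : Ω) with hU
  have hUcard : U.card = M := hζ.card_nthRootsFinset
  have hUmem : ∀ x, x ∈ U ↔ x ^ M = 1 := fun x => by rw [hU, mem_nthRootsFinset hMpos]
  have hUK : U ⊆ K := by
    intro x hx
    rw [hUmem] at hx
    rw [hKmem]
    obtain ⟨j, hj⟩ := hMdvd
    have h1 : x ^ (Q - 1) = 1 := by rw [hj, pow_mul, hx, one_pow]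
    calc x ^ Q = x ^ (Q - 1 + 1) := by rw [Nat.sub_add_cancel hQ2.le]
      _ = x := by rw [pow_succ, h1, one_mul]
  have hcount := mul_card_preimage_eq f (U ×ˢ (K \ U)) (K ×ˢ K)
    (Finset.product_subset_product hUK Finset.sdiff_subset) hrange
  rw [Finset.card_product, Finset.card_product, Finset.card_sdiff_of_subset hUK, hKQ, hUcard]
    at hcount
  have hsubset : (Finset.univ.filter fun g => f g ∈ U ×ˢ (K \ U)) ⊆
      Finset.univ.filter fun g : Fin (k + (e + e)) → Fin D → ZMod p =>
        hev φ ξ₁ (coeffLists g) ^ M = 1 ∧ hev φ ξ₂ (coeffLists g) ^ M ≠ 1 := by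
    intro g hg
    simp only [Finset.mem_filter, Finset.mem_univ, true_and, hfapp, Finset.mem_product,
      Finset.mem_sdiff, hUmem] at hg ⊢
    exact ⟨hg.1, hg.2.2⟩
  refine le_trans ?_ (Nat.mul_le_mul_left 8 (Finset.card_le_card hsubset))
  -- This combines `Q ≤ 4 * M` with `Q ≤ 2 * (Q - M)`, the latter from `2 * M ≤ Q`.
  have h8 : Q * Q ≤ 8 * (M * (Q - M)) := by
    obtain ⟨j, hj⟩ := Nat.exists_eq_add_of_le hM2
    have : Q - M = M + j := by omega
    rw [this]
    have : Q ≤ 2 * (M + j) := by omega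
    calc Q * Q ≤ (4 * M) * (2 * (M + j)) := Nat.mul_le_mul hM4 this
      _ = _ := by ring
  have hQQ : 0 < Q * Q := by positivity
  refine Nat.le_of_mul_le_mul_left ?_ hQQ
  calc Q * Q * Fintype.card (Fin (k + (e + e)) → Fin D → ZMod p)
      ≤ 8 * (M * (Q - M)) * Fintype.card (Fin (k + (e + e)) → Fin D → ZMod p) :=
        Nat.mul_le_mul_right _ h8
    _ = 8 * (Q * Q * _) := by rw [hcount]; ring
    _ = _ := by ring

end Count

/-! ### Averages over a finite set -/

/-- At least one eighth of the points have the better bound `b`. The factor 8 stays on the left to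
avoid division in `ℝ≥0∞`. -/
theorem eight_mul_average_le {G : Type*} [Fintype G] [Nonempty G] (S : Finset G)
    (hS : Fintype.card G ≤ 8 * S.card) {F : G → ℝ≥0∞} {a b : ℝ≥0∞} (hba : b ≤ a)
    (ha : ∀ g, F g ≤ a) (hb : ∀ g ∈ S, F g ≤ b) :
    8 * ∑' g, PMF.uniformOfFintype G g * F g ≤ 7 * a + b := by
  classical
  have hn0 : (Fintype.card G : ℝ≥0∞) ≠ 0 := by simp
  have hnt : (Fintype.card G : ℝ≥0∞) ≠ ⊤ := ENNReal.natCast_ne_top _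
  -- `j` is the surplus of `8 * S.card` over `Fintype.card G`; this part is estimated by `a` instead
  -- of `b`, which is where `b ≤ a` is used.
  obtain ⟨j, hj⟩ := Nat.exists_eq_add_of_le hS
  have hc : S.card + Sᶜ.card = Fintype.card G := Finset.card_add_card_compl S
  have hle : j ≤ 7 * Fintype.card G := by omega
  obtain ⟨i, hi⟩ := Nat.exists_eq_add_of_le hle
  have hi' : 8 * Sᶜ.card = i := by omega
  have hsum : ∑ g, F g ≤ S.card * b + Sᶜ.card * a := by
    rw [← Finset.sum_add_sum_compl S]
    refine add_le_add ?_ ?_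
    · rw [← nsmul_eq_mul]; exact Finset.sum_le_card_nsmul _ _ _ hb
    · rw [← nsmul_eq_mul]; exact Finset.sum_le_card_nsmul _ _ _ fun g _ => ha g
  have hmain : 8 * ∑ g, F g ≤ Fintype.card G * (7 * a + b) := by
    calc 8 * ∑ g, F g ≤ 8 * (S.card * b + Sᶜ.card * a) := by gcongr
      _ = ((8 * S.card : ℕ) : ℝ≥0∞) * b + ((8 * Sᶜ.card : ℕ) : ℝ≥0∞) * a := by
        push_cast; ring
      _ = Fintype.card G * b + (j * b + i * a) := by
        rw [hj, hi']; push_cast; ring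
      _ ≤ Fintype.card G * b + (j * a + i * a) := by gcongr
      _ = Fintype.card G * b + ((j + i : ℕ) : ℝ≥0∞) * a := by push_cast; ring
      _ = Fintype.card G * (7 * a + b) := by rw [← hi]; push_cast; ring
  rw [tsum_fintype]
  simp only [PMF.uniformOfFintype_apply, ← Finset.mul_sum]
  calc 8 * ((Fintype.card G : ℝ≥0∞)⁻¹ * ∑ g, F g)
      = (Fintype.card G : ℝ≥0∞)⁻¹ * (8 * ∑ g, F g) := by ring
    _ ≤ (Fintype.card G : ℝ≥0∞)⁻¹ * (Fintype.card G * (7 * a + b)) := by gcongr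
    _ = 7 * a + b := by rw [← mul_assoc, ENNReal.inv_mul_cancel hn0 hnt, one_mul]

/-! ### The Cantor–Zassenhaus algorithm -/

section CantorZassenhaus

variable {p : ℕ} [Fact p.Prime] {Ω : Type*} [Field Ω] [Algebra (ZMod p) Ω] [CharP Ω p]
  [IsAlgClosed Ω] {fY : List (ZMod p)} {y : Ω} {c e : ℕ} {f₀ : Polynomial Ω}

/-- By separability `mp φ f` has `f.length` distinct roots, and they fall into orbits of size `e`.
If `f.length ≠ e`, one orbit cannot exhaust them, and a second orbit is disjoint from the first. -/
theorem exists_two_roots {R : Type} {A : Arith R} {V : R → Prop} {φ : R → Ω} {D : ℕ}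
    (h : A.ModelsField V φ c (p ^ D)) (hsep : f₀.Separable)
    (hroots : ∀ ξ, f₀.eval ξ = 0 → Function.minimalPeriod (fun x : Ω => x ^ p ^ D) ξ = e)
    {f : List R} (hf : ∀ l ∈ f, V l) (hdvd : mp φ f ∣ f₀) (hpos : 0 < f.length)
    (hne : f.length ≠ e) :
    ∃ ξ₁ ξ₂, ((mp φ f).eval ξ₁ = 0 ∧ (mp φ f).eval ξ₂ = 0) ∧ ξ₂ ∉ orbit (p ^ D) e ξ₁ ∧
      e + e ≤ f.length := by
  classical
  have hsep' := hsep.of_dvd hdvd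
  have hroots' : ∀ ξ, (mp φ f).eval ξ = 0 →
      Function.minimalPeriod (fun x : Ω => x ^ p ^ D) ξ = e :=
    fun ξ hξ => hroots ξ (eval_eq_zero_of_dvd_of_eval_eq_zero hdvd hξ)
  set Z := (mp φ f).roots.toFinset with hZ
  have hZmem : ∀ x, x ∈ Z ↔ (mp φ f).eval x = 0 := by
    intro x
    rw [hZ, Multiset.mem_toFinset, mem_roots (mp_monic φ f).ne_zero, IsRoot.def]
  have hZcard : Z.card = f.length := by
    rw [hZ, Multiset.toFinset_card_of_nodup (nodup_roots hsep'),
      IsAlgClosed.card_roots_eq_natDegree, natDegree_mp]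
  have horb : ∀ ξ, (mp φ f).eval ξ = 0 → orbit (p ^ D) e ξ ⊆ Z := by
    intro ξ hξ x hx
    obtain ⟨j, -, rfl⟩ := mem_orbit.1 hx
    rw [hZmem, ← h.lp_one_cons, eval_lp]
    rw [← h.lp_one_cons, eval_lp] at hξ
    refine hev_iterate_eq_zero (fun a ha => h.fix a ?_) hξ j
    rcases List.mem_cons.1 ha with rfl | ha
    · exact h.one_valid
    · exact hf a ha
  obtain ⟨ξ₁, h₁⟩ := IsAlgClosed.exists_root (mp φ f) (by
    rw [degree_eq_natDegree (mp_monic φ f).ne_zero, natDegree_mp]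
    exact_mod_cast hpos.ne')
  have hnsub : ¬ Z ⊆ orbit (p ^ D) e ξ₁ := by
    intro hsub
    have := Finset.Subset.antisymm hsub (horb ξ₁ h₁)
    rw [this, card_orbit (hroots' ξ₁ h₁)] at hZcard
    exact hne hZcard.symm
  obtain ⟨ξ₂, h₂, h₁₂⟩ := Finset.not_subset.1 hnsub
  rw [hZmem] at h₂
  refine ⟨ξ₁, ξ₂, ⟨h₁, h₂⟩, h₁₂, ?_⟩
  have hdisj := disjoint_orbit (hroots' ξ₁ h₁) h₁₂ e
  have hcard := Finset.card_union_of_disjoint hdisj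
  rw [card_orbit (hroots' ξ₁ h₁), card_orbit (hroots' ξ₂ h₂)] at hcard
  rw [← hZcard, ← hcard]
  exact Finset.card_le_card (Finset.union_subset (horb ξ₁ h₁) (horb ξ₂ h₂))

/-- Since `k` divides `Q - 1 > 0` exactly, `M` is at least 1, so `Q = k * M + 1 ≤ 4 * M` even for `k
= 3`. -/
theorem exponent_bounds {Q k M : ℕ} (hQ : 1 < Q) (hk : k = 2 ∨ k = 3) (hdvd : k ∣ Q - 1)
    (hM : M = (Q - 1) / k) : M ∣ Q - 1 ∧ Q ≤ 4 * M ∧ 2 * M ≤ Q := by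
  obtain ⟨j, hj⟩ := hdvd
  have hMj : M = j := by
    rw [hM, hj]
    exact Nat.mul_div_cancel_left _ (by omega)
  subst hMj
  refine ⟨⟨k, by rw [hj, mul_comm]⟩, ?_⟩
  rcases hk with rfl | rfl <;> omega

/-- Induction on the number of rounds, with the invariant that the current polynomial divides `f₀`.
A round costs at most `T` and lowers the degree with probability at least 1/8, whence `8 * T` per
unit of degree. The cut-off bound uses 2^degree as potential; it at least halves with the same
probability. -/
theorem cantorZassenhaus_spec
    (h : (ext p fY).ModelsField (fun l => l.length = fY.length) (hev (algebraMap (ZMod p) Ω) y) c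
      (p ^ fY.length)) (hD : 0 < fY.length) (he : 0 < e) (hsep : f₀.Separable)
    (hroots : ∀ ξ, f₀.eval ξ = 0 →
      Function.minimalPeriod (fun x : Ω => x ^ p ^ fY.length) ξ = e)
    (hk : (if p = 2 then 3 else 2) ∣ (p ^ fY.length) ^ e - 1) {w : ℕ}
    (hwq : (p ^ fY.length - 2).size ≤ w)
    (hwM : (((p ^ fY.length) ^ e - 1) / (if p = 2 then 3 else 2)).size ≤ w)
    (k : ℕ) {f : List (List (ZMod p))} (hf : ∀ l ∈ f, l.length = fY.length)
    (hdvd : mp (hev (algebraMap (ZMod p) Ω) y) f ∣ f₀) (hpos : 0 < f.length)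
    (hw : f.length + 1 ≤ w) :
    (∀ g, (cantorZassenhaus p fY e k f).CanReturn g → (∀ l ∈ g, l.length = fY.length) ∧
      mp (hev (algebraMap (ZMod p) Ω) y) g ∣ f₀ ∧ g.length = e) ∧
    (cantorZassenhaus p fY e k f).expectedOps ≤ (8 * (26 * (c * w ^ 3)) * f.length : ℕ) ∧
    (cantorZassenhaus p fY e k f).cutOffProb ≤ 2 ^ f.length * (15 / 16) ^ k := by
  classical
  set φ := hev (algebraMap (ZMod p) Ω) y with hφ
  set T := 26 * (c * w ^ 3) with hT
  have hdone : ∀ (f : List (List (ZMod p))) (x : Rand (List (List (ZMod p)))) (k : ℕ),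
      (∀ l ∈ f, l.length = fY.length) → mp φ f ∣ f₀ → x = pure f → f.length = e →
      (∀ g, x.CanReturn g → (∀ l ∈ g, l.length = fY.length) ∧ mp φ g ∣ f₀ ∧ g.length = e) ∧
      x.expectedOps ≤ (8 * T * f.length : ℕ) ∧ x.cutOffProb ≤ 2 ^ f.length * (15 / 16) ^ k := by
    rintro f x k hf hdvd rfl hfe
    refine ⟨fun g hg => ?_, ?_, ?_⟩
    · rw [hg.of_pure]; exact ⟨hf, hdvd, hfe⟩
    · rw [Rand.expectedOps_pure]; exact zero_le
    · rw [Rand.cutOffProb_pure]; exact zero_le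
  induction k generalizing f with
  | zero =>
    by_cases hfe : f.length = e
    · exact hdone f _ _ hf hdvd (by rw [cantorZassenhaus, if_pos hfe]) hfe
    · rw [cantorZassenhaus, if_neg hfe]
      refine ⟨fun g hg => absurd hg Rand.not_canReturn_cutOff, ?_, ?_⟩
      · rw [Rand.expectedOps_cutOff]; exact zero_le
      · rw [Rand.cutOffProb_cutOff, pow_zero, mul_one]
        exact one_le_pow₀ one_le_two
  | succ k ih =>
    by_cases hfe : f.length = e
    · exact hdone f _ _ hf hdvd (by rw [cantorZassenhaus, if_pos hfe]) hfe
    obtain ⟨ξ₁, ξ₂, ⟨r₁, r₂⟩, h₁₂, hee⟩ := exists_two_roots h hsep hroots hf hdvd hpos hfe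
    set M := ((p ^ fY.length) ^ e - 1) / (if p = 2 then 3 else 2) with hM
    have hQ1 : 1 < (p ^ fY.length) ^ e :=
      Nat.one_lt_pow he.ne' (Nat.one_lt_pow hD.ne' (Fact.out : p.Prime).one_lt)
    obtain ⟨hM1, hM4, hM2⟩ := exponent_bounds hQ1 (by split_ifs <;> simp) hk hM
    have hcount := card_le_eight_mul_card_split (m := f.length) h.inj h.fix
      (hroots ξ₁ (eval_eq_zero_of_dvd_of_eval_eq_zero hdvd r₁))
      (hroots ξ₂ (eval_eq_zero_of_dvd_of_eval_eq_zero hdvd r₂)) h₁₂ hee hD he hM1 hM4 hM2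
    set S := Finset.univ.filter fun g : Fin f.length → Fin fY.length → ZMod p =>
        hev φ ξ₁ (coeffLists g) ^ M = 1 ∧ hev φ ξ₂ (coeffLists g) ^ M ≠ 1 with hS
    have hround : ∀ g : Fin f.length → Fin fY.length → ZMod p, _ := fun g =>
      czRound_spec (e := e) h hD hf (length_of_mem_coeffLists g) (length_coeffLists g) hpos hw hwq
        hwM
    have hle : ∀ g : Fin f.length → Fin fY.length → ZMod p,
        (czRound p fY e f (coeffLists g)).val.length ≤ f.length :=
      fun g => length_le_of_mp_dvd (hround g).1.2.1
    have hlt : ∀ g ∈ S, (czRound p fY e f (coeffLists g)).val.length + 1 ≤ f.length := by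
      intro g hg
      obtain ⟨-, g₁, g₂⟩ := Finset.mem_filter.1 hg
      exact (hround g).2.2 ξ₁ ξ₂ r₁ r₂ g₁ g₂
    have hih : ∀ g : Fin f.length → Fin fY.length → ZMod p, _ := fun g =>
      ih (hround g).1.1 (hround g).1.2.2 ((Nat.succ_le_succ (hle g)).trans hw)
        ((hround g).1.2.1.trans hdvd)
    have hunf : cantorZassenhaus p fY e (k + 1) f =
        (Rand.sample (randomPoly p fY.length f.length) >>= fun g =>
          Rand.lift (czRound p fY e f g) >>= fun f' => cantorZassenhaus p fY e k f') := by
      rw [cantorZassenhaus, if_neg hfe]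
    have hrand : randomPoly p fY.length f.length =
        PMF.map coeffLists (PMF.uniformOfFintype (Fin f.length → Fin fY.length → ZMod p)) := rfl
    have h8 : (8 : ℝ≥0∞) ≠ 0 := by norm_num
    have h8t : (8 : ℝ≥0∞) ≠ ⊤ := by norm_num
    obtain ⟨L, hL⟩ : ∃ L, f.length = L + 1 := ⟨f.length - 1, by omega⟩
    rw [hunf]
    refine ⟨fun g hg => ?_, ?_, ?_⟩
    · obtain ⟨a, ha, hg₁⟩ := hg.of_bind
      obtain ⟨f', hf', hg₂⟩ := hg₁.of_bind
      have ha' := ha.of_sample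
      rw [hrand, PMF.mem_support_map_iff] at ha'
      obtain ⟨b, -, rfl⟩ := ha'
      rw [hf'.of_lift] at hg₂
      exact (hih b).1 g hg₂
    · rw [Rand.expectedOps_sample_bind, hrand, tsum_map_mul]
      simp only [Rand.expectedOps_lift_bind]
      rw [← ENNReal.mul_le_mul_iff_right h8 h8t]
      -- The gain `8 * T` in one eighth of the cases pays exactly for the round's cost `T`.
      refine (eight_mul_average_le S hcount (a := ((T + 8 * T * f.length : ℕ) : ℝ≥0∞))
        (b := ((T + 8 * T * L : ℕ) : ℝ≥0∞)) ?_ ?_ ?_).trans (le_of_eq ?_)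
      · rw [hL]
        exact_mod_cast Nat.add_le_add_left (Nat.mul_le_mul_left _ (Nat.le_succ _)) _
      · intro g
        rw [Nat.cast_add]
        refine add_le_add (by exact_mod_cast (hround g).2.1) ((hih g).2.1.trans ?_)
        exact_mod_cast Nat.mul_le_mul_left _ (hle g)
      · intro g hg
        rw [Nat.cast_add]
        refine add_le_add (by exact_mod_cast (hround g).2.1) ((hih g).2.1.trans ?_)
        have := hlt g hg
        exact_mod_cast Nat.mul_le_mul_left _ (by omega)
      · rw [hL]
        push_cast
        ring
    · rw [Rand.cutOffProb_sample_bind, hrand, tsum_map_mul]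
      simp only [Rand.cutOffProb_lift_bind]
      rw [← ENNReal.mul_le_mul_iff_right h8 h8t]
      -- Here 7/8 + (1/8)(1/2) = 15/16 is the factor per round.
      refine (eight_mul_average_le S hcount (a := 2 ^ f.length * (15 / 16) ^ k)
        (b := 2 ^ L * (15 / 16) ^ k) ?_ ?_ ?_).trans (le_of_eq ?_)
      · rw [hL]
        gcongr
        · exact one_le_two
        · exact Nat.le_succ _
      · intro g
        refine (hih g).2.2.trans ?_
        gcongr
        · exact one_le_two
        · exact hle g
      · intro g hg
        refine (hih g).2.2.trans ?_
        have := hlt g hg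
        gcongr
        · exact one_le_two
        · omega
      · have e16 : (16 : ℝ≥0∞) * (15 / 16) = 15 :=
          ENNReal.mul_div_cancel (by norm_num) (by norm_num)
        rw [hL, pow_succ, pow_succ]
        generalize (15 / 16 : ℝ≥0∞) = r at e16 ⊢
        calc 7 * (2 ^ L * 2 * r ^ k) + 2 ^ L * r ^ k = 2 ^ L * r ^ k * 15 := by ring
          _ = 2 ^ L * r ^ k * (16 * r) := by rw [e16]
          _ = _ := by ring

end CantorZassenhaus

/-! ### Adjoining roots of unity -/

section RootsOfUnity

variable {p : ℕ} [Fact p.Prime] {Ω : Type*} [Field Ω] [Algebra (ZMod p) Ω] [CharP Ω p]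

/-- `fY` is the tail of the minimal polynomial over `𝔽_p` of the primitive `a`-th root of
unity `y`. -/
structure IsCyclotomicFactor (a : ℕ) (fY : List (ZMod p)) (y : Ω) : Prop where
  prim : IsPrimitiveRoot y a
  len : fY.length = orderOf (p : ZMod a)
  root : y ^ fY.length + hev (algebraMap (ZMod p) Ω) y fY = 0

theorem orderOf_natCast_pos {a : ℕ} (ha : 0 < a) (hpa : p.Coprime a) :
    0 < orderOf (p : ZMod a) := by
  have : NeZero a := ⟨ha.ne'⟩
  rw [orderOf_pos_iff, ← ZMod.coe_unitOfCoprime p hpa, Units.isOfFinOrder_val]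
  exact isOfFinOrder_of_finite _

theorem natCast_pow_eq_one_iff {a n : ℕ} : (p : ZMod a) ^ n = 1 ↔ a ∣ p ^ n - 1 := by
  have h1 : 1 ≤ p ^ n := Nat.one_le_pow _ _ (Fact.out : p.Prime).pos
  rw [← CharP.cast_eq_zero_iff (ZMod a) a, Nat.cast_sub h1, sub_eq_zero]
  push_cast
  rfl

/-- For a root of unity `y ≠ 0`, being fixed means `y ^ (p ^ n - 1) = 1`, i.e. `a ∣ p ^ n - 1`. This
ties the degree of a root of unity over 𝔽_p to the order of `p`. -/
theorem pow_card_eq_self_iff {a n : ℕ} {y : Ω} (hy : IsPrimitiveRoot y a) (ha : 0 < a) :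
    y ^ p ^ n = y ↔ orderOf (p : ZMod a) ∣ n := by
  have h1 : 1 ≤ p ^ n := Nat.one_le_pow _ _ (Fact.out : p.Prime).pos
  have hy0 : y ≠ 0 := hy.ne_zero ha.ne'
  rw [orderOf_dvd_iff_pow_eq_one, natCast_pow_eq_one_iff, ← hy.pow_eq_one_iff_dvd]
  conv_lhs => rw [← Nat.sub_add_cancel h1, pow_succ]
  exact mul_eq_right₀ hy0

theorem minimalPeriod_eq {q e : ℕ} {ξ : Ω} (h : ∀ n, ξ ^ q ^ n = ξ ↔ e ∣ n) :
    Function.minimalPeriod (fun x : Ω => x ^ q) ξ = e := by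
  have key : ∀ n, Function.minimalPeriod (fun x : Ω => x ^ q) ξ ∣ n ↔ e ∣ n := by
    intro n
    rw [← Function.isPeriodicPt_iff_minimalPeriod_dvd, Function.IsPeriodicPt,
      Function.IsFixedPt, iterate_pow_eq, h]
  exact Nat.dvd_antisymm ((key e).2 dvd_rfl) ((key _).1 dvd_rfl)

theorem IsCyclotomicFactor.modelsField {a : ℕ} {fY : List (ZMod p)} {y : Ω}
    (h : IsCyclotomicFactor a fY y) (ha : 0 < a) (hpa : p.Coprime a) :
    (ext p fY).ModelsField (fun l => l.length = fY.length) (hev (algebraMap (ZMod p) Ω) y)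
      (4 * fY.length ^ 2) (p ^ fY.length) := by
  have hD : 0 < fY.length := by rw [h.len]; exact orderOf_natCast_pos ha hpa
  have hbase : (Arith.base (ZMod p)).ModelsField (fun _ => True) (algebraMap (ZMod p) Ω) 1
      (p ^ 1) := by
    rw [pow_one]
    exact Arith.modelsField_base
  have := hbase.quot (f := fY) (fun _ _ => trivial) hD h.root (by
    rw [pow_one]
    refine minimalPeriod_eq fun n => ?_
    rw [h.len]
    exact pow_card_eq_self_iff h.prim ha)
  simpa [ext] using this

theorem hev_replicate_one_mul {R T : Type*} [CommRing T] {φ : R → T} {x : R} (hx : φ x = 1)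
    (t : T) (n : ℕ) : hev φ t (List.replicate n x) * (t - 1) = t ^ n - 1 := by
  induction n with
  | zero => simp
  | succ n ih =>
    rw [List.replicate_succ, hev_cons, add_mul, ih, hx, List.length_replicate]
    ring

theorem hev_replicate_one_at_one {R T : Type*} [CommRing T] {φ : R → T} {x : R} (hx : φ x = 1)
    (n : ℕ) : hev φ 1 (List.replicate n x) = n := by
  induction n with
  | zero => simp
  | succ n ih =>
    rw [List.replicate_succ, hev_cons, ih, hx]
    push_cast
    ring

/-- The `ℓ`-th power of `y * ξ` is `y ^ (ℓ + b)`, of order `a`. Hence `y * ξ` has order `a` or `a *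
ℓ`, and order `a` is impossible: divisible by `ℓ`, it would drop on taking `ℓ`-th powers. -/
theorem isPrimitiveRoot_mul_of_pow_eq {a ℓ b : ℕ} {y ξ : Ω} (hy : IsPrimitiveRoot y a)
    (hℓ : ℓ.Prime) (hdvd : ℓ ∣ a) (hb : (ℓ + b).Coprime a) (hξ : ξ ^ ℓ = y ^ b) :
    IsPrimitiveRoot (y * ξ) (a * ℓ) := by
  have h1 : IsPrimitiveRoot ((y * ξ) ^ ℓ) a := by
    rw [mul_pow, hξ, ← pow_add]
    exact hy.pow_of_coprime _ hb
  rw [IsPrimitiveRoot.iff_orderOf]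
  have h2 := h1.eq_orderOf
  rw [orderOf_pow' _ hℓ.ne_zero] at h2
  have hg := Nat.gcd_dvd_left (orderOf (y * ξ)) ℓ
  rcases (Nat.dvd_prime hℓ).1 (Nat.gcd_dvd_right (orderOf (y * ξ)) ℓ) with h3 | h3
  · rw [h3, Nat.div_one] at h2
    rw [h2] at hdvd
    have := Nat.gcd_eq_right hdvd
    exact absurd (h3.symm.trans this) hℓ.one_lt.ne
  · rw [h3] at h2 hg
    rw [h2, Nat.div_mul_cancel hg]

/-- Every root `ξ` makes `y * ξ` a primitive root of order `a * ℓ`, so it does not matter which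
irreducible factor is found. Separability holds because the polynomial divides some `X ^ ℓ - C c`
with `c ≠ 0`, and `ℓ ≠ p`. -/
theorem kummerPoly_spec {a ℓ w : ℕ} {fY : List (ZMod p)} {y : Ω}
    (h : IsCyclotomicFactor a fY y) (ha : 0 < a) (hpa : p.Coprime a) (hℓ : ℓ.Prime)
    (hpℓ : p ≠ ℓ) (hwa : a.size ≤ w) (hwD : fY.length ≤ w) :
    ((∀ l ∈ (kummerPoly p fY a ℓ).val, l.length = fY.length) ∧
      0 < (kummerPoly p fY a ℓ).val.length ∧ (kummerPoly p fY a ℓ).val.length ≤ ℓ) ∧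
    (mp (hev (algebraMap (ZMod p) Ω) y) (kummerPoly p fY a ℓ).val).Separable ∧
    (∀ ξ, (mp (hev (algebraMap (ZMod p) Ω) y) (kummerPoly p fY a ℓ).val).eval ξ = 0 →
      IsPrimitiveRoot (y * ξ) (a * ℓ)) ∧
    (kummerPoly p fY a ℓ).ops ≤ 14 * w ^ 3 := by
  have hF := h.modelsField ha hpa
  have hD : 0 < fY.length := by rw [h.len]; exact orderOf_natCast_pos ha hpa
  have hℓΩ : (ℓ : Ω) ≠ 0 := by
    rw [Ne, CharP.cast_eq_zero_iff Ω p]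
    exact fun hd => hpℓ ((Nat.prime_dvd_prime_iff_eq Fact.out hℓ).1 hd)
  have hy0 : y ≠ 0 := h.prim.ne_zero ha.ne'
  by_cases hdvd : ℓ ∣ a
  · obtain ⟨g1, g2, g3⟩ := (Arith.models_base (algebraMap (ZMod p) Ω)).gen_spec
      (f := fY) (fun _ _ => trivial) hD h.root
    set Y := ((Arith.base (ZMod p)).gen fY).val with hY
    set b := a / ℓ ^ a.factorization ℓ with hb
    have hc := hF.pow_valid g1.1 b
    have hc' := hF.map_pow g1.1 b
    have hco := hF.pow_ops g1.1 b
    have hs := hF.sub_valid hF.zero_valid hc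
    have hs' := hF.map_sub hF.zero_valid hc
    have hso := hF.sub_ops hF.zero_valid hc
    set s := (ext p fY).sub (ext p fY).zero ((ext p fY).pow Y b).val with hsdef
    have hval : (kummerPoly p fY a ℓ).val = (ext p fY).const ℓ s.val := by
      simp only [kummerPoly, if_pos hdvd, Counted.val_bind, Counted.val_pure]
      rfl
    have hops : (kummerPoly p fY a ℓ).ops =
        ((Arith.base (ZMod p)).gen fY).ops + (((ext p fY).pow Y b).ops + s.ops) := by
      simp only [kummerPoly, if_pos hdvd, Counted.ops_bind, Counted.ops_pure]
      rfl
    have hlen : ((ext p fY).const ℓ s.val).length = ℓ := Arith.Models.const_length hℓ.pos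
    have hmp : mp (hev (algebraMap (ZMod p) Ω) y) ((ext p fY).const ℓ s.val) =
        X ^ ℓ - C (y ^ b) := by
      rw [mp, hlen, lp, (hF.comp C).hev_const X ℓ, hs', hF.map_zero, hc', g2]
      simp [sub_eq_add_neg]
    rw [hval, hops, hmp, hlen]
    refine ⟨⟨hF.const_valid hs, hℓ.pos, le_rfl⟩,
      separable_X_pow_sub_C _ hℓΩ (pow_ne_zero _ hy0), fun ξ hξ => ?_, ?_⟩
    · refine isPrimitiveRoot_mul_of_pow_eq h.prim hℓ hdvd (b := b) ?_ ?_
      -- Here `a = ℓ ^ v * b` with `ℓ` prime to `b`; so `ℓ + b` is prime to `ℓ` and to `b`, hence to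
      -- `a`.
      · have hbl : ℓ.Coprime b := Nat.coprime_ordCompl hℓ ha.ne'
        have hab : ℓ ^ a.factorization ℓ * b = a := Nat.ordProj_mul_ordCompl_eq_self a ℓ
        rw [← hab]
        refine Nat.Coprime.mul_right (Nat.Coprime.pow_right _ ?_) ?_
        · simpa using hbl.symm
        · simpa using hbl
      · simpa [sub_eq_zero] using hξ
    · have hbs : b.size ≤ w := (Nat.size_le_size (Nat.div_le_self _ _)).trans hwa
      have hw1 : 1 ≤ w := hD.trans_le hwD
      calc _ ≤ fY.length * (2 * 1) + (2 * b.size * (4 * fY.length ^ 2) + 4 * fY.length ^ 2) :=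
            add_le_add g3 (add_le_add hco hso)
        _ ≤ w * (2 * 1) + (2 * w * (4 * w ^ 2) + 4 * w ^ 2) := by gcongr
        _ = 2 * (w * 1 * 1) + 8 * w ^ 3 + 4 * (w ^ 2 * 1) := by ring
        _ ≤ 2 * (w * w * w) + 8 * w ^ 3 + 4 * (w ^ 2 * w) := by gcongr
        _ = 14 * w ^ 3 := by ring
  · have hval : (kummerPoly p fY a ℓ) = pure (List.replicate (ℓ - 1) (ext p fY).one) := by
      simp only [kummerPoly, if_neg hdvd]
    have hℓ1 : ℓ - 1 + 1 = ℓ := Nat.sub_add_cancel hℓ.one_le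
    rw [hval]
    simp only [Counted.val_pure, Counted.ops_pure]
    set f := List.replicate (ℓ - 1) (ext p fY).one with hf
    have hlen : f.length = ℓ - 1 := by simp [hf]
    have hmul : mp (hev (algebraMap (ZMod p) Ω) y) f * (X - 1) = X ^ ℓ - C 1 := by
      rw [mp, add_mul, lp, hf, hev_replicate_one_mul (by rw [hF.map_one, C_1]),
        List.length_replicate, C_1]
      calc X ^ (ℓ - 1) * (X - 1) + (X ^ (ℓ - 1) - 1) = (X ^ (ℓ - 1 + 1) - 1 : Polynomial Ω) := by
            ring
        _ = X ^ ℓ - 1 := by rw [hℓ1]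
    refine ⟨⟨?_, ?_, ?_⟩, ?_, fun ξ hξ => ?_, Nat.zero_le _⟩
    · intro l hl
      rw [List.eq_of_mem_replicate hl]
      exact hF.one_valid
    · have := hℓ.two_le; omega
    · omega
    · exact (separable_X_pow_sub_C (1 : Ω) hℓΩ one_ne_zero).of_dvd (Dvd.intro _ hmul)
    · have h1 : ξ ^ ℓ = 1 := by
        have := congrArg (eval ξ) hmul
        rw [eval_mul, hξ, zero_mul] at this
        exact (sub_eq_zero.1 (by simpa using this.symm))
      -- At 1 the polynomial has the value `ℓ`, which is nonzero in characteristic `p`.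
      have h2 : ξ ≠ 1 := by
        rintro rfl
        rw [eval_mp, hf, hev_replicate_one_at_one hF.map_one] at hξ
        apply hℓΩ
        rw [← hℓ1]
        push_cast
        rw [← hξ]
        ring
      have h3 : orderOf ξ = ℓ := orderOf_eq_prime h1 h2
        (hp := ⟨hℓ⟩)
      rw [IsPrimitiveRoot.iff_orderOf, (Commute.all y ξ).orderOf_mul_eq_mul_orderOf_of_coprime,
        h3, ← h.prim.eq_orderOf]
      rw [h3, ← h.prim.eq_orderOf]
      exact ((Nat.Prime.coprime_iff_not_dvd hℓ).2 hdvd).symm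

theorem exists_algebraMap_of_pow_eq {x : Ω} (hx : x ^ p = x) :
    ∃ k : ZMod p, algebraMap (ZMod p) Ω k = x := by
  classical
  have hp : p.Prime := Fact.out
  have hne := FiniteField.X_pow_card_sub_X_ne_zero Ω hp.one_lt
  have hsub : Finset.univ.image (algebraMap (ZMod p) Ω) ⊆
      (X ^ p - X : Polynomial Ω).roots.toFinset := by
    intro z hz
    obtain ⟨k, -, rfl⟩ := Finset.mem_image.1 hz
    rw [Multiset.mem_toFinset, mem_roots hne]
    simp [← map_pow]
  have hcard : (X ^ p - X : Polynomial Ω).roots.toFinset.card ≤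
      (Finset.univ.image (algebraMap (ZMod p) Ω)).card := by
    rw [Finset.card_image_of_injective _ (algebraMap (ZMod p) Ω).injective, Finset.card_univ,
      ZMod.card]
    refine (Multiset.toFinset_card_le _).trans ((card_roots' _).trans ?_)
    rw [FiniteField.X_pow_card_sub_X_natDegree_eq Ω hp.one_lt]
  have hmem : x ∈ (X ^ p - X : Polynomial Ω).roots.toFinset := by
    rw [Multiset.mem_toFinset, mem_roots hne]
    simp [hx]
  rw [← Finset.eq_of_subset_of_card_le hsub hcard] at hmem
  obtain ⟨k, -, hk⟩ := Finset.mem_image.1 hmem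
  exact ⟨k, hk⟩

theorem map_frobenius_prod_conjugates {n : ℕ} {z : Ω} (hz : z ^ p ^ n = z) :
    (((List.range n).map fun j => X - C ((fun x : Ω => x ^ p)^[j] z)).prod).map (frobenius Ω p) =
      ((List.range n).map fun j => X - C ((fun x : Ω => x ^ p)^[j] z)).prod := by
  have hl : ∀ n, ((List.range n).map fun j => X - C ((fun x : Ω => x ^ p)^[j] z)).prod =
      ∏ j ∈ Finset.range n, (X - C ((fun x : Ω => x ^ p)^[j] z)) := by
    intro n
    rfl
  rw [hl, Polynomial.map_prod]
  -- Frobenius shifts the factors by one place. The product over `n + 1` conjugates, split at either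
  -- end, has the same outer factor `X - C z`, which cancels.
  have h1 := Finset.prod_range_succ (fun j => X - C ((fun x : Ω => x ^ p)^[j] z)) n
  rw [Finset.prod_range_succ', iterate_pow_eq, iterate_pow_eq, hz] at h1
  simp only [pow_zero, pow_one] at h1
  have h2 := mul_right_cancel₀ (X_sub_C_ne_zero z) h1
  refine Eq.trans (Finset.prod_congr rfl fun j _ => ?_) h2
  rw [Function.iterate_succ_apply', Polynomial.map_sub, map_X, map_C, frobenius_def]

/-- The product over all conjugates is Frobenius-invariant, so its coefficients lie in 𝔽_p. By
uniqueness of representatives they are constant lists of constant lists, and the last entries, which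
belong to degree 0, are the values. -/
theorem flatten_spec {a b w e : ℕ} {fY : List (ZMod p)} {y ξ : Ω}
    (h : IsCyclotomicFactor a fY y) (ha : 0 < a) (hpa : p.Coprime a) (hb : 0 < b)
    {g : List (List (ZMod p))} (hg : ∀ l ∈ g, l.length = fY.length) (hge : g.length = e)
    (he : 0 < e) (hξ : ξ ^ g.length + hev (hev (algebraMap (ZMod p) Ω) y) ξ g = 0)
    (hper : Function.minimalPeriod (fun x : Ω => x ^ p ^ fY.length) ξ = e)
    (hz : IsPrimitiveRoot (y * ξ) b) (hlen : fY.length * e = orderOf (p : ZMod b))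
    (hwD : fY.length * e ≤ w) (hwp : p.size ≤ w) :
    IsCyclotomicFactor b (flatten p fY g).val (y * ξ) ∧ (flatten p fY g).ops ≤ 78 * w ^ 4 := by
  have hF := h.modelsField ha hpa
  have hD : 0 < fY.length := by rw [h.len]; exact orderOf_natCast_pos ha hpa
  have hE := hF.quot hg (by omega) hξ (by rw [hper, hge])
  set E := (ext p fY).quot g with hEdef
  set φ := hev (algebraMap (ZMod p) Ω) y with hφ
  obtain ⟨g1, g2, g3⟩ := (Arith.models_base (algebraMap (ZMod p) Ω)).gen_spec
    (f := fY) (fun _ _ => trivial) hD h.root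
  set Y := ((Arith.base (ZMod p)).gen fY).val with hY
  obtain ⟨x1, x2, x3⟩ := hF.gen_spec hg (by omega) hξ
  set x := ((ext p fY).gen g).val with hx
  have z1 : (x.map fun c => ((ext p fY).mul Y c).val).length = g.length ∧
      ∀ l ∈ x.map fun c => ((ext p fY).mul Y c).val, l.length = fY.length := by
    refine ⟨by rw [List.length_map, x1.1], fun l hl => ?_⟩
    obtain ⟨c, hc, rfl⟩ := List.mem_map.1 hl
    exact hF.mul_valid g1.1 (x1.2 c hc)
  have z2 : hev φ ξ (x.map fun c => ((ext p fY).mul Y c).val) = y * ξ := by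
    have := congrArg (eval ξ) (hF.lp_mapMul g1.1 x1.2)
    rw [eval_mul, eval_lp, eval_lp, eval_C, show φ Y = y from g2, x2] at this
    exact this
  have z3 : (mapList ((ext p fY).mul Y) x).ops ≤ e * (4 * fY.length ^ 2) := by
    refine (mapList_ops_le fun c hc => hF.mul_ops g1.1 (x1.2 c hc)).trans ?_
    rw [x1.1, hge]
  set z := x.map fun c => ((ext p fY).mul Y c).val with hzdef
  obtain ⟨c1, c2, c3⟩ := Arith.iterates_spec (g := fun t => E.pow t p)
    (σ := fun x : Ω => x ^ p) (fun t ht => hE.pow_valid ht p) (fun t ht => hE.map_pow ht p)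
    (fun t ht => hE.pow_ops ht p) (fY.length * g.length) z1
  have c4 := Arith.iterates_length (fun t => E.pow t p) (fY.length * g.length) z
  set conj := (Arith.iterates (fun t => E.pow t p) (fY.length * g.length) z).val with hconj
  obtain ⟨⟨m1, m1'⟩, m2, m3⟩ := hE.expand_spec c1
  set m := (E.expand conj).val with hm
  have hval : (flatten p fY g).val = m.map fun c => (c.getLastD []).getLastD 0 := by
    simp only [flatten, Counted.val_bind, Counted.val_pure, mapList_val]
    rfl
  have hops : (flatten p fY g).ops = ((Arith.base (ZMod p)).gen fY).ops +
      (((ext p fY).gen g).ops + ((mapList ((ext p fY).mul Y) x).ops +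
      ((Arith.iterates (fun t => E.pow t p) (fY.length * g.length) z).ops +
      (E.expand conj).ops))) := by
    simp only [flatten, Counted.ops_bind, Counted.ops_pure, mapList_val, add_zero]
    rfl
  have hzp : (y * ξ) ^ p ^ (fY.length * e) = y * ξ := by
    rw [pow_card_eq_self_iff hz hb, hlen]
  have hprod : mp (hev φ ξ) m =
      ((List.range (fY.length * e)).map fun j => X - C ((fun x : Ω => x ^ p)^[j] (y * ξ))).prod := by
    rw [m2, ← z2, ← hge]
    have := congrArg (fun l => (l.map fun c => (X - C c : Polynomial Ω)).prod) c2
    simpa [List.map_map, Function.comp_def] using this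
  have hfrob : ∀ c ∈ m, hev φ ξ c ^ p = hev φ ξ c := by
    have h1 : (mp (hev φ ξ) m).map (frobenius Ω p) = mp (hev φ ξ) m := by
      rw [hprod]
      exact map_frobenius_prod_conjugates hzp
    rw [map_mp, mp, mp, add_right_inj] at h1
    have h2 : m.map (fun c => frobenius Ω p (hev φ ξ c)) = m.map (hev φ ξ) := by
      refine lp_injOn (id : Ω → Ω) (V := fun _ => True) (fun _ _ _ _ h => h) (fun _ _ => trivial)
        (fun _ _ => trivial) (by simp) ?_
      rw [lp, lp, hev_map, hev_map]
      exact h1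
    intro c hc
    exact List.map_inj_left.1 h2 c hc
  have hconst : ∀ c ∈ m, algebraMap (ZMod p) Ω ((c.getLastD []).getLastD 0) = hev φ ξ c := by
    intro c hc
    obtain ⟨k, hk⟩ := exists_algebraMap_of_pow_eq (hfrob c hc)
    have hb1 := Arith.models_base (algebraMap (ZMod p) Ω)
    have hv : ((Arith.base (ZMod p)).const fY.length k).length = fY.length :=
      Arith.Models.const_length hD
    have hc' : c = (ext p fY).const g.length ((Arith.base (ZMod p)).const fY.length k) := by
      refine hE.inj _ _ (m1 c hc)
        ⟨Arith.Models.const_length (by omega), hF.const_valid hv⟩ ?_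
      rw [hF.hev_const, hφ, hb1.hev_const, hk]
    rw [← hk, hc']
    simp [Arith.const]
  have hmp : mp (algebraMap (ZMod p) Ω) (flatten p fY g).val = mp (hev φ ξ) m := by
    rw [hval, mp, mp, List.length_map, lp, lp, hev_map]
    congr 1
    exact hev_congr _ fun c hc => by rw [hconst c hc]
  have hlen' : (flatten p fY g).val.length = fY.length * e := by
    rw [hval, List.length_map, m1', c4, hge]
  refine ⟨⟨hz, hlen'.trans hlen, ?_⟩, ?_⟩
  · rw [← eval_mp, hmp, hprod]
    have hpos : 0 < fY.length * e := Nat.mul_pos hD he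
    obtain ⟨n, hn⟩ : ∃ n, fY.length * e = n + 1 := ⟨fY.length * e - 1, by omega⟩
    rw [hn, List.range_succ_eq_map, List.map_cons, List.prod_cons]
    simp
  · have hDw : fY.length ≤ w := (Nat.le_mul_of_pos_right _ he).trans hwD
    have hew : e ≤ w := (Nat.le_mul_of_pos_left _ hD).trans hwD
    have hw1 : 1 ≤ w := hD.trans_le hDw
    rw [hops, hge]
    rw [hge] at x3 c3
    rw [c4, hge] at m3
    set k := fY.length * e with hk
    -- The price of an operation in the two-storey extension depends only on its total degree `k`
    -- over 𝔽_p.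
    have hcost : 4 * (4 * fY.length ^ 2) * e ^ 2 = 16 * k ^ 2 := by rw [hk]; ring
    rw [hcost] at c3 m3
    calc _ ≤ fY.length * (2 * 1) + (e * (2 * (4 * fY.length ^ 2)) + (e * (4 * fY.length ^ 2) +
          (k * (2 * p.size * (16 * k ^ 2)) + k * (k * (2 * (16 * k ^ 2)))))) :=
          add_le_add g3 (add_le_add x3 (add_le_add z3 (add_le_add c3 m3)))
      _ ≤ w * (2 * 1) + (w * (2 * (4 * w ^ 2)) + (w * (4 * w ^ 2) +
          (w * (2 * w * (16 * w ^ 2)) + w * (w * (2 * (16 * w ^ 2)))))) := by gcongr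
      _ = 2 * (w * 1) + 12 * (w ^ 3 * 1) + 64 * w ^ 4 := by ring
      _ ≤ 2 * (w * w ^ 3) + 12 * (w ^ 3 * w) + 64 * w ^ 4 := by
        gcongr
        exact Nat.one_le_pow _ _ hw1
      _ = 78 * w ^ 4 := by ring

end RootsOfUnity

/-! ### Adjoining roots of unity, one prime factor after the other -/

section Adjoin

variable {p : ℕ} [Fact p.Prime] {Ω : Type*} [Field Ω] [Algebra (ZMod p) Ω] [CharP Ω p]
  [IsAlgClosed Ω]

theorem orderOf_natCast_dvd_of_dvd {a b : ℕ} (h : a ∣ b) :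
    orderOf (p : ZMod a) ∣ orderOf (p : ZMod b) := by
  rw [orderOf_dvd_iff_pow_eq_one, natCast_pow_eq_one_iff]
  exact h.trans (natCast_pow_eq_one_iff.1 (pow_orderOf_eq_one _))

/-- A single parameter `w` bounds the degree, `ℓ` and all binary lengths, since everything in
question is at most `p ^ n`. The constant is 14 + 832 + 78, from `kummerPoly`, Cantor–Zassenhaus (8
* 26 * 4) and `flatten`. -/
theorem adjoinStep_spec {a ℓ w : ℕ} (rounds : ℕ) {fY : List (ZMod p)} {y : Ω}
    (h : IsCyclotomicFactor a fY y) (ha : 0 < a) (hℓ : ℓ.Prime) (hpb : p.Coprime (a * ℓ))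
    (h3 : p = 2 → 3 ∣ a * ℓ) (hwℓ : ℓ + 1 ≤ w)
    (hwn : (p ^ orderOf (p : ZMod (a * ℓ))).size ≤ w) :
    (∀ fY', (adjoinStep p rounds fY a ℓ).CanReturn fY' →
      ∃ y' : Ω, IsCyclotomicFactor (a * ℓ) fY' y') ∧
    (adjoinStep p rounds fY a ℓ).expectedOps ≤ (924 * w ^ 6 : ℕ) ∧
    (adjoinStep p rounds fY a ℓ).cutOffProb ≤ 2 ^ w * (15 / 16) ^ rounds := by
  have hp : p.Prime := Fact.out
  have hpa : p.Coprime a := hpb.coprime_mul_right_right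
  have hpl : p.Coprime ℓ := hpb.coprime_mul_left_right
  have hpℓ : p ≠ ℓ := fun hh => by
    rw [hh, Nat.coprime_self] at hpl
    exact hℓ.one_lt.ne' hpl
  have hb : 0 < a * ℓ := Nat.mul_pos ha hℓ.pos
  set b := a * ℓ with hbdef
  set n := orderOf (p : ZMod b) with hn
  have hn0 : 0 < n := orderOf_natCast_pos hb hpb
  have hD : 0 < fY.length := by rw [h.len]; exact orderOf_natCast_pos ha hpa
  have hDn : fY.length ∣ n := by
    rw [h.len]; exact orderOf_natCast_dvd_of_dvd (Dvd.intro _ rfl)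
  set e := n / fY.length with he
  have hDe : fY.length * e = n := Nat.mul_div_cancel' hDn
  have he0 : 0 < e := Nat.pos_of_ne_zero fun h0 => by rw [h0, mul_zero] at hDe; omega
  have hQ : (p ^ fY.length) ^ e = p ^ n := by rw [← pow_mul, hDe]
  have hbQ : b ∣ p ^ n - 1 := natCast_pow_eq_one_iff.1 (pow_orderOf_eq_one _)
  have hDle : fY.length ≤ n := Nat.le_of_dvd hn0 hDn
  have hpD : p ^ fY.length ≤ p ^ n := Nat.pow_le_pow_right hp.pos hDle
  have hnw : n ≤ w := (Nat.lt_size.2 (Nat.pow_le_pow_left hp.two_le n)).le.trans hwn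
  have hwD : fY.length ≤ w := hDle.trans hnw
  have hle : ∀ {k}, k ≤ p ^ n → k.size ≤ w := fun hk => (Nat.size_le_size hk).trans hwn
  have hbn : b ≤ p ^ n := by
    refine (Nat.le_of_dvd ?_ hbQ).trans (Nat.sub_le _ _)
    have := Nat.one_lt_pow hn0.ne' hp.one_lt
    omega
  have hwa : a.size ≤ w := hle ((Nat.le_mul_of_pos_right a hℓ.pos).trans hbn)
  have hwp : p.size ≤ w := hle (Nat.le_self_pow hn0.ne' p)
  obtain ⟨⟨k1, k2, k3⟩, k4, k5, k6⟩ := kummerPoly_spec h ha hpa hℓ hpℓ hwa hwD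
  have hF := h.modelsField ha hpa
  -- `y` lies in the field with `p ^ fY.length` elements, so a power of its Frobenius fixes `ξ` if
  -- and only if it fixes `y * ξ`, which is a root of unity of known order. Thus every root has
  -- degree `e`.
  have hper : ∀ ξ, (mp (hev (algebraMap (ZMod p) Ω) y) (kummerPoly p fY a ℓ).val).eval ξ = 0 →
      Function.minimalPeriod (fun x : Ω => x ^ p ^ fY.length) ξ = e := by
    intro ξ hξ
    refine minimalPeriod_eq fun j => ?_
    have hy : y ^ p ^ (fY.length * j) = y := by
      rw [pow_card_eq_self_iff h.prim ha, ← h.len]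
      exact Dvd.intro _ rfl
    have hy0 : y ≠ 0 := h.prim.ne_zero ha.ne'
    have := pow_card_eq_self_iff (p := p) (n := fY.length * j) (k5 ξ hξ) hb
    rw [mul_pow, hy, mul_right_inj' hy0, ← hn, ← hDe, Nat.mul_dvd_mul_iff_left hD] at this
    rw [← this, ← pow_mul]
  -- In characteristic 2 the exponent is an exact quotient because 3 divides `b`, which divides `2 ^
  -- n - 1`.
  have hk : (if p = 2 then 3 else 2) ∣ (p ^ fY.length) ^ e - 1 := by
    rw [hQ]
    split_ifs with hp2
    · exact (h3 hp2).trans hbQ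
    · have hodd : Odd (p ^ n) := (hp.odd_of_ne_two hp2).pow
      exact (Nat.Odd.sub_odd hodd odd_one).two_dvd
  have hw1 : 1 ≤ w := by omega
  have hcz := cantorZassenhaus_spec hF hD he0 k4 hper hk (w := w)
    (hle ((Nat.sub_le _ _).trans hpD))
    (hle ((Nat.div_le_self _ _).trans ((Nat.sub_le _ _).trans hQ.le))) rounds k1 dvd_rfl k2
    (by omega)
  obtain ⟨c1, c2, c3⟩ := hcz
  have hflat : ∀ g, (cantorZassenhaus p fY e rounds (kummerPoly p fY a ℓ).val).CanReturn g →
      ∃ y' : Ω, IsCyclotomicFactor b (flatten p fY g).val y' ∧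
        (flatten p fY g).ops ≤ 78 * w ^ 4 := by
    intro g hg
    obtain ⟨g1, g2, g3⟩ := c1 g hg
    obtain ⟨ξ, hξ⟩ := IsAlgClosed.exists_root (mp (hev (algebraMap (ZMod p) Ω) y) g) (by
      rw [degree_eq_natDegree (mp_monic _ g).ne_zero, natDegree_mp, g3]
      exact_mod_cast he0.ne')
    have hξ' := eval_eq_zero_of_dvd_of_eval_eq_zero g2 hξ
    rw [IsRoot.def, eval_mp] at hξ
    exact ⟨_, flatten_spec h ha hpa hb g1 g3 he0 hξ (hper ξ hξ') (k5 ξ hξ') hDe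
      (hDe.le.trans hnw) hwp⟩
  have hunf : adjoinStep p rounds fY a ℓ = (Rand.lift (kummerPoly p fY a ℓ) >>= fun f =>
      cantorZassenhaus p fY e rounds f >>= fun g => Rand.lift (flatten p fY g)) := rfl
  rw [hunf]
  refine ⟨fun fY' hr => ?_, ?_, ?_⟩
  · obtain ⟨f, hf, hr₁⟩ := hr.of_bind
    rw [hf.of_lift] at hr₁
    obtain ⟨g, hg, hr₂⟩ := hr₁.of_bind
    rw [hr₂.of_lift]
    obtain ⟨y', hy', -⟩ := hflat g hg
    exact ⟨y', hy'⟩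
  · rw [Rand.expectedOps_lift_bind]
    have h1 := Rand.expectedOps_bind_le (x := cantorZassenhaus p fY e rounds
      (kummerPoly p fY a ℓ).val) (f := fun g => Rand.lift (flatten p fY g))
      (B := (78 * w ^ 4 : ℕ)) (fun g hg => by
        rw [Rand.expectedOps_lift]
        obtain ⟨_, -, hops⟩ := hflat g hg
        exact_mod_cast hops)
    refine (add_le_add (Nat.cast_le.2 k6) (h1.trans (add_le_add_left c2 _))).trans ?_
    rw [← Nat.cast_add, ← Nat.cast_add, Nat.cast_le]
    calc _ ≤ 14 * w ^ 3 + (8 * (26 * (4 * w ^ 2 * w ^ 3)) * w + 78 * w ^ 4) := by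
          have : (kummerPoly p fY a ℓ).val.length ≤ w := by omega
          gcongr
      _ = 14 * (w ^ 3 * 1) + 832 * w ^ 6 + 78 * (w ^ 4 * 1) := by ring
      _ ≤ 14 * (w ^ 3 * w ^ 3) + 832 * w ^ 6 + 78 * (w ^ 4 * w ^ 2) := by
          gcongr <;> exact Nat.one_le_pow _ _ hw1
      _ = 924 * w ^ 6 := by ring
  · rw [Rand.cutOffProb_lift_bind]
    have h1 := Rand.cutOffProb_bind_le (x := cantorZassenhaus p fY e rounds
      (kummerPoly p fY a ℓ).val) (f := fun g => Rand.lift (flatten p fY g))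
      (B := 0) (fun g _ => by rw [Rand.cutOffProb_lift])
    rw [add_zero] at h1
    refine (h1.trans c3).trans ?_
    gcongr
    · exact one_le_two
    · omega

/-- The root `y` depends on the random choices, so only its existence is passed on. The condition
for `p = 2` holds if 3 is the first prime treated, and from then on because 3 divides `a`. -/
theorem adjoinAll_spec {w : ℕ} (rounds : ℕ) (ls : List ℕ) {a : ℕ} {fY : List (ZMod p)} {y : Ω}
    (h : IsCyclotomicFactor a fY y) (ha : 0 < a) (hls : ∀ ℓ ∈ ls, ℓ.Prime ∧ ℓ + 1 ≤ w)
    (hpb : p.Coprime (a * ls.prod)) (h3 : p = 2 → 3 ∣ a ∨ ls.head? = some 3)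
    (hwn : (p ^ orderOf (p : ZMod (a * ls.prod))).size ≤ w) :
    (∀ fY', (adjoinAll p rounds ls a fY).CanReturn fY' →
      ∃ y' : Ω, IsCyclotomicFactor (a * ls.prod) fY' y') ∧
    (adjoinAll p rounds ls a fY).expectedOps ≤ (ls.length * (924 * w ^ 6) : ℕ) ∧
    (adjoinAll p rounds ls a fY).cutOffProb ≤ ls.length * (2 ^ w * (15 / 16) ^ rounds) := by
  induction ls generalizing a fY y with
  | nil =>
    simp only [adjoinAll, List.prod_nil, mul_one, Rand.expectedOps_pure, Rand.cutOffProb_pure]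
    refine ⟨fun fY' hr => ?_, zero_le, zero_le⟩
    rw [hr.of_pure]
    exact ⟨y, h⟩
  | cons ℓ ls ih =>
    rw [List.prod_cons, ← mul_assoc] at hpb hwn ⊢
    have hℓ := hls ℓ (by simp)
    have hprod : 0 < ls.prod := List.prod_pos fun k hk => (hls k (by simp [hk])).1.pos
    have hb : 0 < a * ℓ := Nat.mul_pos ha hℓ.1.pos
    have hpb' : p.Coprime (a * ℓ) := hpb.coprime_mul_right_right
    have h3' : p = 2 → 3 ∣ a * ℓ := by
      intro hp2
      rcases h3 hp2 with h3 | h3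
      · exact h3.mul_right _
      · rw [List.head?_cons, Option.some.injEq] at h3
        rw [h3]; exact dvd_mul_left _ _
    have hwn' : (p ^ orderOf (p : ZMod (a * ℓ))).size ≤ w := by
      refine (Nat.size_le_size (Nat.pow_le_pow_right (Fact.out : p.Prime).pos ?_)).trans hwn
      exact Nat.le_of_dvd (orderOf_natCast_pos (Nat.mul_pos hb hprod) hpb)
        (orderOf_natCast_dvd_of_dvd (Dvd.intro _ rfl))
    obtain ⟨s1, s2, s3⟩ := adjoinStep_spec rounds h ha hℓ.1 hpb' h3' hℓ.2 hwn'
    have hrec : ∀ fY', (adjoinStep p rounds fY a ℓ).CanReturn fY' → _ := fun fY' hr =>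
      ih (s1 fY' hr).choose_spec hb (fun k hk => hls k (by simp [hk])) hpb
        (fun hp2 => Or.inl (h3' hp2)) hwn
    have hunf : adjoinAll p rounds (ℓ :: ls) a fY =
        (adjoinStep p rounds fY a ℓ >>= fun fY' => adjoinAll p rounds ls (a * ℓ) fY') := rfl
    rw [hunf]
    refine ⟨fun fY' hr => ?_, ?_, ?_⟩
    · obtain ⟨fY₁, h₁, hr₁⟩ := hr.of_bind
      exact (hrec fY₁ h₁).1 fY' hr₁
    · refine (Rand.expectedOps_bind_le fun fY' hr => (hrec fY' hr).2.1).trans ?_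
      refine (add_le_add_left s2 _).trans (le_of_eq ?_)
      rw [List.length_cons]
      push_cast
      ring
    · refine (Rand.cutOffProb_bind_le fun fY' hr => (hrec fY' hr).2.2).trans ?_
      refine (add_le_add_left s3 _).trans (le_of_eq ?_)
      rw [List.length_cons]
      push_cast
      ring

theorem isCyclotomicFactor_one : IsCyclotomicFactor (p := p) 1 [-1] (1 : Ω) where
  prim := IsPrimitiveRoot.one
  len := by
    rw [List.length_singleton, Subsingleton.elim ((p : ℕ) : ZMod 1) 1, orderOf_one]
  root := by simp [hev]

theorem cyclotomicFactor_spec {w s : ℕ} (rounds : ℕ) (hs : 0 < s)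
    (hws : ∀ ℓ, ℓ.Prime → ℓ ∣ s → ℓ + 1 ≤ w) (hps : p.Coprime s) (h3 : p = 2 → 3 ∣ s)
    (hwn : (p ^ orderOf (p : ZMod s)).size ≤ w) :
    (∀ fY', (cyclotomicFactor p rounds s).CanReturn fY' →
      ∃ y' : Ω, IsCyclotomicFactor s fY' y') ∧
    (cyclotomicFactor p rounds s).expectedOps ≤
      (s.primeFactorsList.length * (924 * w ^ 6) : ℕ) ∧
    (cyclotomicFactor p rounds s).cutOffProb ≤
      s.primeFactorsList.length * (2 ^ w * (15 / 16) ^ rounds) := by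
  have hprod : 1 * s.primeFactorsList.prod = s := by
    rw [one_mul, Nat.prod_primeFactorsList hs.ne']
  have := adjoinAll_spec (w := w) rounds s.primeFactorsList
    (isCyclotomicFactor_one (p := p) (Ω := Ω)) one_pos
    (fun ℓ hℓ => ⟨Nat.prime_of_mem_primeFactorsList hℓ,
      hws ℓ (Nat.prime_of_mem_primeFactorsList hℓ) (Nat.dvd_of_mem_primeFactorsList hℓ)⟩)
    (by rw [hprod]; exact hps) (fun hp2 => Or.inr ?_) (by rw [hprod]; exact hwn)
  · rw [hprod] at this
    exact this
  · have h3s := h3 hp2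
    have hs1 : s ≠ 1 := by rintro rfl; norm_num at h3s
    obtain ⟨k, rfl⟩ : ∃ k, s = k + 2 := ⟨s - 2, by omega⟩
    have h2 : ¬ 2 ∣ k + 2 := by
      rw [hp2] at hps
      exact (Nat.Prime.coprime_iff_not_dvd Nat.prime_two).1 hps
    -- For `p = 2` the length is odd and divisible by 3; the increasing order of the prime factors
    -- puts 3 first.
    have hmin : (k + 2).minFac = 3 := by
      have h4 := Nat.minFac_le_of_dvd (by norm_num) h3s
      have h5 := (Nat.minFac_prime hs1).two_le
      have h6 := Nat.minFac_dvd (k + 2)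
      interval_cases hm : (k + 2).minFac
      · exact absurd h6 h2
      · rfl
    rw [Nat.primeFactorsList, hmin]
    rfl

end Adjoin

/-! ### Coordinates in `S[X]/(g)` -/

section Coordinates

variable {S : Type} [CommRing S] {f : List S} {g : S[X]}

/-- The element of `S[X]/(g)` with the given coordinates, highest degree first. -/
noncomputable def quotVal (g : S[X]) (l : List S) : AdjoinRoot g :=
  hev (AdjoinRoot.of g) (AdjoinRoot.root g) l

theorem quotVal_eq_mk (l : List S) : quotVal g l = AdjoinRoot.mk g (lp id l) := by
  rw [lp, map_hev]
  rfl

theorem lift_quotVal {T : Type*} [CommRing T] (σ : S →+* T) {t : T} (ht : g.eval₂ σ t = 0)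
    (l : List S) : AdjoinRoot.lift σ t ht (quotVal g l) = hev σ t l := by
  rw [quotVal, map_hev]
  simp

theorem eval₂_mp {T : Type*} [CommRing T] (σ : S →+* T) (t : T) (l : List S) :
    (mp id l).eval₂ σ t = t ^ l.length + hev σ t l := by
  rw [eval₂_eq_eval_map, map_mp, eval_mp]
  rfl

theorem root_pow_add (hg : g = mp id f) :
    AdjoinRoot.root g ^ f.length + hev (AdjoinRoot.of g) (AdjoinRoot.root g) f = 0 := by
  rw [← eval₂_mp, ← hg, AdjoinRoot.eval₂_root]

theorem quotVal_models (hg : g = mp id f) (hd : 0 < f.length) :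
    ((Arith.base S).quot f).Models (fun l => l.length = f.length) (quotVal g)
      (4 * f.length ^ 2) := by
  have := (Arith.models_base (AdjoinRoot.of g)).quot (f := f) (fun _ _ => trivial) hd
    (root_pow_add hg)
  simp only [implies_true, and_true, mul_one] at this
  exact this

theorem quotVal_gen (hg : g = mp id f) (hd : 0 < f.length) :
    ((Arith.base S).gen f).val.length = f.length ∧
      quotVal g ((Arith.base S).gen f).val = AdjoinRoot.root g ∧
      ((Arith.base S).gen f).ops ≤ f.length * 2 := by
  obtain ⟨h1, h2, h3⟩ := (Arith.models_base (AdjoinRoot.of g)).gen_spec (f := f)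
    (fun _ _ => trivial) hd (root_pow_add hg)
  exact ⟨h1.1, h2, h3⟩

theorem quotVal_const (d : ℕ) (c : S) :
    quotVal g ((Arith.base S).const d c) = AdjoinRoot.of g c :=
  (Arith.models_base (AdjoinRoot.of g)).hev_const _ d

theorem quotVal_map_mul (c : S) (l : List S) :
    quotVal g (l.map fun x => c * x) = AdjoinRoot.of g c * quotVal g l := by
  induction l with
  | nil => simp [quotVal]
  | cons x l ih =>
    simp only [quotVal] at ih ⊢
    rw [List.map_cons, hev_cons, ih, hev_cons, List.length_map, map_mul]
    ring

theorem quotVal_zipWith_sub {l m : List S} (h : l.length = m.length) :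
    quotVal g (List.zipWith (· - ·) l m) = quotVal g l - quotVal g m := by
  rw [quotVal, hev_zipWith _ _ (-1) h]
  · rw [quotVal, quotVal]; ring
  · intro a _ b _
    rw [map_sub]; ring

theorem quotVal_injOn [Nontrivial S] (hg : g = mp id f) {l m : List S} (hl : l.length = f.length)
    (hm : m.length = f.length) (h : quotVal g l = quotVal g m) : l = m := by
  refine lp_injOn (id : S → S) (V := fun _ => True) (fun _ _ _ _ h => h) (fun _ _ => trivial)
    (fun _ _ => trivial) (hl.trans hm.symm) ?_
  rw [quotVal_eq_mk, quotVal_eq_mk, ← sub_eq_zero, ← map_sub, AdjoinRoot.mk_eq_zero] at h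
  by_contra hne
  have hmon : g.Monic := hg ▸ mp_monic id f
  refine hmon.not_dvd_of_degree_lt (sub_ne_zero.2 hne) ?_ h
  rw [degree_eq_natDegree hmon.ne_zero, hg, natDegree_mp]
  refine (degree_sub_le _ _).trans_lt (max_lt ?_ ?_)
  · rw [← hl]; exact degree_lp_lt id l
  · rw [← hm]; exact degree_lp_lt id m

theorem quotVal_surjective (hg : g = mp id f) (hd : 0 < f.length) (x : AdjoinRoot g) :
    ∃ l : List S, l.length = f.length ∧ quotVal g l = x := by
  have hq := quotVal_models hg hd
  induction x using AdjoinRoot.induction_on with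
  | ih P =>
    induction P using Polynomial.induction_on' with
    | add P Q hP hQ =>
      obtain ⟨l, hl, hl'⟩ := hP
      obtain ⟨m, hm, hm'⟩ := hQ
      exact ⟨_, hq.add_valid hl hm, by rw [hq.map_add hl hm, hl', hm', map_add]⟩
    | monomial n c =>
      obtain ⟨h1, h2, -⟩ := quotVal_gen hg hd
      have hc : ((Arith.base S).const f.length c).length = f.length :=
        Arith.Models.const_length hd
      refine ⟨_, hq.mul_valid hc (hq.pow_valid h1 n), ?_⟩
      rw [hq.map_mul hc (hq.pow_valid h1 n), hq.map_pow h1, h2, quotVal_const,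
        ← C_mul_X_pow_eq_monomial, map_mul, map_pow, AdjoinRoot.mk_C, AdjoinRoot.mk_X]

theorem dvd_quotVal_sub {c : S} {l m : List S} (h : List.Forall₂ (fun a b => c ∣ a - b) l m) :
    AdjoinRoot.of g c ∣ quotVal g l - quotVal g m := by
  induction h with
  | nil => simp [quotVal]
  | @cons a b l m hab hlm ih =>
    rw [quotVal, quotVal, hev_cons, hev_cons, hlm.length_eq]
    have h1 : AdjoinRoot.of g c ∣ AdjoinRoot.of g a - AdjoinRoot.of g b := by
      rw [← map_sub]; exact map_dvd _ hab
    have h2 := dvd_add (h1.mul_right (AdjoinRoot.root g ^ m.length)) ih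
    rw [quotVal, quotVal] at h2
    convert h2 using 1
    ring

theorem forall₂_of_zipWith_sub {P : S → Prop} {l m n : List S} (hlm : l.length = m.length)
    (h : List.zipWith (· - ·) l m = n) (hn : ∀ x ∈ n, P x) :
    List.Forall₂ (fun a b => P (a - b)) l m := by
  induction l generalizing m n with
  | nil =>
    cases m with
    | nil => exact List.Forall₂.nil
    | cons b m => simp at hlm
  | cons a l ih =>
    cases m with
    | nil => simp at hlm
    | cons b m =>
      subst h
      exact List.Forall₂.cons (hn _ (by simp))
        (ih (by simpa using hlm) rfl fun x hx => hn x (by simp [hx]))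

/-- Multiplication by a constant acts coordinatewise and coordinates are unique. Congruences in
`S[X]/(g)` can therefore be tested on coordinates, where limits are taken. -/
theorem forall₂_dvd_of_dvd [Nontrivial S] (hg : g = mp id f) (hd : 0 < f.length) {c : S}
    {l m : List S} (hl : l.length = f.length) (hm : m.length = f.length)
    (h : AdjoinRoot.of g c ∣ quotVal g l - quotVal g m) :
    List.Forall₂ (fun a b => c ∣ a - b) l m := by
  obtain ⟨u, hu⟩ := h
  obtain ⟨n, hn, rfl⟩ := quotVal_surjective hg hd u
  rw [← quotVal_map_mul, ← quotVal_zipWith_sub (hl.trans hm.symm)] at hu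
  have := quotVal_injOn hg (by simp [hl, hm]) (by simpa using hn) hu
  refine forall₂_of_zipWith_sub (P := fun x => c ∣ x) (hl.trans hm.symm) this fun x hx => ?_
  obtain ⟨z, -, rfl⟩ := List.mem_map.1 hx
  exact Dvd.intro _ rfl

end Coordinates

/-! ### Lifting to the `p`-adic integers -/

section Lifting

variable {p : ℕ} [Fact p.Prime] {Ω : Type*} [Field Ω] [Algebra (ZMod p) Ω] [CharP Ω p]
  {s : ℕ} {fY : List (ZMod p)} {y : Ω}

theorem IsCyclotomicFactor.pos (h : IsCyclotomicFactor s fY y) (hs : 0 < s) (hps : p.Coprime s) :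
    0 < fY.length := by
  rw [h.len]; exact orderOf_natCast_pos hs hps

/-- Evaluation at `y` embeds 𝔽_p[X]/(fY) into the field `Ω`, since it separates coordinate lists; so
the quotient is a domain. -/
theorem IsCyclotomicFactor.irreducible (h : IsCyclotomicFactor s fY y) (hs : 0 < s)
    (hps : p.Coprime s) : Irreducible (mp id fY : (ZMod p)[X]) := by
  have hd := h.pos hs hps
  have hF := h.modelsField hs hps
  set σ := AdjoinRoot.lift (f := mp id fY) (algebraMap (ZMod p) Ω) y
    ((eval₂_mp _ _ _).trans h.root) with hσ
  have hinj : Function.Injective σ := by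
    intro x x' hxx
    obtain ⟨l, hl, rfl⟩ := quotVal_surjective rfl hd x
    obtain ⟨m, hm, rfl⟩ := quotVal_surjective rfl hd x'
    rw [hσ, lift_quotVal, lift_quotVal] at hxx
    rw [hF.inj l m hl hm hxx]
  have hdom : IsDomain (AdjoinRoot (mp id fY : (ZMod p)[X])) := hinj.isDomain σ
  have hprime : (Ideal.span {(mp id fY : (ZMod p)[X])}).IsPrime :=
    (Ideal.Quotient.isDomain_iff_prime _).1 hdom
  exact ((Ideal.span_singleton_prime (mp_monic _ _).ne_zero).1 hprime).irreducible

/-- The coefficients of `fY` lifted to `{0, …, p - 1}`. -/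
noncomputable def liftCoeffs (fY : List (ZMod p)) : List ℤ_[p] :=
  fY.map fun c => (c.val : ℤ_[p])

theorem length_liftCoeffs : (liftCoeffs fY).length = fY.length := by simp [liftCoeffs]

theorem map_toZMod_liftCoeffs : (liftCoeffs fY).map PadicInt.toZMod = fY := by
  rw [liftCoeffs, List.map_map]
  conv_rhs => rw [← List.map_id fY]
  refine List.map_congr_left fun c _ => ?_
  simp

theorem map_mp_liftCoeffs :
    (mp id (liftCoeffs fY)).map (PadicInt.toZMod (p := p)) = mp id fY := by
  rw [map_mp, mp, mp, length_liftCoeffs]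
  congr 1
  conv_rhs => rw [← map_toZMod_liftCoeffs (fY := fY)]
  rw [lp, lp, hev_map]
  rfl

theorem IsCyclotomicFactor.irreducible_lift (h : IsCyclotomicFactor s fY y) (hs : 0 < s)
    (hps : p.Coprime s) : Irreducible (mp id (liftCoeffs fY)) := by
  refine (mp_monic _ _).irreducible_of_irreducible_map (PadicInt.toZMod (p := p)) _ ?_
  rw [map_mp_liftCoeffs]
  exact h.irreducible hs hps

theorem IsCyclotomicFactor.root_lift (h : IsCyclotomicFactor s fY y) :
    (mp id (liftCoeffs fY)).eval₂ ((algebraMap (ZMod p) Ω).comp PadicInt.toZMod) y = 0 := by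
  rw [← eval₂_map, map_mp_liftCoeffs, eval₂_mp, h.root]

/-- The reduction of `ℤ_p[X]/(F)` modulo `p`, as a subfield of `Ω`. -/
noncomputable def IsCyclotomicFactor.reduction (h : IsCyclotomicFactor s fY y) :
    AdjoinRoot (mp id (liftCoeffs fY)) →+* Ω :=
  AdjoinRoot.lift ((algebraMap (ZMod p) Ω).comp PadicInt.toZMod) y h.root_lift

theorem IsCyclotomicFactor.reduction_root (h : IsCyclotomicFactor s fY y) :
    h.reduction (AdjoinRoot.root _) = y :=
  AdjoinRoot.lift_root _

theorem toZMod_eq_zero_iff {c : ℤ_[p]} : PadicInt.toZMod c = 0 ↔ (p : ℤ_[p]) ∣ c := by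
  rw [← RingHom.mem_ker, PadicInt.ker_toZMod, PadicInt.maximalIdeal_eq_span_p,
    Ideal.mem_span_singleton]

/-- Coordinates reduced modulo `p` are determined by the value at `y`, so an element with zero
reduction has all its coordinates divisible by `p`. -/
theorem IsCyclotomicFactor.reduction_eq_zero_iff (h : IsCyclotomicFactor s fY y) (hs : 0 < s)
    (hps : p.Coprime s) (x : AdjoinRoot (mp id (liftCoeffs fY))) :
    h.reduction x = 0 ↔ AdjoinRoot.of _ (p : ℤ_[p]) ∣ x := by
  have hd := h.pos hs hps
  constructor
  · intro hx
    obtain ⟨l, hl, rfl⟩ := quotVal_surjective rfl (by rwa [length_liftCoeffs]) x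
    rw [length_liftCoeffs] at hl
    rw [IsCyclotomicFactor.reduction, lift_quotVal] at hx
    have hx' : hev (algebraMap (ZMod p) Ω) y (l.map PadicInt.toZMod) = 0 := by
      rw [hev_map]; exact hx
    have h0 : hev (algebraMap (ZMod p) Ω) y (List.replicate fY.length 0) = 0 :=
      hev_eq_zero _ _ fun c hc => by rw [List.eq_of_mem_replicate hc, map_zero]
    have := (h.modelsField hs hps).inj _ _ (by simpa using hl) (by simp) (hx'.trans h0.symm)
    have hz : quotVal (mp id (liftCoeffs fY)) (List.replicate l.length 0) = 0 :=
      hev_eq_zero _ _ fun c hc => by rw [List.eq_of_mem_replicate hc, map_zero]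
    rw [← sub_zero (quotVal _ l), ← hz]
    refine dvd_quotVal_sub ?_
    rw [← hl, ← List.map_const', List.map_inj_left] at this
    rw [← List.map_const', List.forall₂_map_right_iff, List.forall₂_same]
    intro c hc
    rw [sub_zero, ← toZMod_eq_zero_iff]
    exact this c hc
  · rintro ⟨u, rfl⟩
    rw [map_mul]
    have : h.reduction (AdjoinRoot.of _ (p : ℤ_[p])) = 0 := by
      rw [IsCyclotomicFactor.reduction, AdjoinRoot.lift_of]
      simp
    rw [this, zero_mul]

end Lifting

/-! ### Newton's iteration for roots of unity -/

section Newton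

/-- Newton's correction divides `α ^ s - 1` by `s * α ^ (s - 1)`; here `α * (2 - α ^ s)` replaces `α
/ α ^ s`, because `2 - t` inverts `t = 1 + π * v` modulo `π ^ 2`. -/
theorem newton_dvd {R : Type*} [CommRing R] {s : ℕ} {s' π α α' : R} (hs : (s : R) * s' = 1)
    (hα : π ∣ α ^ s - 1) (h : α' = α - s' * ((α ^ s - 1) * α * (2 - α ^ s))) :
    π ∣ α' - α ∧ π ^ 2 ∣ α' ^ s - 1 := by
  obtain ⟨v, hv⟩ := hα
  have ht : α ^ s = 1 + π * v := by rw [← hv]; ring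
  refine ⟨⟨-(s' * v * α * (2 - α ^ s)), by rw [h, hv]; ring⟩, ?_⟩
  set x := -(s' * (π * v) * (1 - π * v)) with hx
  have h' : α' = α * (1 + x) := by rw [h, hx, ht]; ring
  obtain ⟨k, hk⟩ := Polynomial.powAddExpansion 1 x s
  -- Since `s * x = -π * v * (1 - π * v)`, the product `(1 + π * v) * (1 + s * x)` is `1 + π ^ 3 * v
  -- ^ 3`; the term `k * x ^ 2` of the expansion is divisible by `π ^ 2`.
  refine ⟨k * (1 + π * v) * (s' * v * (1 - π * v)) ^ 2 + π * v ^ 3, ?_⟩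
  rw [h', mul_pow, hk, ht, hx]
  simp only [one_pow, mul_one]
  linear_combination (-(1 + π * v) * (π * v) * (1 - π * v)) * hs

variable {p : ℕ} [Fact p.Prime] {F : List ℤ_[p]} {s : ℕ} {sInv : ℤ_[p]}

theorem newtonStep_spec (hF : 0 < F.length) (hs : (s : ℤ_[p]) * sInv = 1) {k : ℕ}
    {α : List ℤ_[p]} (hα : α.length = F.length)
    (h : AdjoinRoot.of (mp id F) ((p : ℤ_[p]) ^ k) ∣ quotVal (mp id F) α ^ s - 1) :
    (newtonStep p F s sInv (2 * k) α).val.length = F.length ∧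
      AdjoinRoot.of (mp id F) ((p : ℤ_[p]) ^ k) ∣
        quotVal (mp id F) (newtonStep p F s sInv (2 * k) α).val - quotVal (mp id F) α ∧
      AdjoinRoot.of (mp id F) ((p : ℤ_[p]) ^ (2 * k)) ∣
        quotVal (mp id F) (newtonStep p F s sInv (2 * k) α).val ^ s - 1 := by
  have hq := quotVal_models (g := mp id F) rfl hF
  have hc : ((Arith.base ℤ_[p]).const F.length 2).length = F.length :=
    Arith.Models.const_length hF
  have ht := hq.pow_valid hα s
  have hu := hq.sub_valid ht hq.one_valid
  have hv := hq.sub_valid hc ht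
  have hw := hq.mul_valid hu hα
  have hx := hq.mul_valid hw hv
  set A := (Arith.base ℤ_[p]).quot F
  set x := (A.mul (A.mul (A.sub (A.pow α s).val A.one).val α).val
    (A.sub ((Arith.base ℤ_[p]).const F.length 2) (A.pow α s).val).val).val with hxdef
  have hy : (x.map fun c => sInv * c).length = F.length := by simpa using hx
  set z := (A.sub α (x.map fun c => sInv * c)).val with hzdef
  have hz : z.length = F.length := hq.sub_valid hα hy
  have hval : (newtonStep p F s sInv (2 * k) α).val =
      z.map fun c : ℤ_[p] => (c.appr (2 * k) : ℤ_[p]) := by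
    simp only [newtonStep, Counted.val_bind, mapList_val]
    rfl
  have hzv : quotVal (mp id F) z = quotVal (mp id F) α - AdjoinRoot.of (mp id F) sInv *
      ((quotVal (mp id F) α ^ s - 1) * quotVal (mp id F) α *
        (2 - quotVal (mp id F) α ^ s)) := by
    rw [hzdef, hq.map_sub hα hy, quotVal_map_mul, hxdef, hq.map_mul hw hv, hq.map_mul hu hα,
      hq.map_sub ht hq.one_valid, hq.map_sub hc ht, hq.map_pow hα, hq.map_one, quotVal_const,
      map_ofNat]
  have hs' : (s : AdjoinRoot (mp id F)) * AdjoinRoot.of (mp id F) sInv = 1 := by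
    rw [← map_natCast (AdjoinRoot.of (mp id F)), ← map_mul, hs, map_one]
  obtain ⟨h1, h2⟩ := newton_dvd hs' h hzv
  -- Truncation after the step changes the coordinates only modulo the new precision.
  have happr : AdjoinRoot.of (mp id F) ((p : ℤ_[p]) ^ (2 * k)) ∣
      quotVal (mp id F) (newtonStep p F s sInv (2 * k) α).val - quotVal (mp id F) z := by
    rw [hval]
    refine dvd_quotVal_sub ?_
    rw [List.forall₂_map_left_iff, List.forall₂_same]
    intro c _
    rw [← neg_sub, dvd_neg, ← Ideal.mem_span_singleton]
    exact PadicInt.appr_spec _ _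
  refine ⟨by rw [hval, List.length_map, hz], ?_, ?_⟩
  · refine (dvd_add (dvd_trans (_root_.map_dvd _ (pow_dvd_pow _ (by omega))) happr) h1).trans
      (dvd_of_eq ?_)
    ring
  · rw [← map_pow, ← pow_mul, mul_comm k 2] at h2
    refine (dvd_add (happr.trans (sub_dvd_pow_sub_pow _ _ s)) h2).trans (dvd_of_eq ?_)
    ring

theorem newtonStep_ops (hF : 0 < F.length) {k : ℕ} {α : List ℤ_[p]} (hα : α.length = F.length) :
    (newtonStep p F s sInv k α).ops ≤
      (2 * s.size + 5) * (4 * F.length ^ 2) + 2 * F.length := by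
  have hq := quotVal_models (g := mp id F) rfl hF
  have hc : ((Arith.base ℤ_[p]).const F.length 2).length = F.length :=
    Arith.Models.const_length hF
  have ht := hq.pow_valid hα s
  have hu := hq.sub_valid ht hq.one_valid
  have hv := hq.sub_valid hc ht
  have hw := hq.mul_valid hu hα
  have hx := hq.mul_valid hw hv
  have hmap : ∀ (c : ℕ) (h : ℤ_[p] → Counted ℤ_[p]), (∀ a, (h a).ops ≤ c) →
      ∀ l : List ℤ_[p], l.length = F.length → (mapList h l).ops ≤ F.length * c := by
    intro c h hh l hl
    rw [← hl]
    exact mapList_ops_le fun a _ => hh a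
  simp only [newtonStep, Counted.ops_bind, mapList_val]
  have e : (2 * s.size + 5) * (4 * F.length ^ 2) + 2 * F.length = 2 * s.size * (4 * F.length ^ 2) +
      (4 * F.length ^ 2 + (4 * F.length ^ 2 + (4 * F.length ^ 2 + (4 * F.length ^ 2 +
        (F.length * 1 + (4 * F.length ^ 2 + F.length * 1)))))) := by ring
  rw [e]
  have hy : ∀ h : ℤ_[p] → ℤ_[p], ∀ l : List ℤ_[p], l.length = F.length →
      (l.map h).length = F.length := fun h l hl => by rw [List.length_map, hl]
  refine add_le_add (hq.pow_ops hα s) ?_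
  refine add_le_add (hq.sub_ops ht hq.one_valid) ?_
  refine add_le_add (hq.sub_ops hc ht) ?_
  refine add_le_add (hq.mul_ops hu hα) ?_
  refine add_le_add (hq.mul_ops hw hv) ?_
  refine add_le_add (hmap 1 _ (fun _ => Nat.le_refl 1) _ hx) ?_
  refine add_le_add (hq.sub_ops hα (hy _ _ hx)) ?_
  refine hmap 1 _ (fun _ => Nat.le_refl 1) _ ?_
  exact hq.sub_valid hα (hy _ _ hx)

/-- The recursion splits off the first step, whereas induction on the precision needs the last one.
-/
theorem newtonSteps_succ (i n : ℕ) (α : List ℤ_[p]) :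
    (newtonSteps p F s sInv i (n + 1) α).val =
        (newtonStep p F s sInv (2 ^ (i + n)) (newtonSteps p F s sInv i n α).val).val ∧
      (newtonSteps p F s sInv i (n + 1) α).ops = (newtonSteps p F s sInv i n α).ops +
        (newtonStep p F s sInv (2 ^ (i + n)) (newtonSteps p F s sInv i n α).val).ops := by
  induction n generalizing i α with
  | zero => simp [newtonSteps]
  | succ n ih =>
    obtain ⟨h1, h2⟩ := ih (i + 1) (newtonStep p F s sInv (2 ^ i) α).val
    have hi : i + 1 + n = i + (n + 1) := by ring
    rw [hi] at h1 h2
    rw [newtonSteps]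
    simp only [Counted.val_bind, Counted.ops_bind]
    rw [h1, h2]
    refine ⟨by simp [newtonSteps], by simp [newtonSteps, add_assoc]⟩

theorem newtonSteps_spec (hF : 0 < F.length) (hs : (s : ℤ_[p]) * sInv = 1) {α : List ℤ_[p]}
    (hα : α.length = F.length)
    (h : AdjoinRoot.of (mp id F) (p : ℤ_[p]) ∣ quotVal (mp id F) α ^ s - 1) (n : ℕ) :
    (newtonSteps p F s sInv 1 n α).val.length = F.length ∧
      AdjoinRoot.of (mp id F) ((p : ℤ_[p]) ^ 2 ^ n) ∣
        quotVal (mp id F) (newtonSteps p F s sInv 1 n α).val ^ s - 1 ∧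
      (newtonSteps p F s sInv 1 n α).ops ≤
        n * ((2 * s.size + 5) * (4 * F.length ^ 2) + 2 * F.length) := by
  induction n with
  | zero => simpa [newtonSteps] using ⟨hα, h⟩
  | succ n ih =>
    obtain ⟨h1, h2, h3⟩ := ih
    obtain ⟨e1, e2⟩ := newtonSteps_succ (F := F) (s := s) (sInv := sInv) 1 n α
    have hpow : 2 ^ (1 + n) = 2 * 2 ^ n := by ring
    obtain ⟨g1, -, g3⟩ := newtonStep_spec hF hs h1 h2
    rw [e1, e2, pow_succ' 2 n, hpow]
    refine ⟨g1, g3, ?_⟩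
    have := newtonStep_ops (s := s) (sInv := sInv) hF (k := 2 * 2 ^ n) h1
    rw [add_mul, one_mul]
    exact add_le_add h3 this

theorem newtonSteps_dvd (hF : 0 < F.length) (hs : (s : ℤ_[p]) * sInv = 1) {α : List ℤ_[p]}
    (hα : α.length = F.length)
    (h : AdjoinRoot.of (mp id F) (p : ℤ_[p]) ∣ quotVal (mp id F) α ^ s - 1) (n : ℕ) :
    List.Forall₂ (fun a b => (p : ℤ_[p]) ^ 2 ^ n ∣ a - b)
      (newtonSteps p F s sInv 1 (n + 1) α).val (newtonSteps p F s sInv 1 n α).val := by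
  obtain ⟨h1, h2, -⟩ := newtonSteps_spec hF hs hα h n
  obtain ⟨h1', -, -⟩ := newtonSteps_spec hF hs hα h (n + 1)
  refine forall₂_dvd_of_dvd rfl hF h1' h1 ?_
  have hpow : 2 ^ (1 + n) = 2 * 2 ^ n := by ring
  rw [(newtonSteps_succ 1 n α).1, hpow]
  exact (newtonStep_spec hF hs h1 h2).2.1

theorem exists_limit {c : ℕ → ℤ_[p]} (h : ∀ n, (p : ℤ_[p]) ^ 2 ^ n ∣ c (n + 1) - c n) :
    ∃ L, ∀ n, (p : ℤ_[p]) ^ 2 ^ n ∣ c n - L := by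
  have h' : ∀ m n, m ≤ n → (p : ℤ_[p]) ^ 2 ^ m ∣ c n - c m := by
    intro m n hmn
    induction n, hmn using Nat.le_induction with
    | base => simp
    | succ n hmn ih =>
      have := dvd_add (dvd_trans (pow_dvd_pow _ (Nat.pow_le_pow_right two_pos hmn)) (h n)) ih
      simpa using this
  have hmem : ∀ (n : ℕ) (x : ℤ_[p]), (p : ℤ_[p]) ^ n ∣ x ↔
      x ∈ (IsLocalRing.maximalIdeal ℤ_[p] ^ n • ⊤ : Ideal ℤ_[p]) := by
    intro n x
    rw [PadicInt.maximalIdeal_eq_span_p, Ideal.span_singleton_pow, smul_eq_mul, Ideal.mul_top,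
      Ideal.mem_span_singleton]
  obtain ⟨L, hL⟩ := IsPrecomplete.prec (I := IsLocalRing.maximalIdeal ℤ_[p])
    (inferInstance : IsPrecomplete (IsLocalRing.maximalIdeal ℤ_[p]) ℤ_[p]) (f := c) (by
      intro m n hmn
      rw [SModEq.comm, SModEq.sub_mem, ← hmem]
      exact dvd_trans (pow_dvd_pow _ Nat.lt_two_pow_self.le) (h' m n hmn))
  refine ⟨L, fun n => ?_⟩
  -- Completeness is used with the modulus `p ^ n` at index `n`; going to index `2 ^ n` recovers the
  -- modulus `p ^ 2 ^ n`.
  have h1 := hL (2 ^ n)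
  rw [SModEq.sub_mem, ← hmem] at h1
  have h2 := dvd_sub h1 (h' n (2 ^ n) Nat.lt_two_pow_self.le)
  convert h2 using 1
  ring

theorem exists_limit_list {d : ℕ} {a : ℕ → List ℤ_[p]} (ha : ∀ n, (a n).length = d)
    (h : ∀ n, List.Forall₂ (fun x y => (p : ℤ_[p]) ^ 2 ^ n ∣ x - y) (a (n + 1)) (a n)) :
    ∃ z : List ℤ_[p], z.length = d ∧
      ∀ n, List.Forall₂ (fun x y => (p : ℤ_[p]) ^ 2 ^ n ∣ x - y) (a n) z := by
  have key : ∀ i, ∃ L, ∀ n, (p : ℤ_[p]) ^ 2 ^ n ∣ (a n).getD i 0 - L := fun i =>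
    exists_limit fun n => by
      have := Arith.forall₂_getD (h n) (by simp : (p : ℤ_[p]) ^ 2 ^ n ∣ 0 - 0) i
      simpa using this
  choose L hL using key
  refine ⟨(List.range d).map L, by simp, fun n => ?_⟩
  rw [List.forall₂_iff_get]
  refine ⟨by simp [ha], fun i h1 h2 => ?_⟩
  have := hL i n
  rw [List.getD_eq_getElem _ _ h1] at this
  simpa using this

theorem eq_zero_of_forall_dvd {x : ℤ_[p]} (h : ∀ n, (p : ℤ_[p]) ^ 2 ^ n ∣ x) : x = 0 := by
  by_contra hx
  have h1 := h x.valuation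
  rw [← Ideal.mem_span_singleton, PadicInt.mem_span_pow_iff_le_valuation x hx] at h1
  exact absurd h1 (not_le.2 Nat.lt_two_pow_self)

end Newton

/-! ### From `ℤ_p[X]/(F)` to `ℚ_p[X]/(F)` -/

section Padic

variable {p : ℕ} [Fact p.Prime]

/-- One limit `z` of the Newton iterates serves all precisions `n`. It reduces to `y`, so an
exponent killing it kills `y` and is a multiple of `s`. -/
theorem IsCyclotomicFactor.exists_root {Ω : Type*} [Field Ω] [Algebra (ZMod p) Ω] [CharP Ω p]
    {s : ℕ} {fY : List (ZMod p)} {y : Ω} (h : IsCyclotomicFactor s fY y) (hs : 0 < s)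
    (hps : p.Coprime s) :
    ∃ z : List ℤ_[p], z.length = fY.length ∧
      IsPrimitiveRoot (quotVal (mp id (liftCoeffs fY)) z) s ∧
      h.reduction (quotVal (mp id (liftCoeffs fY)) z) = y ∧
      ∀ n, (liftRoot p (liftCoeffs fY) s n).val.length = fY.length ∧
        List.Forall₂ (fun a b => (p : ℤ_[p]) ^ 2 ^ n ∣ a - b)
          (liftRoot p (liftCoeffs fY) s n).val z ∧
        (liftRoot p (liftCoeffs fY) s n).ops ≤ 1 + (fY.length * 2 +
          n * ((2 * s.size + 5) * (4 * fY.length ^ 2) + 2 * fY.length)) := by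
  have hF : 0 < (liftCoeffs fY).length := by rw [length_liftCoeffs]; exact h.pos hs hps
  obtain ⟨g1, g2, g3⟩ := quotVal_gen (g := mp id (liftCoeffs fY)) rfl hF
  have hinv : (s : ℤ_[p]) * (s : ℤ_[p]).inv = 1 :=
    PadicInt.mul_inv (PadicInt.norm_natCast_eq_one_iff.2 hps)
  have h0 : AdjoinRoot.of (mp id (liftCoeffs fY)) (p : ℤ_[p]) ∣
      quotVal (mp id (liftCoeffs fY)) ((Arith.base ℤ_[p]).gen (liftCoeffs fY)).val ^ s - 1 := by
    rw [← h.reduction_eq_zero_iff hs hps, g2, map_sub, map_pow, h.reduction_root, map_one,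
      h.prim.pow_eq_one, sub_self]
  obtain ⟨z, hz, hlim⟩ := exists_limit_list
    (fun n => (newtonSteps_spec hF hinv g1 h0 n).1) (newtonSteps_dvd hF hinv g1 h0)
  set Z := quotVal (mp id (liftCoeffs fY)) z with hZ
  -- Each coordinate of `Z ^ s - 1` is divisible by `p ^ 2 ^ n` for all `n`, hence zero.
  have hone : Z ^ s = 1 := by
    have hq := quotVal_models (g := mp id (liftCoeffs fY)) rfl hF
    have hzs := hq.pow_valid hz s
    have key : ∀ n, List.Forall₂ (fun a b => (p : ℤ_[p]) ^ 2 ^ n ∣ a - b)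
        (((Arith.base ℤ_[p]).quot (liftCoeffs fY)).pow z s).val
        ((Arith.base ℤ_[p]).quot (liftCoeffs fY)).one := by
      intro n
      refine forall₂_dvd_of_dvd rfl hF hzs hq.one_valid ?_
      rw [hq.map_pow hz, hq.map_one]
      have h1 := (newtonSteps_spec hF hinv g1 h0 n).2.1
      have h2 := (dvd_quotVal_sub (g := mp id (liftCoeffs fY)) (hlim n)).trans
        (sub_dvd_pow_sub_pow _ _ s)
      have h3 := dvd_sub h1 h2
      convert h3 using 1
      ring
    have heq : (((Arith.base ℤ_[p]).quot (liftCoeffs fY)).pow z s).val =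
        ((Arith.base ℤ_[p]).quot (liftCoeffs fY)).one := by
      refine List.ext_get (hzs.trans hq.one_valid.symm) fun i h1 h2 => ?_
      rw [← sub_eq_zero]
      exact eq_zero_of_forall_dvd fun n => (key n).get h1 h2
    rw [hZ, ← hq.map_pow hz, heq, hq.map_one]
  have hred : h.reduction Z = y := by
    have h1 := dvd_quotVal_sub (g := mp id (liftCoeffs fY)) (hlim 0)
    rw [pow_zero, pow_one, ← h.reduction_eq_zero_iff hs hps] at h1
    change h.reduction (quotVal _ ((Arith.base ℤ_[p]).gen (liftCoeffs fY)).val - Z) = 0 at h1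
    rw [g2, map_sub, h.reduction_root, sub_eq_zero] at h1
    exact h1.symm
  refine ⟨z, hz.trans length_liftCoeffs, ⟨hone, fun l hl => ?_⟩, hred, fun n => ?_⟩
  · refine h.prim.dvd_of_pow_eq_one l ?_
    rw [← hred, ← map_pow, hl, map_one]
  · obtain ⟨e1, -, e3⟩ := newtonSteps_spec hF hinv g1 h0 n
    refine ⟨e1.trans length_liftCoeffs, hlim n, ?_⟩
    rw [length_liftCoeffs] at e3 g3
    exact Nat.add_le_add le_rfl (Nat.add_le_add g3 e3)

theorem monicOf_eq (F : List ℚ_[p]) : monicOf p F = mp id F := by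
  change lp id (1 :: F) = _
  rw [lp_cons, mp]
  simp

theorem element_eq (F l : List ℚ_[p]) : element p F l = quotVal (monicOf p F) l :=
  (quotVal_eq_mk l).symm

/-- Coefficients in `ℤ_p`, seen in `ℚ_p`. -/
noncomputable def toPadic (l : List ℤ_[p]) : List ℚ_[p] := l.map fun c : ℤ_[p] => (c : ℚ_[p])

/-- The left-hand side is what the coercion of lists in `padicFFT` elaborates to. -/
theorem map_coe_eq_toPadic (l : List ℤ_[p]) :
    (List.map (fun c => c) do
      let a ← l
      pure (a : ℚ_[p])) = toPadic l := by
  simp [toPadic, List.map_eq_flatMap]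

theorem length_toPadic (l : List ℤ_[p]) : (toPadic l).length = l.length := by simp [toPadic]

theorem map_mp_coe (F : List ℤ_[p]) :
    (mp id F).map PadicInt.Coe.ringHom = monicOf p (toPadic F) := by
  rw [monicOf_eq, map_mp, mp, mp, length_toPadic, lp, lp, toPadic, hev_map]
  rfl

theorem irreducible_monicOf {F : List ℤ_[p]} (h : Irreducible (mp id F)) :
    Irreducible (monicOf p (toPadic F)) := by
  rw [← map_mp_coe]
  exact ((mp_monic id F).irreducible_iff_irreducible_map_fraction_map (K := ℚ_[p])).1 h

/-- The embedding of `ℤ_p[X]/(F)` into `ℚ_p[X]/(F)`. -/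
noncomputable def embed (F : List ℤ_[p]) :
    AdjoinRoot (mp id F) →+* AdjoinRoot (monicOf p (toPadic F)) :=
  AdjoinRoot.lift ((AdjoinRoot.of (monicOf p (toPadic F))).comp PadicInt.Coe.ringHom)
    (AdjoinRoot.root _) (by rw [← eval₂_map, map_mp_coe, AdjoinRoot.eval₂_root])

theorem embed_of (F : List ℤ_[p]) (c : ℤ_[p]) :
    embed F (AdjoinRoot.of _ c) = AdjoinRoot.of _ (c : ℚ_[p]) := AdjoinRoot.lift_of _

theorem embed_quotVal (F l : List ℤ_[p]) :
    embed F (quotVal _ l) = quotVal (monicOf p (toPadic F)) (toPadic l) := by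
  rw [embed, lift_quotVal]
  exact (hev_map (AdjoinRoot.of (monicOf p (toPadic F))) (AdjoinRoot.root _)
    (fun c : ℤ_[p] => (c : ℚ_[p])) l).symm

theorem embed_injective {F : List ℤ_[p]} (hF : 0 < F.length) : Function.Injective (embed F) := by
  intro a b hab
  obtain ⟨l, hl, rfl⟩ := quotVal_surjective rfl hF a
  obtain ⟨m, hm, rfl⟩ := quotVal_surjective rfl hF b
  rw [embed_quotVal, embed_quotVal] at hab
  have := quotVal_injOn (monicOf_eq _) (by simpa [toPadic] using hl) (by simpa [toPadic] using hm)
    hab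
  rw [List.map_injective_iff.2 Subtype.coe_injective this]

/-! ### Precision -/

/-- `x` is `c` times an integral element. -/
def MulInt (F : List ℤ_[p]) (c : ℚ_[p]) (x : AdjoinRoot (monicOf p (toPadic F))) : Prop :=
  ∃ r, x = AdjoinRoot.of _ c * embed F r

theorem MulInt.add {F : List ℤ_[p]} {c : ℚ_[p]} {x y : AdjoinRoot (monicOf p (toPadic F))}
    (hx : MulInt F c x) (hy : MulInt F c y) : MulInt F c (x + y) := by
  obtain ⟨r, rfl⟩ := hx
  obtain ⟨t, rfl⟩ := hy
  exact ⟨r + t, by rw [map_add, mul_add]⟩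

theorem MulInt.mul {F : List ℤ_[p]} {c c' : ℚ_[p]} {x y : AdjoinRoot (monicOf p (toPadic F))}
    (hx : MulInt F c x) (hy : MulInt F c' y) : MulInt F (c * c') (x * y) := by
  obtain ⟨r, rfl⟩ := hx
  obtain ⟨t, rfl⟩ := hy
  exact ⟨r * t, by rw [map_mul, map_mul]; ring⟩

theorem MulInt.zero {F : List ℤ_[p]} {c : ℚ_[p]} : MulInt F c 0 := ⟨0, by simp⟩

/-- `x` and `y` are in `c` times the integral elements, and are congruent modulo `c * c'`. -/
structure Near (F : List ℤ_[p]) (c c' : ℚ_[p]) (x y : AdjoinRoot (monicOf p (toPadic F))) :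
    Prop where
  left : MulInt F c x
  right : MulInt F c y
  diff : MulInt F (c * c') (x - y)

theorem Near.add {F : List ℤ_[p]} {c c' : ℚ_[p]} {x x' y y' : AdjoinRoot (monicOf p (toPadic F))}
    (hx : Near F c c' x x') (hy : Near F c c' y y') : Near F c c' (x + y) (x' + y') :=
  ⟨hx.left.add hy.left, hx.right.add hy.right, by
    rw [add_sub_add_comm]; exact hx.diff.add hy.diff⟩

/-- From `x * y - x' * y' = x * (y - y') + (x - x') * y'`. The factor `y` has scale 1, like the
powers of the root of unity, so the relative precision `c'` survives. -/
theorem Near.mul {F : List ℤ_[p]} {c c' : ℚ_[p]} {x x' y y' : AdjoinRoot (monicOf p (toPadic F))}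
    (hx : Near F c c' x x') (hy : Near F 1 c' y y') : Near F c c' (x * y) (x' * y') := by
  refine ⟨by simpa using hx.left.mul hy.left, by simpa using hx.right.mul hy.right, ?_⟩
  have h1 := hx.left.mul hy.diff
  have h2 := hx.diff.mul hy.right
  rw [one_mul] at h1
  rw [mul_one] at h2
  have := h1.add h2
  convert this using 1
  ring

theorem Near.refl {F : List ℤ_[p]} {c c' : ℚ_[p]} {x : AdjoinRoot (monicOf p (toPadic F))}
    (hx : MulInt F c x) : Near F c c' x x :=
  ⟨hx, hx, by rw [sub_self]; exact MulInt.zero⟩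

theorem close_of_mulInt {F : List ℤ_[p]} (hF : 0 < F.length) {c : ℚ_[p]} {l m : List ℚ_[p]}
    (hl : l.length = F.length) (hm : m.length = F.length)
    (h : MulInt F c (quotVal _ l - quotVal _ m)) {δ : ℝ} (hδ : ‖c‖ ≤ δ) : Close p δ l m := by
  obtain ⟨r, hr⟩ := h
  obtain ⟨n, hn, rfl⟩ := quotVal_surjective rfl hF r
  rw [embed_quotVal, ← quotVal_map_mul, ← quotVal_zipWith_sub (hl.trans hm.symm)] at hr
  have := quotVal_injOn (monicOf_eq _) (by simp [length_toPadic, hl, hm])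
    (by simpa [length_toPadic] using hn) hr
  refine forall₂_of_zipWith_sub (P := fun x => ‖x‖ ≤ δ) (hl.trans hm.symm) this fun x hx => ?_
  obtain ⟨y, hy, rfl⟩ := List.mem_map.1 hx
  obtain ⟨w, -, rfl⟩ := List.mem_map.1 hy
  rw [norm_mul]
  exact (mul_le_of_le_one_right (norm_nonneg _) (PadicInt.norm_le_one w)).trans hδ

theorem mulInt_of {F : List ℤ_[p]} {a c : ℚ_[p]} (h : ‖a‖ ≤ ‖c‖) :
    MulInt F c (AdjoinRoot.of _ a) := by
  rcases eq_or_ne c 0 with rfl | hc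
  · have : a = 0 := by simpa using h
    rw [this, map_zero]; exact MulInt.zero
  · have hn : ‖a / c‖ ≤ 1 := by
      rw [norm_div]; exact div_le_one_of_le₀ h (norm_nonneg _)
    obtain ⟨b, hb⟩ : ∃ b : ℤ_[p], (b : ℚ_[p]) = a / c := ⟨⟨a / c, hn⟩, rfl⟩
    refine ⟨AdjoinRoot.of _ b, ?_⟩
    rw [embed_of, ← map_mul, hb, mul_div_cancel₀ a hc]

theorem forall₂_imp_mem {α β : Type*} {P Q : α → β → Prop} {l : List α} {m : List β}
    (h : List.Forall₂ P l m) (hPQ : ∀ a ∈ l, ∀ b ∈ m, P a b → Q a b) : List.Forall₂ Q l m := by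
  induction h with
  | nil => exact .nil
  | cons h _ ih =>
    exact .cons (hPQ _ (by simp) _ (by simp) h)
      (ih fun a ha b hb => hPQ a (by simp [ha]) b (by simp [hb]))

theorem transform_spec {F : List ℚ_[p]} (hF : 0 < F.length) (s : ℕ) {ω : List ℚ_[p]}
    (hω : ω.length = F.length) (f : ℚ_[p][X]) :
    (∀ v ∈ (transform p F s ω f).val, v.length = F.length) ∧
      (transform p F s ω f).val.map (quotVal (monicOf p F)) =
        ((Arith.base (AdjoinRoot (monicOf p F))).fft s.primeFactorsList (quotVal _ ω)
          ((List.range s).map fun j => AdjoinRoot.of _ (f.coeff j))).val := by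
  have hq := quotVal_models (monicOf_eq F) hF
  obtain ⟨h1, h2⟩ := hq.fft_spec s.primeFactorsList hω
    (a := (List.range s).map fun j => (Arith.base ℚ_[p]).const F.length (f.coeff j)) (by
      intro x hx
      obtain ⟨j, -, rfl⟩ := List.mem_map.1 hx
      exact Arith.Models.const_length hF)
  refine ⟨h1, h2.trans ?_⟩
  rw [List.map_map]
  congr 2
  refine List.map_congr_left fun j _ => ?_
  exact quotVal_const _ _

theorem transform_eq_aeval {F : List ℚ_[p]} (hF : 0 < F.length) {s : ℕ} (hs : 0 < s)
    {ω : List ℚ_[p]} (hω : ω.length = F.length) (hroot : quotVal (monicOf p F) ω ^ s = 1)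
    {f : ℚ_[p][X]} (hf : f.natDegree < s) :
    (transform p F s ω f).val.map (quotVal (monicOf p F)) =
      (List.range s).map fun i => aeval (quotVal (monicOf p F) ω ^ i) f := by
  have hprod := Nat.prod_primeFactorsList hs.ne'
  rw [(transform_spec hF s hω f).2, Arith.base_fft _ (by rw [hprod, hroot]), hprod]
  refine List.map_congr_left fun i _ => ?_
  rw [aeval_eq_sum_range' hf]
  refine Finset.sum_congr rfl fun k hk => ?_
  rw [Finset.mem_range] at hk
  rw [List.getD_eq_getElem _ _ (by simpa using hk), List.getElem_map, List.getElem_range,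
    Algebra.smul_def, AdjoinRoot.algebraMap_eq, pow_mul]

/-- The scale in `Near` must be an element of ℚ_p; a largest coefficient of `f` provides it, and any
real bound `B` enters only at the end. -/
theorem exists_norm_coeff_le (f : ℚ_[p][X]) : ∃ k, ∀ j, ‖f.coeff j‖ ≤ ‖f.coeff k‖ := by
  obtain ⟨k, -, hk⟩ := Finset.exists_max_image (Finset.range (f.natDegree + 1))
    (fun j => ‖f.coeff j‖) ⟨0, by simp⟩
  refine ⟨k, fun j => ?_⟩
  by_cases hj : j ≤ f.natDegree
  · exact hk j (by simpa [Nat.lt_succ_iff] using hj)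
  · rw [coeff_eq_zero_of_natDegree_lt (not_le.1 hj), norm_zero]
    exact norm_nonneg _

theorem norm_p_pow (m : ℕ) : ‖(p : ℚ_[p]) ^ m‖ = ((p : ℝ) ^ m)⁻¹ := by
  rw [norm_pow, Padic.norm_p, inv_pow]

theorem near_of_forall₂_dvd {F : List ℤ_[p]} {m : ℕ} {α z : List ℤ_[p]}
    (h : List.Forall₂ (fun a b => (p : ℤ_[p]) ^ m ∣ a - b) α z) :
    Near F 1 ((p : ℚ_[p]) ^ m) (quotVal _ (toPadic α)) (quotVal _ (toPadic z)) := by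
  refine ⟨⟨quotVal _ α, ?_⟩, ⟨quotVal _ z, ?_⟩, ?_⟩
  · rw [embed_quotVal, map_one, one_mul]
  · rw [embed_quotVal, map_one, one_mul]
  · obtain ⟨r, hr⟩ := dvd_quotVal_sub (g := mp id F) h
    refine ⟨r, ?_⟩
    rw [← embed_quotVal, ← embed_quotVal, ← map_sub, hr, map_mul, embed_of, one_mul]
    simp

/-- `fft_rel` with two scales: powers of the root are near at scale 1, transformed values at the
scale of the largest coefficient of `f`. Both relations are stable, so no error accumulates over the
levels. -/
theorem transform_close {F : List ℤ_[p]} (hF : 0 < F.length) (s m : ℕ) {α z : List ℤ_[p]}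
    (hα : α.length = F.length) (hz : z.length = F.length)
    (h : List.Forall₂ (fun a b => (p : ℤ_[p]) ^ m ∣ a - b) α z) (f : ℚ_[p][X]) {B : ℝ}
    (hB : ∀ k, ‖f.coeff k‖ ≤ B) :
    List.Forall₂ (Close p (B * ((p : ℝ) ^ m)⁻¹)) (transform p (toPadic F) s (toPadic α) f).val
      (transform p (toPadic F) s (toPadic z) f).val := by
  obtain ⟨k, hk⟩ := exists_norm_coeff_le f
  have hF' : 0 < (toPadic F).length := by rwa [length_toPadic]
  obtain ⟨a1, a2⟩ := transform_spec hF' s (ω := toPadic α) (by simpa [length_toPadic] using hα) f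
  obtain ⟨z1, z2⟩ := transform_spec hF' s (ω := toPadic z) (by simpa [length_toPadic] using hz) f
  have key := Arith.fft_rel (A := Arith.base (AdjoinRoot (monicOf p (toPadic F))))
    (A' := Arith.base (AdjoinRoot (monicOf p (toPadic F))))
    (P := Near F 1 ((p : ℚ_[p]) ^ m)) (Q := Near F (f.coeff k) ((p : ℚ_[p]) ^ m))
    (Near.refl ⟨1, by simp [Arith.base]⟩) (fun h1 h2 => h1.mul h2) (Near.refl MulInt.zero)
    (fun h1 h2 => h1.add h2) (fun h1 h2 => h1.mul h2) s.primeFactorsList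
    (near_of_forall₂_dvd h)
    (Arith.forall₂_range_map (f := fun j => AdjoinRoot.of _ (f.coeff j))
      (g := fun j => AdjoinRoot.of _ (f.coeff j)) s fun j _ => Near.refl (mulInt_of (hk j)))
  rw [← a2, ← z2, List.forall₂_map_left_iff, List.forall₂_map_right_iff] at key
  refine forall₂_imp_mem key fun v hv w hw hvw => ?_
  refine close_of_mulInt hF ((a1 v hv).trans (length_toPadic F))
    ((z1 w hw).trans (length_toPadic F)) hvw.diff ?_
  rw [norm_mul, norm_p_pow]
  exact mul_le_mul_of_nonneg_right (hB k) (by positivity)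

/-! ### Correctness of the whole algorithm -/

variable {Ω : Type*} [Field Ω] [Algebra (ZMod p) Ω] [CharP Ω p] {s : ℕ} {fY : List (ZMod p)}
  {y : Ω}

theorem IsCyclotomicFactor.correct (h : IsCyclotomicFactor s fY y) (hs : 0 < s)
    (hps : p.Coprime s) (n : ℕ) {f : ℚ_[p][X]} (hf : f.natDegree < s) :
    Correct p s fY.length n f
      ⟨toPadic (liftCoeffs fY), toPadic (liftRoot p (liftCoeffs fY) s n).val,
        (transform p (toPadic (liftCoeffs fY)) s
          (toPadic (liftRoot p (liftCoeffs fY) s n).val) f).val⟩ := by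
  have hF : 0 < (liftCoeffs fY).length := by rw [length_liftCoeffs]; exact h.pos hs hps
  have hF' : 0 < (toPadic (liftCoeffs fY)).length := by rwa [length_toPadic]
  obtain ⟨z, hz, hprim, -, hroot⟩ := h.exists_root hs hps
  obtain ⟨r1, r2, -⟩ := hroot n
  have hz' : z.length = (liftCoeffs fY).length := hz.trans length_liftCoeffs.symm
  have hα' := r1.trans (length_liftCoeffs (fY := fY)).symm
  have hzp : (toPadic z).length = (toPadic (liftCoeffs fY)).length := by
    rw [length_toPadic, length_toPadic, hz']
  have hlen : (toPadic (liftCoeffs fY)).length = fY.length := by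
    rw [length_toPadic, length_liftCoeffs]
  have hprim' : IsPrimitiveRoot (quotVal (monicOf p (toPadic (liftCoeffs fY))) (toPadic z)) s := by
    rw [← embed_quotVal]
    exact hprim.map_of_injective (embed_injective hF)
  have hel : element p (toPadic (liftCoeffs fY)) = quotVal _ := funext (element_eq _)
  refine ⟨hlen, irreducible_monicOf (h.irreducible_lift hs hps), toPadic z, hzp.trans hlen,
    ?_, ?_, _, rfl, ?_, ?_, ?_⟩
  · rw [hel]; exact hprim'
  · refine close_of_mulInt hF ((length_toPadic _).trans hα') ((length_toPadic _).trans hz')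
      (near_of_forall₂_dvd r2).diff ?_
    rw [one_mul, norm_p_pow]
  · intro v hv
    exact ((transform_spec hF' s hzp f).1 v hv).trans hlen
  · simp only [hel]
    exact transform_eq_aeval hF' hs hzp hprim'.pow_eq_one hf
  · intro B hB
    exact transform_close hF s _ hα' hz' r2 f hB

/-- The cyclotomic field is ℚ_p(Z) inside ℚ_p[X]/(F), so its degree is at most that of `F`.
Conversely the minimal polynomial of `Z` has coefficients in ℤ_p, and its reduction vanishes at `y`,
hence is divisible by `mp id fY`. -/
theorem IsCyclotomicFactor.finrank_cyclotomicField (h : IsCyclotomicFactor s fY y) (hs : 0 < s)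
    (hps : p.Coprime s) : Module.finrank ℚ_[p] (CyclotomicField s ℚ_[p]) = fY.length := by
  have : NeZero s := ⟨hs.ne'⟩
  have hF : 0 < (liftCoeffs fY).length := by rw [length_liftCoeffs]; exact h.pos hs hps
  have : Fact (Irreducible (monicOf p (toPadic (liftCoeffs fY)))) :=
    ⟨irreducible_monicOf (h.irreducible_lift hs hps)⟩
  obtain ⟨z, hz, hprim, hred, -⟩ := h.exists_root hs hps
  set Z := quotVal (mp id (liftCoeffs fY)) z
  set g := monicOf p (toPadic (liftCoeffs fY)) with hg
  have hgm : g.Monic := by rw [hg, monicOf_eq]; exact mp_monic _ _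
  have hgd : g.natDegree = fY.length := by
    rw [hg, monicOf_eq, natDegree_mp, length_toPadic, length_liftCoeffs]
  have hprim' : IsPrimitiveRoot (embed (liftCoeffs fY) Z) s :=
    hprim.map_of_injective (embed_injective hF)
  have hfin : Module.Finite ℚ_[p] (AdjoinRoot g) := hgm.finite_adjoinRoot
  have hrank : Module.finrank ℚ_[p] (AdjoinRoot g) = fY.length := by
    rw [(AdjoinRoot.powerBasis' hgm).finrank, AdjoinRoot.powerBasis'_dim, hgd]
  have hint : IsIntegral ℤ_[p] (embed (liftCoeffs fY) Z) := by
    refine ⟨X ^ s - 1, monic_X_pow_sub_C 1 hs.ne', ?_⟩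
    simp [hprim'.pow_eq_one]
  have hcyc := hprim'.intermediateField_adjoin_isCyclotomicExtension ℚ_[p]
  have e := IsCyclotomicExtension.algEquiv {s} ℚ_[p] (CyclotomicField s ℚ_[p])
    (IntermediateField.adjoin ℚ_[p] {embed (liftCoeffs fY) Z})
  rw [e.toLinearEquiv.finrank_eq, IntermediateField.adjoin.finrank (hprim'.isIntegral hs).tower_top]
  refine le_antisymm ?_ ?_
  · rw [← hrank]
    exact minpoly.natDegree_le _
  · rw [minpoly.isIntegrallyClosed_eq_field_fractions' ℚ_[p] hint,
      (minpoly.monic hint).natDegree_map]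
    set M := minpoly ℤ_[p] (embed (liftCoeffs fY) Z) with hM
    have h1 : M.eval₂ (AdjoinRoot.of _) Z = 0 := by
      refine embed_injective hF ?_
      rw [hom_eval₂, map_zero]
      have h0 := minpoly.aeval ℤ_[p] (embed (liftCoeffs fY) Z)
      rw [aeval_def] at h0
      rw [← h0]
      congr 1
      ext c
      exact embed_of _ _
    have h2 : (M.map PadicInt.toZMod).eval₂ (algebraMap (ZMod p) Ω) y = 0 := by
      have := congrArg h.reduction h1
      rw [hom_eval₂, map_zero, hred] at this
      rw [eval₂_map, ← this]
      congr 1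
      ext c
      exact (AdjoinRoot.lift_of h.root_lift).symm
    have h3 : minpoly (ZMod p) y = mp id fY := by
      refine (minpoly.eq_of_irreducible_of_monic (h.irreducible hs hps) ?_ (mp_monic _ _)).symm
      exact (eval₂_mp _ _ _).trans h.root
    have h4 := minpoly.dvd (ZMod p) y h2
    rw [h3] at h4
    have hMm : (M.map (PadicInt.toZMod (p := p))).Monic := (minpoly.monic hint).map _
    have h5 := natDegree_le_of_dvd h4 hMm.ne_zero
    rwa [natDegree_mp, (minpoly.monic hint).natDegree_map] at h5

end Padic

/-! ### The length of the transform -/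

section Numbers

variable {p : ℕ} [Fact p.Prime]

theorem prime_nth (i : ℕ) : (Nat.nth Nat.Prime i).Prime := Nat.prime_nth_prime i

theorem geomSum_dvd (ℓ : ℕ) : ∑ j ∈ Finset.range ℓ, p ^ j ∣ p ^ ℓ - 1 := by
  have hp := (Fact.out : p.Prime).one_lt
  have h := geom_sum_mul_add (p - 1) ℓ
  rw [Nat.sub_add_cancel hp.le] at h
  exact ⟨p - 1, by rw [← h, Nat.add_sub_cancel]⟩

theorem geomSum_le (ℓ : ℕ) : ∑ j ∈ Finset.range ℓ, p ^ j ≤ p ^ ℓ :=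
  (Nat.geomSum_lt (Fact.out : p.Prime).two_le fun _ hk => Finset.mem_range.1 hk).le

theorem pow_pred_le_geomSum {ℓ : ℕ} (hℓ : 0 < ℓ) : p ^ (ℓ - 1) ≤ ∑ j ∈ Finset.range ℓ, p ^ j :=
  Finset.single_le_sum (f := fun j => p ^ j) (fun _ _ => Nat.zero_le _)
    (Finset.mem_range.2 (by omega))

theorem lt_geomSum {ℓ : ℕ} (hℓ : 2 ≤ ℓ) : p < ∑ j ∈ Finset.range ℓ, p ^ j := by
  have h : ∑ j ∈ Finset.range 2, p ^ j ≤ ∑ j ∈ Finset.range ℓ, p ^ j :=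
    Finset.sum_le_sum_of_subset (Finset.range_mono hℓ)
  simp [Finset.sum_range_succ] at h
  omega

/-- The order of `p` modulo Φ_ℓ(p) divides the prime `ℓ`, and it is not 1 because Φ_ℓ(p) exceeds `p
- 1`. -/
theorem dvd_of_geomSum_dvd {ℓ o : ℕ} (hℓ : ℓ.Prime)
    (h : ∑ j ∈ Finset.range ℓ, p ^ j ∣ p ^ o - 1) : ℓ ∣ o := by
  have hp := (Fact.out : p.Prime).one_lt
  have h1 := orderOf_dvd_of_pow_eq_one (natCast_pow_eq_one_iff.2 (geomSum_dvd (p := p) ℓ))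
  rcases (Nat.dvd_prime hℓ).1 h1 with h2 | h2
  · have h3 : _ ∣ p ^ 1 - 1 := natCast_pow_eq_one_iff.1 (by rw [← h2, pow_orderOf_eq_one])
    rw [pow_one] at h3
    replace h3 := Nat.le_of_dvd (by omega) h3
    have := lt_geomSum (p := p) hℓ.two_le
    omega
  · have h3 := orderOf_dvd_of_pow_eq_one (natCast_pow_eq_one_iff.2 h)
    rwa [h2] at h3

theorem lengthOf_eq (r : ℕ) : lengthOf p r =
    (p - 1) * ∏ i ∈ Finset.range r, ∑ j ∈ Finset.range (Nat.nth Nat.Prime i), p ^ j := by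
  have hp := (Fact.out : p.Prime).one_lt
  have h : (cyclotomic 1 ℤ).eval (p : ℤ) *
      ∏ i ∈ Finset.range r, (cyclotomic (Nat.nth Nat.Prime i) ℤ).eval (p : ℤ) =
      (((p - 1) * ∏ i ∈ Finset.range r, ∑ j ∈ Finset.range (Nat.nth Nat.Prime i), p ^ j : ℕ) :
        ℤ) := by
    rw [Nat.cast_mul, Nat.cast_prod, cyclotomic_one, Nat.cast_sub hp.le]
    congr 1
    · simp
    · refine Finset.prod_congr rfl fun i _ => ?_
      have : Fact (Nat.nth Nat.Prime i).Prime := ⟨prime_nth i⟩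
      rw [cyclotomic_prime, eval_geom_sum]
      push_cast
      rfl
  rw [lengthOf, h, Int.natAbs_natCast]

theorem lengthOf_succ (r : ℕ) : lengthOf p (r + 1) =
    lengthOf p r * ∑ j ∈ Finset.range (Nat.nth Nat.Prime r), p ^ j := by
  rw [lengthOf_eq, lengthOf_eq, Finset.prod_range_succ, mul_assoc]

theorem lengthOf_pos (r : ℕ) : 0 < lengthOf p r := by
  have hp := (Fact.out : p.Prime).one_lt
  rw [lengthOf_eq]
  refine Nat.mul_pos (by omega) (Finset.prod_pos fun i _ => ?_)
  exact (Nat.zero_le p).trans_lt (lt_geomSum (prime_nth i).two_le)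

theorem two_pow_le_lengthOf (r : ℕ) : 2 ^ (∑ i ∈ Finset.range r, (i + 1)) ≤ lengthOf p r := by
  have hp := (Fact.out : p.Prime).two_le
  induction r with
  | zero => exact lengthOf_pos 0
  | succ r ih =>
    rw [Finset.sum_range_succ, pow_add, lengthOf_succ]
    refine Nat.mul_le_mul ih ?_
    refine le_trans ?_ (pow_pred_le_geomSum (prime_nth r).pos)
    have := Nat.add_two_le_nth_prime r
    exact (Nat.pow_le_pow_left hp _).trans (Nat.pow_le_pow_right (by omega) (by omega))

/-- X^d - 1 is the product of Φ_k over the divisors `k` of `d`, among which are 1 and the primes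
p_i, pairwise distinct; then evaluate at `p`. -/
theorem lengthOf_dvd (r : ℕ) :
    lengthOf p r ∣ p ^ (∏ i ∈ Finset.range r, Nat.nth Nat.Prime i) - 1 := by
  have hp := (Fact.out : p.Prime).one_lt
  set d := ∏ i ∈ Finset.range r, Nat.nth Nat.Prime i with hd
  have hd0 : 0 < d := Finset.prod_pos fun i _ => (prime_nth i).pos
  have h1 : cyclotomic 1 ℤ * ∏ i ∈ Finset.range r, cyclotomic (Nat.nth Nat.Prime i) ℤ ∣
      X ^ d - 1 := by
    rw [← prod_cyclotomic_eq_X_pow_sub_one hd0,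
      ← Finset.prod_image (s := Finset.range r) (g := Nat.nth Nat.Prime)
        (f := fun k => cyclotomic k ℤ)
        fun i _ j _ h => Nat.nth_injective Nat.infinite_setOfPred_prime h,
      ← Finset.prod_insert (f := fun k => cyclotomic k ℤ)]
    · refine Finset.prod_dvd_prod_of_subset _ _ _ fun k hk => ?_
      rw [Nat.mem_divisors]
      refine ⟨?_, hd0.ne'⟩
      rcases Finset.mem_insert.1 hk with rfl | hk
      · exact one_dvd _
      · obtain ⟨i, hi, rfl⟩ := Finset.mem_image.1 hk
        exact Finset.dvd_prod_of_mem _ hi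
    · intro h
      obtain ⟨i, -, hi⟩ := Finset.mem_image.1 h
      exact (prime_nth i).one_lt.ne' hi
  have h2 := map_dvd (evalRingHom (p : ℤ)) h1
  rw [map_mul, map_prod] at h2
  simp only [coe_evalRingHom, eval_sub, eval_pow, eval_X, eval_one] at h2
  have h3 := Int.natAbs_dvd_natAbs.2 h2
  have h4 : ((p : ℤ) ^ d - 1) = ((p ^ d - 1 : ℕ) : ℤ) := by
    rw [Nat.cast_sub (Nat.one_le_pow _ _ (by omega))]
    push_cast; rfl
  rwa [h4, Int.natAbs_natCast] at h3

theorem prod_nth_prime_dvd {r o : ℕ} (h : ∀ i < r, Nat.nth Nat.Prime i ∣ o) :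
    ∏ i ∈ Finset.range r, Nat.nth Nat.Prime i ∣ o := by
  rw [← Finset.prod_image (s := Finset.range r) (g := Nat.nth Nat.Prime) (f := fun k => k)
    fun i _ j _ h => Nat.nth_injective Nat.infinite_setOfPred_prime h]
  refine Finset.prod_primes_dvd _ (fun k hk => ?_) fun k hk => ?_
  · obtain ⟨i, -, rfl⟩ := Finset.mem_image.1 hk
    exact (prime_nth i).prime
  · obtain ⟨i, hi, rfl⟩ := Finset.mem_image.1 hk
    exact h i (Finset.mem_range.1 hi)

theorem orderOf_lengthOf (r : ℕ) : orderOf (p : ZMod (lengthOf p r)) =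
    ∏ i ∈ Finset.range r, Nat.nth Nat.Prime i := by
  refine Nat.dvd_antisymm (orderOf_dvd_of_pow_eq_one (natCast_pow_eq_one_iff.2 (lengthOf_dvd r)))
    (prod_nth_prime_dvd fun i hi => dvd_of_geomSum_dvd (p := p) (prime_nth i) ?_)
  refine dvd_trans ?_ (natCast_pow_eq_one_iff.1 (pow_orderOf_eq_one _))
  rw [lengthOf_eq]
  exact (Finset.dvd_prod_of_mem (fun i => ∑ j ∈ Finset.range (Nat.nth Nat.Prime i), p ^ j)
    (Finset.mem_range.2 hi)).mul_left _

theorem coprime_lengthOf (r : ℕ) : p.Coprime (lengthOf p r) := by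
  have hp := (Fact.out : p.Prime)
  refine Nat.Coprime.coprime_dvd_right (lengthOf_dvd r) ?_
  have hd0 : (∏ i ∈ Finset.range r, Nat.nth Nat.Prime i) ≠ 0 :=
    (Finset.prod_pos fun i _ => (prime_nth i).pos).ne'
  rw [hp.coprime_iff_not_dvd]
  intro h
  have h1 := (Nat.dvd_sub_iff_right (Nat.one_le_pow _ _ hp.pos) (dvd_pow_self p hd0)).1 h
  exact hp.one_lt.ne' (Nat.dvd_one.1 h1)

/-! ### Sizes of `s` and `d` in terms of `N` -/

theorem isLeast_chooseR (N : ℕ) (hN : 0 < N) :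
    IsLeast {r | 0 < r ∧ N < lengthOf p r} (chooseR p N) := by
  have hne : {r | 0 < r ∧ N < lengthOf p r}.Nonempty := by
    refine ⟨N, hN, Nat.lt_two_pow_self.trans_le ?_⟩
    refine le_trans (Nat.pow_le_pow_right two_pos ?_) (two_pow_le_lengthOf N)
    calc N = ∑ i ∈ Finset.range N, 1 := by simp
      _ ≤ _ := Finset.sum_le_sum fun i _ => by omega
  exact ⟨Nat.sInf_mem hne, fun r hr => Nat.sInf_le hr⟩

/-- By minimality the length for `r - 1` is at most `N`, and the last factor of `s` is at most `p ^
p_r`. -/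
theorem lengthOf_pred_chooseR_le (N : ℕ) (hN : 0 < N) :
    2 ^ (∑ i ∈ Finset.range (chooseR p N - 1), (i + 1)) ≤ N ∧
      chooseS p N ≤ N * p ^ Nat.nth Nat.Prime (chooseR p N - 1) := by
  obtain ⟨⟨hr, -⟩, hmin⟩ := isLeast_chooseR (p := p) N hN
  have hp := (Fact.out : p.Prime).two_le
  rw [chooseS]
  obtain ⟨k, hk⟩ : ∃ k, chooseR p N = k + 1 := ⟨chooseR p N - 1, by omega⟩
  rw [hk, Nat.add_sub_cancel, lengthOf_succ]
  rcases Nat.eq_zero_or_pos k with rfl | hk0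
  -- For `r = 1` minimality says nothing, as `r` has to be positive; but then `s = p ^ 2 - 1`.
  · refine ⟨by simpa using Nat.succ_le_of_lt hN, ?_⟩
    have h2 : Nat.nth Nat.Prime 0 = 2 := Nat.nth_prime_zero_eq_two
    have h1 : (p - 1) * (1 + p) ≤ p ^ 2 := by
      obtain ⟨m, rfl⟩ : ∃ m, p = m + 1 := ⟨p - 1, by omega⟩
      rw [Nat.add_sub_cancel]; nlinarith
    rw [lengthOf_eq, h2]
    simp only [Finset.range_zero, Finset.prod_empty, mul_one, Finset.sum_range_succ,
      Finset.sum_empty, zero_add, pow_zero, pow_one]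
    exact h1.trans (Nat.le_mul_of_pos_left _ hN)
  · have hle : lengthOf p k ≤ N := by
      by_contra hlt
      have := hmin ⟨hk0, not_le.1 hlt⟩
      omega
    exact ⟨(two_pow_le_lengthOf k).trans hle, Nat.mul_le_mul hle (geomSum_le _)⟩

theorem three_dvd_chooseS (N : ℕ) (hN : 0 < N) (hp2 : p = 2) : 3 ∣ chooseS p N := by
  obtain ⟨⟨hr, -⟩, -⟩ := isLeast_chooseR (p := p) N hN
  rw [chooseS, lengthOf_eq]
  refine Dvd.dvd.mul_left ?_ _
  refine dvd_trans ?_ (Finset.dvd_prod_of_mem _ (Finset.mem_range.2 hr))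
  rw [Nat.nth_prime_zero_eq_two]
  simp [Finset.sum_range_succ, hp2]

theorem prime_le_of_dvd_chooseS (N : ℕ) (hN : 0 < N) {ℓ : ℕ} (hℓ : ℓ.Prime)
    (h : ℓ ∣ chooseS p N) : ℓ ≤ p ^ Nat.nth Nat.Prime (chooseR p N - 1) := by
  obtain ⟨⟨hr, -⟩, -⟩ := isLeast_chooseR (p := p) N hN
  have hp := (Fact.out : p.Prime).two_le
  rw [chooseS, lengthOf_eq] at h
  rcases (hℓ.dvd_mul).1 h with h | h
  · have h1 := Nat.le_of_dvd (by omega) h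
    have h2 := Nat.le_self_pow (prime_nth (chooseR p N - 1)).ne_zero p
    omega
  · obtain ⟨i, hi, hdvd⟩ := (Prime.dvd_finsetProd_iff hℓ.prime _).1 h
    have h0 := (Nat.zero_le p).trans_lt (lt_geomSum (p := p) (prime_nth i).two_le)
    refine (Nat.le_of_dvd h0 hdvd).trans ((geomSum_le _).trans ?_)
    refine Nat.pow_le_pow_right (by omega) (Nat.nth_monotone Nat.infinite_setOfPred_prime ?_)
    have := Finset.mem_range.1 hi
    omega

theorem chooseD_le (N : ℕ) : chooseD p N ≤ 4 ^ Nat.nth Nat.Prime (chooseR p N - 1) := by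
  refine le_trans ?_ (primorial_le_four_pow _)
  rw [chooseD, primorial, ← Finset.prod_image (s := Finset.range (chooseR p N))
    (g := Nat.nth Nat.Prime) (f := fun k => k)
    fun i _ j _ h => Nat.nth_injective Nat.infinite_setOfPred_prime h]
  refine Finset.prod_le_prod_of_subset_of_one_le' (fun k hk => ?_) fun k hk _ => ?_
  · obtain ⟨i, hi, rfl⟩ := Finset.mem_image.1 hk
    have := Finset.mem_range.1 hi
    rw [Finset.mem_filter, Finset.mem_range, Nat.lt_succ_iff]
    exact ⟨Nat.nth_monotone Nat.infinite_setOfPred_prime (by omega), prime_nth i⟩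
  · exact (Finset.mem_filter.1 hk).2.one_le

/-- A bound for the degree, the prime factors and the binary lengths that occur. -/
noncomputable def width (p N : ℕ) : ℕ := 2 * p * (4 * p) ^ Nat.nth Nat.Prime (chooseR p N - 1)

/-- In `width` the base `4 * p` dominates both `4 ^ p_r`, a bound for the primorial `d`, and `p ^
p_r`, a bound for the primes dividing `s`. The factor `2 * p` leaves room for the binary length of
`p ^ d`. -/
theorem chooseD_mul_le_width (N : ℕ) : 2 * p * chooseD p N ≤ width p N := by
  refine Nat.mul_le_mul_left _ ((chooseD_le N).trans (Nat.pow_le_pow_left ?_ _))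
  have := (Fact.out : p.Prime).pos
  omega

theorem pow_mul_le_width (N : ℕ) :
    2 * p * p ^ Nat.nth Nat.Prime (chooseR p N - 1) ≤ width p N :=
  Nat.mul_le_mul_left _ (Nat.pow_le_pow_left (by omega) _)

theorem chooseD_le_width (N : ℕ) : chooseD p N ≤ width p N := by
  refine le_trans ?_ (chooseD_mul_le_width N)
  have := (Fact.out : p.Prime).pos
  exact Nat.le_mul_of_pos_left _ (by omega)

theorem size_pow_le_width (N : ℕ) : (p ^ chooseD p N).size ≤ width p N := by
  refine le_trans (Nat.size_le.2 ?_) (chooseD_mul_le_width N)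
  calc p ^ chooseD p N ≤ (2 ^ p) ^ chooseD p N := Nat.pow_le_pow_left Nat.lt_two_pow_self.le _
    _ = 2 ^ (p * chooseD p N) := (pow_mul _ _ _).symm
    _ < 2 ^ (2 * p * chooseD p N) := by
      refine Nat.pow_lt_pow_right one_lt_two ?_
      have h1 := (Fact.out : p.Prime).pos
      have h2 : 0 < chooseD p N := Finset.prod_pos fun i _ => (prime_nth i).pos
      have := Nat.mul_pos h1 h2
      rw [mul_assoc]
      omega

theorem chooseS_lt_pow (N : ℕ) : chooseS p N < p ^ chooseD p N := by
  have hp := (Fact.out : p.Prime).one_lt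
  have hd : (∏ i ∈ Finset.range (chooseR p N), Nat.nth Nat.Prime i) ≠ 0 :=
    (Finset.prod_pos fun i _ => (prime_nth i).pos).ne'
  have h1 := Nat.one_lt_pow hd hp
  have := Nat.le_of_dvd (by omega) (lengthOf_dvd (p := p) (chooseR p N))
  rw [chooseS, chooseD]
  omega

theorem size_chooseS_le_width (N : ℕ) : (chooseS p N).size ≤ width p N :=
  (Nat.size_le_size (chooseS_lt_pow N).le).trans (size_pow_le_width N)

theorem two_pow_length_primeFactorsList_le {n : ℕ} (hn : n ≠ 0) :
    2 ^ n.primeFactorsList.length ≤ n := by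
  conv_rhs => rw [← Nat.prod_primeFactorsList hn]
  exact List.pow_card_le_prod _ _ fun q hq => (Nat.prime_of_mem_primeFactorsList hq).two_le

theorem length_primeFactorsList_chooseS_le (N : ℕ) :
    (chooseS p N).primeFactorsList.length ≤ width p N :=
  (Nat.lt_size.2 (two_pow_length_primeFactorsList_le (lengthOf_pos _).ne')).le.trans
    (size_chooseS_le_width N)

theorem prime_succ_le_width (N : ℕ) (hN : 0 < N) {ℓ : ℕ} (hℓ : ℓ.Prime)
    (h : ℓ ∣ chooseS p N) : ℓ + 1 ≤ width p N := by
  have h1 := prime_le_of_dvd_chooseS N hN hℓ h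
  have h2 := pow_mul_le_width (p := p) N
  have h3 := (Fact.out : p.Prime).pos
  have h4 := hℓ.pos
  have h5 : 2 * p * p ^ Nat.nth Nat.Prime (chooseR p N - 1) ≥
      2 * p ^ Nat.nth Nat.Prime (chooseR p N - 1) := Nat.mul_le_mul_right _ (by omega)
  omega

theorem chooseS_le_width (N : ℕ) (hN : 0 < N) : chooseS p N ≤ N * width p N := by
  refine (lengthOf_pred_chooseR_le N hN).2.trans (Nat.mul_le_mul_left _ ?_)
  refine le_trans ?_ (pow_mul_le_width N)
  have := (Fact.out : p.Prime).pos
  exact Nat.le_mul_of_pos_left _ (by omega)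

/-! ### The width is `N ^ o(1)` -/

/-- An explicit form of p_k = o(k²): with `x` the fourth root of the prime `n`, Chebyshev's bound
and `log n ≤ 4 * x` give `x ^ 3 = O(k)`, so that `n = x ^ 4` is of order at most k^{4/3}. -/
theorem nth_prime_le (k : ℕ) {η : ℝ} (hη : 0 < η) :
    (Nat.nth Nat.Prime k : ℝ) ≤ η * (128 * k ^ 2 + 648) + 1 / η ^ 2 := by
  set n := Nat.nth Nat.Prime k with hn
  have hn1 : (1 : ℝ) ≤ n := by exact_mod_cast (prime_nth k).one_le
  have hpi : Nat.primeCounting n = k + 1 := by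
    rw [Nat.primeCounting, Nat.primeCounting', Nat.count_succ, if_pos (prime_nth k)]
    congr 1
    exact Nat.primeCounting'_nth_eq k
  have hge := Chebyshev.pi_ge n
  set x := √√(n : ℝ) with hx
  have hx4 : x ^ 4 = n := by
    rw [show x ^ 4 = (x ^ 2) ^ 2 by ring, hx, Real.sq_sqrt (Real.sqrt_nonneg _),
      Real.sq_sqrt (by linarith)]
  have hx1 : 1 ≤ x := by rw [hx, Real.one_le_sqrt, Real.one_le_sqrt]; exact hn1
  have hlog : Real.log n ≤ 4 * x := by
    rw [← hx4, Real.log_pow]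
    have := Real.log_le_sub_one_of_pos (by linarith : 0 < x)
    push_cast; linarith
  have hn2 : (1 : ℝ) < n := by exact_mod_cast (prime_nth k).one_lt
  rw [hpi, div_le_iff₀ (Real.log_pos hn2)] at hge
  have hlog' : Real.log (n + 1) ≤ 1 + 4 * x := by
    have h1 : Real.log (n + 1) ≤ Real.log (2 * n) := Real.log_le_log (by linarith) (by linarith)
    rw [Real.log_mul two_ne_zero (by linarith)] at h1
    have := Real.log_two_lt_d9
    linarith
  have hl2 := Real.log_two_gt_d9
  have hk0 : (0 : ℝ) ≤ k := Nat.cast_nonneg k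
  push_cast at hge
  -- Chebyshev's bound reads `n / 2 ≤ 4 * x * (k + 1) + 1 + 4 * x`; doubling and `1 ≤ x` give 8 + 8
  -- + 2 = 18.
  have h3 : x * x ^ 3 ≤ x * (8 * k + 18) := by
    have h1 : (n : ℝ) * (1 / 2) ≤ n * Real.log 2 :=
      mul_le_mul_of_nonneg_left (by linarith) (by linarith)
    have h2 : ((k : ℝ) + 1) * Real.log n ≤ (k + 1) * (4 * x) :=
      mul_le_mul_of_nonneg_left hlog (by linarith)
    have : x * x ^ 3 = n := by rw [← hx4]; ring
    nlinarith
  have h3' : x ^ 3 ≤ 8 * k + 18 := le_of_mul_le_mul_left h3 (by linarith)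
  have h6 : x ^ 6 ≤ 128 * k ^ 2 + 648 := by
    have : (x ^ 3) ^ 2 ≤ (8 * k + 18) ^ 2 := pow_le_pow_left₀ (by positivity) h3' 2
    nlinarith [sq_nonneg ((8 : ℝ) * k - 18)]
  rw [← hx4]
  -- Either `1 ≤ η * x ^ 2`, and the first term dominates, or `x ^ 2` is at most `1 / η`.
  have h7 : x ^ 4 ≤ η * x ^ 6 + 1 / η ^ 2 := by
    rcases le_total 1 (η * x ^ 2) with h | h
    · have : x ^ 4 * 1 ≤ x ^ 4 * (η * x ^ 2) := mul_le_mul_of_nonneg_left h (by positivity)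
      have h' : 0 < 1 / η ^ 2 := by positivity
      nlinarith
    · have h1 : (η * x ^ 2) ^ 2 ≤ 1 := pow_le_one₀ (by positivity) h
      have h2 : x ^ 4 ≤ 1 / η ^ 2 := by
        rw [le_div_iff₀ (by positivity)]
        nlinarith
      have : 0 ≤ η * x ^ 6 := by positivity
      linarith
  have := mul_le_mul_of_nonneg_left h6 hη.le
  linarith

theorem exists_width_pow_le (p : ℕ) [Fact p.Prime] {ε : ℝ} (hε : 0 < ε) (m : ℕ) :
    ∃ C : ℝ, 0 ≤ C ∧ ∀ N : ℕ, 0 < N → (width p N : ℝ) ^ m ≤ C * (N : ℝ) ^ ε := by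
  have hp := (Fact.out : p.Prime).two_le
  have hp' : (2 : ℝ) ≤ p := by exact_mod_cast hp
  set L := ((m : ℝ) + 1) * Real.log (4 * p) with hL
  have hL0 : 0 < L := mul_pos (by positivity) (Real.log_pos (by linarith))
  -- Chosen so that `L * η * 128 * k ^ 2 = ε * (k ^ 2 / 4)`, which is at most `ε * log N`. In `L`
  -- the factor `m + 1` ensures positivity also for `m = 0`.
  set η := ε / (512 * L) with hηdef
  have hη : 0 < η := by positivity
  refine ⟨(2 * p) ^ m * Real.exp (L * (648 * η + 1 / η ^ 2)), by positivity, fun N hN => ?_⟩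
  obtain ⟨hlow, -⟩ := lengthOf_pred_chooseR_le (p := p) N hN
  set k := chooseR p N - 1 with hk
  have hNpos : (0 : ℝ) < N := by exact_mod_cast hN
  have hlogN : (k : ℝ) ^ 2 / 4 ≤ Real.log N := by
    have h1 : ((2 : ℝ) ^ (∑ i ∈ Finset.range k, (i + 1))) ≤ N := by exact_mod_cast hlow
    have h2 := Real.log_le_log (by positivity) h1
    rw [Real.log_pow] at h2
    have h3 : (k : ℝ) ^ 2 / 2 ≤ ((∑ i ∈ Finset.range k, (i + 1) : ℕ) : ℝ) := by
      have : ∀ k : ℕ, (k : ℝ) ^ 2 / 2 ≤ ((∑ i ∈ Finset.range k, (i + 1) : ℕ) : ℝ) := by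
        intro k
        induction k with
        | zero => simp
        | succ k ih =>
          rw [Finset.sum_range_succ]
          push_cast at ih ⊢
          nlinarith
      exact this k
    have h4 := Real.log_two_gt_d9
    have h5 : (0 : ℝ) ≤ (k : ℝ) ^ 2 / 2 := by positivity
    nlinarith
  have hP := nth_prime_le k hη
  have hexp : L * (Nat.nth Nat.Prime k : ℝ) ≤ ε * Real.log N + L * (648 * η + 1 / η ^ 2) := by
    have h1 := mul_le_mul_of_nonneg_left hP hL0.le
    have h2 : L * (η * (128 * (k : ℝ) ^ 2)) = ε * ((k : ℝ) ^ 2 / 4) := by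
      rw [hηdef]; field_simp; ring
    have h3 := mul_le_mul_of_nonneg_left hlogN hε.le
    nlinarith
  rw [width, Nat.cast_mul, mul_pow]
  push_cast
  rw [mul_assoc]
  refine mul_le_mul_of_nonneg_left ?_ (by positivity)
  rw [← pow_mul, ← Real.rpow_natCast, Real.rpow_def_of_pos (by linarith),
    Real.rpow_def_of_pos hNpos, ← Real.exp_add, Real.exp_le_exp]
  push_cast
  refine le_trans ?_ (hexp.trans (by linarith))
  rw [hL]
  have h1 : 0 ≤ Real.log (4 * (p : ℝ)) := Real.log_nonneg (by linarith)
  have h2 : (0 : ℝ) ≤ Nat.nth Nat.Prime k := Nat.cast_nonneg _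
  have := mul_nonneg h1 h2
  nlinarith

end Numbers

/-! ### The whole algorithm -/

theorem Rand.exists_canReturn {α : Type} {x : Rand α} (h : x.cutOffProb < 1) :
    ∃ a, x.CanReturn a := by
  by_contra hx
  refine h.not_ge ?_
  rw [cutOffProb_eq_mean]
  refine (mean_const x 1).symm.le.trans ?_
  refine mean_mono x ?_
  rintro ⟨_ | a, n⟩ hr
  · simp
  · exact absurd ⟨a, n, hr⟩ hx

section Main

variable (p : ℕ) [Fact p.Prime]

theorem padicFFT_eq (rounds N n : ℕ) (f : ℚ_[p][X]) :
    padicFFT p rounds N n f = (cyclotomicFactor p rounds (chooseS p N) >>= fun fY =>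
      Rand.lift (liftRoot p (liftCoeffs fY) (chooseS p N) n) >>= fun α =>
      Rand.lift (transform p (toPadic (liftCoeffs fY)) (chooseS p N) (toPadic α) f) >>= fun v =>
      pure ⟨toPadic (liftCoeffs fY), toPadic α, v⟩) := by
  simp only [padicFFT, map_coe_eq_toPadic]
  rfl

theorem cyclotomicFactor_chooseS (rounds N : ℕ) (hN : 0 < N) :
    (∀ fY, (cyclotomicFactor p rounds (chooseS p N)).CanReturn fY →
      ∃ y : AlgebraicClosure (ZMod p), IsCyclotomicFactor (chooseS p N) fY y) ∧
    (cyclotomicFactor p rounds (chooseS p N)).expectedOps ≤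
      ((chooseS p N).primeFactorsList.length * (924 * width p N ^ 6) : ℕ) ∧
    (cyclotomicFactor p rounds (chooseS p N)).cutOffProb ≤
      (chooseS p N).primeFactorsList.length * (2 ^ width p N * (15 / 16) ^ rounds) := by
  have : CharP (AlgebraicClosure (ZMod p)) p := charP_of_injective_algebraMap
    (algebraMap (ZMod p) (AlgebraicClosure (ZMod p))).injective p
  refine cyclotomicFactor_spec rounds (lengthOf_pos _)
    (fun ℓ hℓ h => prime_succ_le_width N hN hℓ h) (coprime_lengthOf _)
    (three_dvd_chooseS N hN) ?_
  rw [chooseS, orderOf_lengthOf]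
  exact size_pow_le_width N

theorem length_eq_chooseD {Ω : Type*} [Field Ω] [Algebra (ZMod p) Ω] {N : ℕ}
    {fY : List (ZMod p)} {y : Ω} (h : IsCyclotomicFactor (chooseS p N) fY y) :
    fY.length = chooseD p N := by
  rw [h.len, chooseS, orderOf_lengthOf, chooseD]

theorem tendsto_cutOffProb_cyclotomicFactor (N : ℕ) (hN : 0 < N) :
    Filter.Tendsto (fun rounds => (cyclotomicFactor p rounds (chooseS p N)).cutOffProb)
      Filter.atTop (nhds 0) := by
  refine tendsto_of_tendsto_of_tendsto_of_le_of_le tendsto_const_nhds ?_ (fun _ => zero_le)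
    fun rounds => (cyclotomicFactor_chooseS p rounds N hN).2.2
  have h1 : Filter.Tendsto (fun k : ℕ => ((15 / 16 : ℝ≥0∞)) ^ k) Filter.atTop (nhds 0) :=
    ENNReal.tendsto_pow_atTop_nhds_zero_of_lt_one
      (ENNReal.div_lt_of_lt_mul' (by norm_num))
  have h2 := ENNReal.Tendsto.const_mul (a := (2 : ℝ≥0∞) ^ width p N) h1
    (Or.inr (ENNReal.pow_ne_top ENNReal.ofNat_ne_top))
  have h3 := ENNReal.Tendsto.const_mul
    (a := ((chooseS p N).primeFactorsList.length : ℝ≥0∞)) h2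
    (Or.inr (ENNReal.natCast_ne_top _))
  simpa using h3

/-- The algorithm itself provides the factor: its cut-off probability tends to 0, so some run
returns a result. -/
theorem exists_isCyclotomicFactor (N : ℕ) (hN : 0 < N) :
    ∃ (fY : List (ZMod p)) (y : AlgebraicClosure (ZMod p)),
      IsCyclotomicFactor (chooseS p N) fY y := by
  obtain ⟨rounds, h⟩ := ((tendsto_cutOffProb_cyclotomicFactor p N hN).eventually
    (gt_mem_nhds one_pos)).exists
  obtain ⟨fY, hfY⟩ := Rand.exists_canReturn h
  obtain ⟨y, hy⟩ := (cyclotomicFactor_chooseS p rounds N hN).1 fY hfY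
  exact ⟨fY, y, hy⟩

theorem finrank_cyclotomicField (N : ℕ) (hN : 0 < N) :
    Module.finrank ℚ_[p] (CyclotomicField (chooseS p N) ℚ_[p]) = chooseD p N := by
  have : CharP (AlgebraicClosure (ZMod p)) p := charP_of_injective_algebraMap
    (algebraMap (ZMod p) (AlgebraicClosure (ZMod p))).injective p
  obtain ⟨fY, y, h⟩ := exists_isCyclotomicFactor p N hN
  rw [h.finrank_cyclotomicField (lengthOf_pos _) (coprime_lengthOf _), length_eq_chooseD p h]

theorem correct_of_canReturn {rounds N n : ℕ} (hN : 0 < N) {f : ℚ_[p][X]}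
    (hf : f.natDegree < chooseS p N) {out : Output p}
    (h : (padicFFT p rounds N n f).CanReturn out) :
    Correct p (chooseS p N) (chooseD p N) n f out := by
  have : CharP (AlgebraicClosure (ZMod p)) p := charP_of_injective_algebraMap
    (algebraMap (ZMod p) (AlgebraicClosure (ZMod p))).injective p
  rw [padicFFT_eq] at h
  obtain ⟨fY, hfY, h⟩ := h.of_bind
  obtain ⟨α, hα, h⟩ := h.of_bind
  obtain ⟨v, hv, h⟩ := h.of_bind
  obtain rfl := hα.of_lift
  obtain rfl := hv.of_lift
  obtain rfl := h.of_pure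
  obtain ⟨y, hy⟩ := (cyclotomicFactor_chooseS p rounds N hN).1 fY hfY
  rw [← length_eq_chooseD p hy]
  exact hy.correct (lengthOf_pos _) (coprime_lengthOf _) n hf

theorem cutOffProb_padicFFT_le (rounds N n : ℕ) (f : ℚ_[p][X]) :
    (padicFFT p rounds N n f).cutOffProb ≤
      (cyclotomicFactor p rounds (chooseS p N)).cutOffProb := by
  rw [padicFFT_eq]
  refine (Rand.cutOffProb_bind_le (B := 0) fun fY _ => ?_).trans_eq (add_zero _)
  rw [Rand.cutOffProb_lift_bind, Rand.cutOffProb_lift_bind, Rand.cutOffProb_pure]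

theorem transform_ops_le {N : ℕ} (hN : 0 < N) (f : ℚ_[p][X]) {F z : List ℚ_[p]}
    (hF : F.length = chooseD p N) (hz : z.length = chooseD p N) :
    (transform p F (chooseS p N) z f).ops ≤ N * (20 * width p N ^ 6) := by
  have hd : 0 < chooseD p N := Finset.prod_pos fun i _ => (prime_nth i).pos
  have hF0 : 0 < F.length := hF ▸ hd
  have h := (quotVal_models (monicOf_eq F) hF0).fft_ops (w := width p N)
    (chooseS p N).primeFactorsList (fun m hm => ?_) (hz.trans hF.symm)
    (a := (List.range (chooseS p N)).map fun j =>
      (Arith.base ℚ_[p]).const F.length (f.coeff j)) (by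
        intro x hx
        obtain ⟨j, -, rfl⟩ := List.mem_map.1 hx
        exact Arith.Models.const_length hF0)
  · refine h.trans ?_
    rw [Nat.prod_primeFactorsList (show chooseS p N ≠ 0 from (lengthOf_pos _).ne'), hF]
    calc chooseS p N * ((chooseS p N).primeFactorsList.length *
          (5 * width p N * (4 * chooseD p N ^ 2)))
        ≤ (N * width p N) * (width p N * (5 * width p N * (4 * width p N ^ 2))) := by
          gcongr
          · exact chooseS_le_width N hN
          · exact length_primeFactorsList_chooseS_le N
          · exact chooseD_le_width N
      _ = N * (20 * width p N ^ 5) := by ring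
      _ ≤ _ := by
          have hw : 1 ≤ width p N := hd.trans_le (chooseD_le_width N)
          gcongr
          norm_num
  · have hm' := Nat.prime_of_mem_primeFactorsList hm
    have := prime_succ_le_width N hN hm' (Nat.dvd_of_mem_primeFactorsList hm)
    exact ⟨hm'.pos, by omega⟩

theorem liftRoot_ops_le {Ω : Type*} [Field Ω] [Algebra (ZMod p) Ω] [CharP Ω p] {N : ℕ}
    {fY : List (ZMod p)} {y : Ω} (h : IsCyclotomicFactor (chooseS p N) fY y) (n : ℕ) :
    (liftRoot p (liftCoeffs fY) (chooseS p N) n).val.length = chooseD p N ∧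
      (liftRoot p (liftCoeffs fY) (chooseS p N) n).ops ≤
        3 * width p N + n * (30 * width p N ^ 3) := by
  obtain ⟨z, -, -, -, hroot⟩ := h.exists_root (lengthOf_pos _) (coprime_lengthOf _)
  obtain ⟨h1, -, h2⟩ := hroot n
  have hd : 0 < chooseD p N := Finset.prod_pos fun i _ => (prime_nth i).pos
  have hdw := chooseD_le_width (p := p) N
  have hsw := size_chooseS_le_width (p := p) N
  rw [length_eq_chooseD p h] at h1 h2
  refine ⟨h1, h2.trans ?_⟩
  have hw : 1 ≤ width p N := hd.trans_le hdw
  have hw2 : width p N * 1 ≤ width p N * width p N ^ 2 :=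
    Nat.mul_le_mul_left _ (Nat.one_le_pow _ _ hw)
  have hw3 : width p N ^ 2 * 1 ≤ width p N ^ 2 * width p N := Nat.mul_le_mul_left _ hw
  have key : (2 * (chooseS p N).size + 5) * (4 * chooseD p N ^ 2) + 2 * chooseD p N ≤
      30 * width p N ^ 3 := by
    calc _ ≤ (2 * width p N + 5) * (4 * width p N ^ 2) + 2 * width p N := by gcongr
      _ ≤ _ := by nlinarith
  have := Nat.mul_le_mul_left n key
  omega

theorem expectedOps_padicFFT_le {N : ℕ} (hN : 0 < N) (rounds n : ℕ) (f : ℚ_[p][X]) :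
    (padicFFT p rounds N n f).expectedOps ≤ ((N + n) * (1000 * width p N ^ 7) : ℕ) := by
  have : CharP (AlgebraicClosure (ZMod p)) p := charP_of_injective_algebraMap
    (algebraMap (ZMod p) (AlgebraicClosure (ZMod p))).injective p
  obtain ⟨h1, h2, -⟩ := cyclotomicFactor_chooseS p rounds N hN
  rw [padicFFT_eq]
  refine (Rand.expectedOps_bind_le (B := ((3 * width p N + n * (30 * width p N ^ 3) +
    N * (20 * width p N ^ 6) : ℕ) : ℝ≥0∞)) fun fY hfY => ?_).trans ?_
  · obtain ⟨y, hy⟩ := h1 fY hfY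
    obtain ⟨l1, l2⟩ := liftRoot_ops_le p hy n
    rw [Rand.expectedOps_lift_bind, Rand.expectedOps_lift_bind, Rand.expectedOps_pure, add_zero,
      ← Nat.cast_add, Nat.cast_le]
    refine Nat.add_le_add l2 (transform_ops_le p hN f ?_ ?_)
    · rw [length_toPadic, length_liftCoeffs, length_eq_chooseD p hy]
    · rw [length_toPadic, l1]
  · refine (add_le_add_left h2 _).trans ?_
    rw [← Nat.cast_add, Nat.cast_le]
    have hd : 0 < chooseD p N := Finset.prod_pos fun i _ => (prime_nth i).pos
    have hw : 1 ≤ width p N := hd.trans_le (chooseD_le_width N)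
    set w := width p N
    have a1 : (chooseS p N).primeFactorsList.length * (924 * w ^ 6) ≤ N * (924 * w ^ 7) := by
      calc _ ≤ w * (924 * w ^ 6) :=
            Nat.mul_le_mul_right _ (length_primeFactorsList_chooseS_le N)
        _ = 1 * (924 * w ^ 7) := by ring
        _ ≤ _ := Nat.mul_le_mul_right _ hN
    have a2 : 3 * w ≤ N * (3 * w ^ 7) := by
      calc 3 * w ≤ 1 * (3 * w ^ 7) := by
            rw [one_mul]
            exact Nat.mul_le_mul_left _ (Nat.le_self_pow (by norm_num) _)
        _ ≤ _ := Nat.mul_le_mul_right _ hN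
    have a3 : n * (30 * w ^ 3) ≤ n * (1000 * w ^ 7) := by
      gcongr <;> norm_num
    have a4 : N * (20 * w ^ 6) ≤ N * (20 * w ^ 7) := by
      gcongr
      norm_num
    -- 924 comes from the factorization over 𝔽_p, 3 from starting the lift, 20 from the transform;
    -- 53 is slack.
    have e : (N + n) * (1000 * w ^ 7) = N * (924 * w ^ 7) + N * (3 * w ^ 7) + N * (20 * w ^ 7) +
        N * (53 * w ^ 7) + n * (1000 * w ^ 7) := by ring
    omega

end Main

end PadicFFT

theorem mainTheorem2 (p : ℕ) [Fact p.Prime] :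
    (∀ N : ℕ, 0 < N →
      IsLeast {r | 0 < r ∧ N < PadicFFT.lengthOf p r} (PadicFFT.chooseR p N) ∧
      Module.finrank ℚ_[p] (CyclotomicField (PadicFFT.chooseS p N) ℚ_[p]) =
        PadicFFT.chooseD p N ∧
      ∀ (n : ℕ) (f : Polynomial ℚ_[p]), f.natDegree < PadicFFT.chooseS p N →
        (∀ (rounds : ℕ) (out : PadicFFT.Output p),
          (PadicFFT.padicFFT p rounds N n f).CanReturn out →
            PadicFFT.Correct p (PadicFFT.chooseS p N) (PadicFFT.chooseD p N) n f out) ∧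
        Filter.Tendsto (fun rounds => (PadicFFT.padicFFT p rounds N n f).cutOffProb)
          Filter.atTop (nhds 0)) ∧
    ∀ ε : ℝ, 0 < ε → ∃ C : ℝ, ∀ N : ℕ, 0 < N →
      ∀ f : Polynomial ℚ_[p], f.natDegree < PadicFFT.chooseS p N →
        (∀ F z : List ℚ_[p], F.length = PadicFFT.chooseD p N → z.length = PadicFFT.chooseD p N →
          ((PadicFFT.transform p F (PadicFFT.chooseS p N) z f).ops : ℝ) ≤ C * (N : ℝ) ^ (1 + ε)) ∧
        ∀ n rounds : ℕ,
          (PadicFFT.padicFFT p rounds N n f).expectedOps ≤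
            ENNReal.ofReal (C * ((N : ℝ) ^ (1 + ε) + n * (N : ℝ) ^ ε)) := by
  refine ⟨fun N hN => ⟨PadicFFT.isLeast_chooseR N hN, PadicFFT.finrank_cyclotomicField p N hN,
    fun n f hf => ⟨fun rounds out h => PadicFFT.correct_of_canReturn p hN hf h, ?_⟩⟩,
    fun ε hε => ?_⟩
  · exact tendsto_of_tendsto_of_tendsto_of_le_of_le tendsto_const_nhds
      (PadicFFT.tendsto_cutOffProb_cyclotomicFactor p N hN) (fun _ => zero_le)
      fun rounds => PadicFFT.cutOffProb_padicFFT_le p rounds N n f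
  · obtain ⟨C, hC, hw⟩ := PadicFFT.exists_width_pow_le p hε 7
    refine ⟨1000 * C, fun N hN f _ => ?_⟩
    have hN0 : (0 : ℝ) < N := by exact_mod_cast hN
    have hpow : (N : ℝ) ^ (1 + ε) = N * (N : ℝ) ^ ε := by
      rw [Real.rpow_add hN0, Real.rpow_one]
    have hw7 := hw N hN
    refine ⟨fun F z hF hz => ?_, fun n rounds => ?_⟩
    · have h1 := PadicFFT.transform_ops_le p hN f hF hz
      have hd : 0 < PadicFFT.chooseD p N := Finset.prod_pos fun i _ => (PadicFFT.prime_nth i).pos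
      have h2 : N * (20 * PadicFFT.width p N ^ 6) ≤ N * (1000 * PadicFFT.width p N ^ 7) := by
        have hw1 : 1 ≤ PadicFFT.width p N := hd.trans_le (PadicFFT.chooseD_le_width N)
        gcongr <;> norm_num
      have h3 : ((PadicFFT.transform p F (PadicFFT.chooseS p N) z f).ops : ℝ) ≤
          N * (1000 * (PadicFFT.width p N : ℝ) ^ 7) := by exact_mod_cast h1.trans h2
      refine h3.trans ?_
      rw [hpow]
      have := mul_le_mul_of_nonneg_left hw7 hN0.le
      nlinarith
    · refine (PadicFFT.expectedOps_padicFFT_le p hN rounds n f).trans ?_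
      rw [← ENNReal.ofReal_natCast]
      refine ENNReal.ofReal_le_ofReal ?_
      push_cast
      rw [hpow]
      have := mul_le_mul_of_nonneg_left hw7 (add_nonneg hN0.le (Nat.cast_nonneg n))
      nlinarith
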